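/- **Setting.** Let $\Omega\subset\mathbb R^2$ be a bounded connected open set with Lipschitz boundary, $\partial_D\Omega\subset\partial\Omega$ closed with $\mathcal H^1(\partial_D\Omega)>0$, $\partial_N\Omega=\partial\Omega\setminus\partial_D\Omega$. Let $0<\sigma_0<\sigma_1<\bar\sigma<\sigma_{max}$ and let $\gamma\in C^3([0,\sigma_{max}];\mathbb R^2)$ be injective, parametrized by arc length, with $\gamma(0),\gamma(\sigma_{max})\in\partial_N\Omega$ and $\gamma(s)\in\Omega$ for $0<s<\sigma_{max}$. Put $\Gamma=\gamma([0,\sigma_{max}])$ and $\Gamma(\sigma)=\gamma([0,\sigma])$. Assume that $\Omega\setminus\Gamma$ is the disjoint union of two connected open sets $\Omega^\pm$ with Lipschitz boundary such that $\mathcal H^1(\partial_D\Omega\cap\partial\Omega^\pm)>0$. Let $V$ be the space of all $v\in H^1(\Omega\setminus\Gamma(\sigma_0))$ with zero trace $\mathcal H^1$-a.e. on $\partial_D\Omega$, with $(v,w)_V=\int_{\Omega\setminus\Gamma(\sigma_0)} (Dv|Dw)\,dx$ and $\|v\|_V=\|Dv\|_{L^2}$. For $\sigma\in[\sigma_0,\bar\sigma]$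 let $\Phi_\sigma:\Omega\to\Omega$ be a $C^1$ diffeomorphism equal to the identity near $\partial\Omega$, with $\Phi_\sigma(\Omega^\pm)=\Omega^\pm$ and $\Phi_\sigma(\Gamma(\sigma))=\Gamma(\sigma_0)$; let $\Psi_\sigma=\Phi_\sigma^{-1}$ and $A(\sigma)=\det D\Psi_\sigma\,(D\Psi_\sigma)^{-1}(D\Psi_\sigma)^{-T}$, and assume that $\sigma\mapsto a_{ij}(\sigma)$ is of class $C^2$ from $[\sigma_0,\bar\sigma]$ to $C(\overline\Omega)$. Let $T>0$, $\psi\in W^{1,\infty}(0,T;H^1(\Omega))\cap L^\infty(0,T;L^\infty(\Omega))$ and $g\in W^{1,\infty}(0,T;L^2(\partial_N\Omega,\mathcal H^1))$ (continuous representatives in $t$) be such that for every $t\in[0,T]$ the support of $\psi(t)$ is contained in the set where $\Psi_\sigma$ is the identity for all $\sigma\in[\sigma_0,\bar\sigma]$, and the support of $g(t)$ does not meet $\Gamma$. For $t\in[0,T]$, $v\in V$, $\sigma\in[\sigma_0,\bar\sigma]$ let $$\mathcal F(t,v,\sigma)=\int_{\Omega\setminus\Gamma(\sigma_0)}\sum_{i,j}a_{ij}(\sigma)D_j(v+\psi(t))D_i(v+\psi(t))\,dx+\sigma-\int_{\partial_N\Omega}g(t)(v+\psi(t))\,d\mathcal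 H^1 ,$$ let $\mathrm{grad}_v\mathcal F(t,v,\sigma)\in V$ represent the differential of $\mathcal F(t,\cdot,\sigma)$ at $v$ through $(\cdot,\cdot)_V$, and let $\partial_\sigma\mathcal F$ and $\partial^2_{(v,\sigma)}\mathcal F$ be the derivative in $\sigma$ and the second differential of $\mathcal F(t,\cdot,\cdot)$ on $V\times[\sigma_0,\bar\sigma]$ (one-sided in $\sigma$ at the endpoints). For $u_0\in V$ and $\varepsilon>0$, a solution of the modified $\varepsilon$-gradient flow with initial data $(u_0,\sigma_0)$ is a pair $v_\varepsilon\in C^1([0,T];V)$, $\sigma_\varepsilon\in C^1([0,T];[\sigma_0,\bar\sigma])$ with $\sigma_\varepsilon$ nondecreasing, $v_\varepsilon(0)=u_0$, $\sigma_\varepsilon(0)=\sigma_0$ and, on $[0,T]$, $$\varepsilon\dot v_\varepsilon=-\mathrm{grad}_v\mathcal F(t,v_\varepsilon,\sigma_\varepsilon),\qquad \varepsilon\dot\sigma_\varepsilon=(-\partial_\sigma\mathcal F(t,v_\varepsilon,\sigma_\varepsilon))^+\lambda(\sigma_\varepsilon),\qquad \lambda(\sigma)=\frac{(\bar\sigma-(\sigma\vee\sigma_1))^+}{\bar\sigma-\sigma_1}.$$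 **Theorem.** Let $(t^0,v^0,\sigma^0)\in[0,T[\,\times V\times[\sigma_0,\sigma_1[$ satisfy $\mathrm{grad}_v\mathcal F(t^0,v^0,\sigma^0)=0$ and $\partial_\sigma\mathcal F(t^0,v^0,\sigma^0)=0$, and suppose that for some $\alpha>0$ $$\langle\langle\partial^2_{(v,\sigma)}\mathcal F(t^0,v^0,\sigma^0)(w,\tau),(w,\tau)\rangle\rangle\ge\alpha(\|w\|_V^2+|\tau|^2)\qquad\forall w\in V,\ \tau\in\mathbb R .$$ For an interval $[t^0,t^1]$ and $I\subset[\sigma_0,\sigma_1]$, call a branch in $I$ any Lipschitz function $(v^0(\cdot),\sigma^0(\cdot)):[t^0,t^1]\to V\times I$ with $(v^0(t^0),\sigma^0(t^0))=(v^0,\sigma^0)$ and $\mathrm{grad}_v\mathcal F(t,v^0(t),\sigma^0(t))=0$, $\partial_\sigma\mathcal F(t,v^0(t),\sigma^0(t))=0$ for all $t\in[t^0,t^1]$. Then there is $t_{max}\in\,]t^0,T]$ such that for every $t^1\in\,]t^0,t_{max}]$: 1. if $\sigma^0>\sigma_0$, there exists a branch in $[\sigma_0,\sigma_1]$ on $[t^0,t^1]$;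 2. there is at most one branch in $[\sigma_0,\sigma_1]$ on $[t^0,t^1]$; 3. let $u_0\in V$ and, for every $\varepsilon>0$, let $(v_\varepsilon,\sigma_\varepsilon)$ be a solution of the modified $\varepsilon$-gradient flow with initial data $(u_0,\sigma_0)$, such that $v_\varepsilon(t^0)\to v^0$ in $V$ and $\sigma_\varepsilon(t^0)\to\sigma^0$ as $\varepsilon\to0$. If, for all sufficiently small $\varepsilon>0$, $\dot\sigma_\varepsilon(t)>0$ for every $t\in\,]t^0,t^1]$ and $\sigma_\varepsilon(t)<\sigma_1$ for every $t\in[t^0,t^1]$, then there exists a branch $(v^0(\cdot),\sigma^0(\cdot))$ in $[\sigma^0,\sigma_1]$ on $[t^0,t^1]$ (including when $\sigma^0=\sigma_0$), and $v_\varepsilon(t)\to v^0(t)$ strongly in $V$ and $\sigma_\varepsilon(t)\to\sigma^0(t)$ for every $t\in[t^0,t^1]$. -/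

import Mathlib

open MeasureTheory Set Filter Topology
open scoped ContDiff Convolution NNReal ENNReal

namespace CrackGrowth

/-- The Euclidean plane. -/
abbrev Plane : Type := EuclideanSpace ℝ (Fin 2)

/-- `G` is the distributional gradient of `u` on the open set `U`. -/
def HasWeakGradient (U : Set Plane) (u : Plane → ℝ) (G : Plane → Plane) : Prop :=
  ∀ φ : Plane → ℝ, ContDiff ℝ ∞ φ → HasCompactSupport φ → tsupport φ ⊆ U →
    ∀ e : Plane, ∫ x in U, u x * fderiv ℝ φ x e = -∫ x in U, inner ℝ (G x) e * φ x

lemma integrable_mul_of_test {U : Set Plane} {f : Plane → ℝ}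
    (hf : MemLp f 2 (volume.restrict U)) {h : Plane → ℝ} (hc : Continuous h)
    (hs : HasCompactSupport h) : Integrable (fun x => f x * h x) (volume.restrict U) :=
  hf.integrable_mul (q := 2) (hc.memLp_of_hasCompactSupport hs)

lemma test_fderiv {φ : Plane → ℝ} (h : ContDiff ℝ ∞ φ) (hs : HasCompactSupport φ) (e : Plane) :
    Continuous (fun x => fderiv ℝ φ x e) ∧ HasCompactSupport (fun x => fderiv ℝ φ x e) := by
  refine ⟨(h.continuous_fderiv (by simp)).clm_apply continuous_const, ?_⟩
  exact hs.fderiv_apply ℝ e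

/-- Pairs (function, vector field) in `L²(U) × L²(U; ℝ²)` with the Hilbert norm. -/
abbrev GradPair (U : Set Plane) : Type :=
  WithLp 2 (Lp ℝ 2 (volume.restrict U) × Lp Plane 2 (volume.restrict U))

lemma memLp_inner_const {U : Set Plane} (G : Lp Plane 2 (volume.restrict U)) (e : Plane) :
    MemLp (fun x => inner ℝ (G x) e) 2 (volume.restrict U) :=
  (Lp.memLp G).inner_const e

/-- The Sobolev space `H¹(U)` with its usual norm: an element is a function `u ∈ L²(U)` (first
component) together with its distributional gradient `Du ∈ L²(U; ℝ²)` (second component). -/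
def H1 (U : Set Plane) : Submodule ℝ (GradPair U) where
  carrier := {p | HasWeakGradient U p.fst p.snd}
  zero_mem' := by
    intro φ h hs hU e
    have h1 : ∫ x in U, ((0 : GradPair U).fst : Plane → ℝ) x * fderiv ℝ φ x e = 0 := by
      refine integral_eq_zero_of_ae ?_
      filter_upwards [Lp.coeFn_zero ℝ 2 (volume.restrict U)] with x hx
      simp only [WithLp.zero_fst, hx, Pi.zero_apply, zero_mul]
    have h2 : ∫ x in U, inner ℝ (((0 : GradPair U).snd : Plane → Plane) x) e * φ x = 0 := by
      refine integral_eq_zero_of_ae ?_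
      filter_upwards [Lp.coeFn_zero Plane 2 (volume.restrict U)] with x hx
      simp only [WithLp.zero_snd, hx, Pi.zero_apply, inner_zero_left, zero_mul]
    rw [h1, h2, neg_zero]
  add_mem' := by
    intro p q hp hq φ h hs hU e
    obtain ⟨c1, c2⟩ := test_fderiv h hs e
    have h1 : ∫ x in U, ((p + q).fst : Plane → ℝ) x * fderiv ℝ φ x e
        = ∫ x in U, (p.fst x * fderiv ℝ φ x e + q.fst x * fderiv ℝ φ x e) := by
      refine integral_congr_ae ?_
      filter_upwards [Lp.coeFn_add p.fst q.fst] with x hx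
      simp only [WithLp.add_fst, hx, Pi.add_apply, add_mul]
    have h2 : ∫ x in U, inner ℝ (((p + q).snd : Plane → Plane) x) e * φ x
        = ∫ x in U, (inner ℝ (p.snd x) e * φ x + inner ℝ (q.snd x) e * φ x) := by
      refine integral_congr_ae ?_
      filter_upwards [Lp.coeFn_add p.snd q.snd] with x hx
      simp only [WithLp.add_snd, hx, Pi.add_apply, inner_add_left, add_mul]
    rw [h1, h2, integral_add (integrable_mul_of_test (Lp.memLp _) c1 c2)
        (integrable_mul_of_test (Lp.memLp _) c1 c2),
      integral_add (integrable_mul_of_test (memLp_inner_const _ e) h.continuous hs)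
        (integrable_mul_of_test (memLp_inner_const _ e) h.continuous hs),
      hp φ h hs hU e, hq φ h hs hU e, neg_add]
  smul_mem' := by
    intro c p hp φ h hs hU e
    have h1 : ∫ x in U, ((c • p).fst : Plane → ℝ) x * fderiv ℝ φ x e
        = ∫ x in U, c * (p.fst x * fderiv ℝ φ x e) := by
      refine integral_congr_ae ?_
      filter_upwards [Lp.coeFn_smul c p.fst] with x hx
      simp only [WithLp.smul_fst, hx, Pi.smul_apply, smul_eq_mul, mul_assoc]
    have h2 : ∫ x in U, inner ℝ (((c • p).snd : Plane → Plane) x) e * φ x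
        = ∫ x in U, c * (inner ℝ (p.snd x) e * φ x) := by
      refine integral_congr_ae ?_
      filter_upwards [Lp.coeFn_smul c p.snd] with x hx
      simp only [WithLp.smul_snd, hx, Pi.smul_apply, real_inner_smul_left, mul_assoc]
    rw [h1, h2, integral_const_mul, integral_const_mul, hp φ h hs hU e, mul_neg]

lemma ae_const_ball {U : Set Plane} (hU : IsOpen U) {u : Plane → ℝ}
    (hu : MemLp u 2 (volume.restrict U))
    (hw : ∀ φ : Plane → ℝ, ContDiff ℝ ∞ φ → HasCompactSupport φ → tsupport φ ⊆ U →
      ∀ e : Plane, ∫ x in U, u x * fderiv ℝ φ x e = 0) {x₀ : Plane} (hx₀ : x₀ ∈ U) :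
    ∃ c : ℝ, ∃ δ > 0, Metric.ball x₀ δ ⊆ U ∧ ∀ᵐ x, x ∈ Metric.ball x₀ δ → u x = c := by
  obtain ⟨δ, hδ, hball⟩ := Metric.isOpen_iff.1 hU x₀ hx₀
  set f : Plane → ℝ := U.indicator u with hf
  have hfL : MemLp f 2 volume := by
    rw [hf, memLp_indicator_iff_restrict hU.measurableSet]; exact hu
  have hfl : LocallyIntegrable f volume := hfL.locallyIntegrable (by norm_num)
  let B : ℕ → ContDiffBump (0 : Plane) := fun n =>
    ⟨δ / 4 / (n + 1), δ / 2 / (n + 1), by positivity, by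
      have : (0 : ℝ) < n + 1 := by positivity
      gcongr; norm_num⟩
  have hout : Tendsto (fun n => (B n).rOut) atTop (𝓝 0) := by
    have := (tendsto_one_div_add_atTop_nhds_zero_nat (𝕜 := ℝ)).const_mul (δ / 2)
    simp only [mul_zero] at this
    refine this.congr fun n => ?_
    change δ / 2 * (1 / ((n : ℝ) + 1)) = δ / 2 / (n + 1)
    ring
  have hlim := ContDiffBump.ae_convolution_tendsto_right_of_locallyIntegrable (μ := volume)
    (φ := B) (l := atTop) (K := 2) hout (Eventually.of_forall fun n => by
      change δ / 2 / ((n : ℝ) + 1) ≤ 2 * (δ / 4 / (n + 1))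
      apply le_of_eq; ring) hfl
  have hrle : ∀ n, (B n).rOut ≤ δ / 2 := fun n => by
    change δ / 2 / ((n : ℝ) + 1) ≤ δ / 2
    apply div_le_self (by positivity)
    have : (0 : ℝ) ≤ n := by positivity
    linarith
  -- the mollified functions are constant on the half ball
  have hconst : ∀ n, ∀ x ∈ Metric.ball x₀ (δ / 2), ∀ y ∈ Metric.ball x₀ (δ / 2),
      ((B n).normed volume ⋆[ContinuousLinearMap.lsmul ℝ ℝ, volume] f) x
        = ((B n).normed volume ⋆[ContinuousLinearMap.lsmul ℝ ℝ, volume] f) y := by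
    intro n
    set g : Plane → ℝ := (B n).normed volume with hg
    have hgs : HasCompactSupport g := (B n).hasCompactSupport_normed
    have hgc : ContDiff ℝ ∞ g := (B n).contDiff_normed
    have hflip : (g ⋆[ContinuousLinearMap.lsmul ℝ ℝ, volume] f)
        = (f ⋆[ContinuousLinearMap.lsmul ℝ ℝ, volume] g) := by
      ext x
      rw [convolution_eq_swap, convolution_def]
      simp [mul_comm]
    rw [hflip]
    have hd : ∀ x, HasFDerivAt (f ⋆[ContinuousLinearMap.lsmul ℝ ℝ, volume] g)
        ((f ⋆[(ContinuousLinearMap.lsmul ℝ ℝ).precompR Plane, volume] fderiv ℝ g) x) x := fun x =>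
      hgs.hasFDerivAt_convolution_right _ hfl (hgc.of_le (by simp)) x
    have hz : ∀ x ∈ Metric.ball x₀ (δ / 2),
        (f ⋆[(ContinuousLinearMap.lsmul ℝ ℝ).precompR Plane, volume] fderiv ℝ g) x = 0 := by
      intro x hx
      ext e
      rw [convolution_precompR_apply _ hfl (hgs.fderiv ℝ) (hgc.continuous_fderiv (by simp)),
        convolution_def]
      set φ : Plane → ℝ := fun t => g (x - t) with hφ
      have hφc : ContDiff ℝ ∞ φ := hgc.comp (contDiff_const.sub contDiff_id)
      have hts : tsupport φ ⊆ Metric.closedBall x (δ / 2) := by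
        refine closure_minimal ?_ Metric.isClosed_closedBall
        intro t ht
        have h1 : x - t ∈ Function.support g := ht
        rw [hg, ContDiffBump.support_normed_eq] at h1
        have h2 : ‖x - t‖ < (B n).rOut := by simpa using h1
        rw [Metric.mem_closedBall, dist_comm, dist_eq_norm]
        exact (h2.trans_le (hrle n)).le
      have hφs : HasCompactSupport φ :=
        (isCompact_closedBall x (δ / 2)).of_isClosed_subset (isClosed_tsupport _) hts
      have hU' : tsupport φ ⊆ U := by
        refine hts.trans (Subset.trans ?_ hball)
        intro t ht
        rw [Metric.mem_closedBall] at ht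
        rw [Metric.mem_ball] at hx ⊢
        linarith [dist_triangle t x x₀]
      have hder : ∀ t, fderiv ℝ φ t e = - fderiv ℝ g (x - t) e := by
        intro t
        have h1 : HasFDerivAt (fun t : Plane => x - t) (-(ContinuousLinearMap.id ℝ Plane)) t :=
          (hasFDerivAt_id t).const_sub x
        have h2 := ((hgc.differentiable (by simp)) (x - t)).hasFDerivAt.comp t h1
        have h3 : fderiv ℝ φ t = _ := h2.fderiv
        rw [h3]; simp
      have key := hw φ hφc hφs hU' e
      rw [← integral_indicator hU.measurableSet] at key
      have : ∫ t, (ContinuousLinearMap.lsmul ℝ ℝ) (f t) (fderiv ℝ g (x - t) e)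
          = - ∫ t, U.indicator (fun t => u t * fderiv ℝ φ t e) t := by
        rw [← integral_neg]
        refine integral_congr_ae (Eventually.of_forall fun t => ?_)
        by_cases ht : t ∈ U
        · simp [hf, ht, hder]
        · simp [hf, ht]
      simpa [key] using this
    intro x hx y hy
    refine (convex_ball x₀ (δ / 2)).is_const_of_fderivWithin_eq_zero (𝕜 := ℝ)
      (fun z _ => (hd z).differentiableAt.differentiableWithinAt) (fun z hz' => ?_) hx hy
    rw [fderivWithin_of_isOpen Metric.isOpen_ball hz', (hd z).fderiv, hz z hz']
  have hsub : Metric.ball x₀ (δ / 2) ⊆ U :=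
    (Metric.ball_subset_ball (by linarith)).trans hball
  have hne : ∃ x ∈ Metric.ball x₀ (δ / 2), Tendsto (fun n =>
      ((B n).normed volume ⋆[ContinuousLinearMap.lsmul ℝ ℝ, volume] f) x) atTop (𝓝 (f x)) := by
    by_contra! hcon
    have h0 : volume (Metric.ball x₀ (δ / 2)) = 0 :=
      measure_mono_null (fun x hx => hcon x hx) (ae_iff.1 hlim)
    exact (Metric.measure_ball_pos volume x₀ (half_pos hδ)).ne' h0
  obtain ⟨y, hy, hty⟩ := hne
  refine ⟨f y, δ / 2, half_pos hδ, hsub, ?_⟩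
  filter_upwards [hlim] with x hx hxb
  have h1 : f x = f y := tendsto_nhds_unique hx
    (hty.congr fun n => hconst n y hy x hxb)
  rw [← h1, hf, indicator_of_mem (hsub hxb)]

lemma ae_const_of_isPreconnected {U W : Set Plane} (hU : IsOpen U) (hW : IsOpen W) (hWU : W ⊆ U)
    (hWc : IsPreconnected W) {u : Plane → ℝ}
    (hu : MemLp u 2 (volume.restrict U))
    (hw : ∀ φ : Plane → ℝ, ContDiff ℝ ∞ φ → HasCompactSupport φ → tsupport φ ⊆ U →
      ∀ e : Plane, ∫ x in U, u x * fderiv ℝ φ x e = 0) :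
    ∃ c : ℝ, ∀ᵐ x, x ∈ W → u x = c := by
  rcases W.eq_empty_or_nonempty with rfl | ⟨x₁, hx₁⟩
  · exact ⟨0, by simp⟩
  obtain ⟨c, δ₁, hδ₁, -, hc⟩ := ae_const_ball hU hu hw (hWU hx₁)
  let P : ℝ → Set Plane := fun a => {x | ∃ δ > 0, ∀ᵐ y, y ∈ Metric.ball x δ → u y = a}
  have hPo : ∀ a, IsOpen (P a) := by
    intro a
    rw [Metric.isOpen_iff]
    rintro x ⟨δ, hδ, h⟩
    refine ⟨δ, hδ, fun z hz => ⟨δ - dist z x, by simpa using hz, ?_⟩⟩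
    filter_upwards [h] with y hy hyz
    refine hy (Metric.ball_subset_ball' (by linarith) hyz)
  have hPd : ∀ a b x, x ∈ P a → x ∈ P b → a = b := by
    rintro a b x ⟨δ, hδ, h⟩ ⟨δ', hδ', h'⟩
    by_contra hab
    have h0 : volume (Metric.ball x (min δ δ')) = 0 := by
      refine measure_mono_null (fun y hy => ?_) (ae_iff.1 (h.and h'))
      intro hyy
      exact hab ((hyy.1 (Metric.ball_subset_ball (min_le_left _ _) hy)).symm.trans
        (hyy.2 (Metric.ball_subset_ball (min_le_right _ _) hy)))
    exact (Metric.measure_ball_pos volume x (lt_min hδ hδ')).ne' h0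
  have hall : W ⊆ P c := by
    by_contra hnot
    obtain ⟨x₂, hx₂, hx₂c⟩ := not_subset.1 hnot
    have hcov : W ⊆ P c ∪ ⋃ a ∈ {a : ℝ | a ≠ c}, P a := by
      intro x hx
      obtain ⟨a, δ, hδ, -, ha⟩ := ae_const_ball hU hu hw (hWU hx)
      by_cases hac : a = c
      · left; exact ⟨δ, hδ, hac ▸ ha⟩
      · right; exact mem_biUnion (show a ∈ {a : ℝ | a ≠ c} from hac) ⟨δ, hδ, ha⟩
    have h2 : x₂ ∈ ⋃ a ∈ {a : ℝ | a ≠ c}, P a := (hcov hx₂).resolve_left hx₂c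
    obtain ⟨z, -, hz1, hz2⟩ := hWc (P c) (⋃ a ∈ {a : ℝ | a ≠ c}, P a) (hPo c)
      (isOpen_biUnion fun a _ => hPo a) hcov ⟨x₁, hx₁, δ₁, hδ₁, hc⟩ ⟨x₂, hx₂, h2⟩
    obtain ⟨a, hac, hza⟩ := mem_iUnion₂.1 hz2
    exact hac (hPd a c z hza hz1)
  refine ⟨c, ?_⟩
  rw [ae_iff]
  refine measure_null_of_locally_null _ fun x hx => ?_
  have hxW : x ∈ W := by
    by_contra h; exact hx fun h' => absurd h' h
  obtain ⟨δ, hδ, h⟩ := hall hxW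
  refine ⟨Metric.ball x δ ∩ {a | ¬(a ∈ W → u a = c)}, ?_, ?_⟩
  · rw [inter_comm]; exact inter_mem_nhdsWithin _ (Metric.ball_mem_nhds x hδ)
  · refine measure_mono_null (fun y hy => ?_) (ae_iff.1 h)
    intro hyy
    exact hy.2 fun _ => hyy hy.1


/-- Near each boundary point, up to a rigid motion, `U` is the region strictly above the graph of a
Lipschitz function. -/
def HasLipschitzBoundary (U : Set Plane) : Prop :=
  ∀ x ∈ frontier U, ∃ (e : Plane ≃ₗᵢ[ℝ] Plane) (φ : ℝ → ℝ) (K : ℝ≥0) (r : ℝ),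
    LipschitzWith K φ ∧ 0 < r ∧ ∀ z ∈ Metric.ball x r, z ∈ U ↔ φ (e z 0) < e z 1

/-- The trace of `u`, a function on the domain `U`, at the boundary point `x` exists and equals `c`:
the averages of `u` over `B(x, r) ∩ U` tend to `c`. For a Sobolev function on a Lipschitz domain this
limit exists, and is the usual trace, at `ℋ¹`-almost every boundary point. -/
def HasTrace (U : Set Plane) (u : Plane → ℝ) (x : Plane) (c : ℝ) : Prop :=
  Tendsto (fun r : ℝ => ⨍ y in Metric.ball x r ∩ U, u y) (𝓝[>] 0) (𝓝 c)

/-- The trace of `u` on the boundary of `U`, as a function (see `HasTrace`). -/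
noncomputable def traceFn (U : Set Plane) (u : Plane → ℝ) (x : Plane) : ℝ :=
  limUnder (𝓝[>] (0 : ℝ)) (fun r : ℝ => ⨍ y in Metric.ball x r ∩ U, u y)

lemma dist_le_coord (e : Plane ≃ₗᵢ[ℝ] Plane) (x z : Plane) :
    dist z x ≤ |e z 0 - e x 0| + |e z 1 - e x 1| := by
  rw [← e.dist_map z x, EuclideanSpace.dist_eq, Fin.sum_univ_two, Real.dist_eq, Real.dist_eq]
  apply Real.sqrt_le_iff.2
  refine ⟨by positivity, ?_⟩
  nlinarith [abs_nonneg (e z 0 - e x 0), abs_nonneg (e z 1 - e x 1)]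

lemma coord_le_dist (e : Plane ≃ₗᵢ[ℝ] Plane) (x z : Plane) (i : Fin 2) :
    |e z i - e x i| ≤ dist z x := by
  rw [← e.dist_map z x, dist_eq_norm]
  simpa [Real.norm_eq_abs] using PiLp.norm_apply_le (e z - e x) i

lemma ball_inter_subset_side {Ω C A B : Set Plane} (hΩ : IsOpen Ω)
    (hL : HasLipschitzBoundary Ω) (hC : IsClosed C) (hAB : Ω \ C = A ∪ B)
    (hA : IsOpen A) (hB : IsOpen B) (hd : Disjoint A B) {x : Plane} (hx : x ∈ frontier Ω)
    (hxC : x ∉ C) (hxA : x ∈ closure A) : ∃ ρ > 0, Metric.ball x ρ ∩ Ω ⊆ A := by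
  obtain ⟨e, φ, K, r, hφ, hr, hgraph⟩ := hL x hx
  obtain ⟨r', hr', hdisj⟩ := Metric.isOpen_iff.1 hC.isOpen_compl x hxC
  have hAΩ : A ⊆ Ω := fun z hz => ((hAB.symm ▸ Or.inl hz : z ∈ Ω \ C)).1
  have hφe : Continuous fun z : Plane => φ (e z 0) :=
    hφ.continuous.comp ((EuclideanSpace.proj (𝕜 := ℝ) (0 : Fin 2)).continuous.comp e.continuous)
  have he1 : Continuous fun z : Plane => e z 1 :=
    (EuclideanSpace.proj (𝕜 := ℝ) (1 : Fin 2)).continuous.comp e.continuous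
  have hx0 : φ (e x 0) = e x 1 := by
    apply le_antisymm
    · by_contra hlt
      push Not at hlt
      have hopen : IsOpen {z : Plane | e z 1 < φ (e z 0)} := isOpen_lt he1 hφe
      obtain ⟨z, ⟨hz1, hz2⟩, hzA⟩ := mem_closure_iff.1 hxA _
        (hopen.inter Metric.isOpen_ball) ⟨hlt, Metric.mem_ball_self hr⟩
      have := (hgraph z hz2).1 (hAΩ hzA)
      exact absurd this (not_lt.2 (le_of_lt hz1))
    · by_contra hlt
      push Not at hlt
      have : x ∈ Ω := (hgraph x (Metric.mem_ball_self hr)).2 hlt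
      rw [hΩ.frontier_eq] at hx
      exact hx.2 this
  set R := min r r' with hR
  have hRpos : 0 < R := lt_min hr hr'
  have hK : (0 : ℝ) ≤ K := K.2
  set ρ := R / (2 * (1 + K)) with hρ
  have hρpos : 0 < ρ := by positivity
  have hρR : 2 * (ρ * (1 + K)) = R := by rw [hρ]; field_simp
  have hLip : ∀ a b, |φ a - φ b| ≤ K * |a - b| := fun a b => by
    simpa [Real.dist_eq] using hφ.dist_le_mul a b
  let m : ℝ × ℝ → Plane := fun p => e.symm !₂[p.1, φ p.1 + p.2]
  have hm : Continuous m := by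
    refine e.symm.continuous.comp ((PiLp.continuous_toLp 2 _).comp ?_)
    refine continuous_pi fun i => ?_
    fin_cases i
    · exact continuous_fst
    · exact (hφ.continuous.comp continuous_fst).add continuous_snd
  set Q : Set (ℝ × ℝ) := Ioo (e x 0 - ρ) (e x 0 + ρ) ×ˢ Ioo 0 (ρ * (1 + K)) with hQ
  have hQc : IsPreconnected (m '' Q) :=
    (isPreconnected_Ioo.prod isPreconnected_Ioo).image _ hm.continuousOn
  have hem0 : ∀ p, e (m p) 0 = p.1 := fun p => by simp [m]
  have hem1 : ∀ p, e (m p) 1 = φ p.1 + p.2 := fun p => by simp [m]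
  have hQsub : m '' Q ⊆ A ∪ B := by
    rintro _ ⟨p, ⟨hp1, hp2⟩, rfl⟩
    have ha : |p.1 - e x 0| < ρ := by
      rw [abs_lt]; constructor <;> linarith [hp1.1, hp1.2]
    have hb : |φ p.1 - φ (e x 0)| ≤ K * ρ :=
      (hLip _ _).trans (mul_le_mul_of_nonneg_left ha.le hK)
    have hdist : dist (m p) x < R := by
      refine (dist_le_coord e x (m p)).trans_lt ?_
      rw [hem0, hem1, ← hx0]
      have : |φ p.1 + p.2 - φ (e x 0)| ≤ K * ρ + p.2 := by
        have h3 := abs_le.1 hb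
        rw [abs_le]; constructor <;> linarith [hp2.1, h3.1, h3.2]
      nlinarith [hp2.2]
    rw [← hAB]
    refine ⟨(hgraph _ (lt_of_lt_of_le hdist (min_le_left _ _))).2 ?_,
      hdisj (lt_of_lt_of_le hdist (min_le_right _ _))⟩
    rw [hem0, hem1]; linarith [hp2.1]
  have hball : Metric.ball x ρ ∩ Ω ⊆ m '' Q := by
    rintro z ⟨hz, hzΩ⟩
    have hzd : dist z x < ρ := hz
    have hρR' : ρ ≤ R := by nlinarith
    have hzg := (hgraph z (lt_of_lt_of_le (lt_of_lt_of_le hzd hρR') (min_le_left _ _))).1 hzΩ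
    have h0 := abs_lt.1 ((coord_le_dist e x z 0).trans_lt hzd)
    have h1 := abs_lt.1 ((coord_le_dist e x z 1).trans_lt hzd)
    have hb : |φ (e z 0) - φ (e x 0)| ≤ K * ρ :=
      (hLip _ _).trans (mul_le_mul_of_nonneg_left
        ((coord_le_dist e x z 0).trans hzd.le) hK)
    have hb' := abs_le.1 hb
    refine ⟨(e z 0, e z 1 - φ (e z 0)), ⟨⟨?_, ?_⟩, ?_, ?_⟩, ?_⟩
    · simp only; linarith
    · simp only; linarith
    · simp only; linarith
    · simp only; nlinarith
    · apply e.injective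
      ext i
      fin_cases i
      · simp [m]
      · simp [m]
  obtain ⟨z, hz, hzA⟩ := mem_closure_iff.1 hxA _ Metric.isOpen_ball
    (Metric.mem_ball_self hρpos)
  exact ⟨ρ, hρpos, hball.trans (hQc.subset_left_of_subset_union hA hB hd hQsub
    ⟨z, hball ⟨hz, hAΩ hzA⟩, hzA⟩)⟩

lemma const_eq_of_hasTrace {U A : Set Plane} (hAU : A ⊆ U) (hA : IsOpen A)
    {u : Plane → ℝ} {c d : ℝ} (hu : ∀ᵐ y, y ∈ A → u y = c) {x : Plane}
    (hxA : x ∈ closure A) {ρ : ℝ} (hρ : 0 < ρ) (hsub : Metric.ball x ρ ∩ U ⊆ A)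
    (hUm : MeasurableSet U) (ht : HasTrace U u x d) : c = d := by
  refine tendsto_nhds_unique (tendsto_const_nhds.congr' ?_) ht
  filter_upwards [Ioo_mem_nhdsGT hρ] with r hr
  have hm : MeasurableSet (Metric.ball x r ∩ U) := Metric.isOpen_ball.measurableSet.inter hUm
  have hpos : volume (Metric.ball x r ∩ U) ≠ 0 := by
    obtain ⟨z, hz, hzA⟩ := mem_closure_iff.1 hxA _ Metric.isOpen_ball
      (Metric.mem_ball_self hr.1)
    have := (Metric.isOpen_ball.inter hA).measure_pos volume ⟨z, hz, hzA⟩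
    exact (this.trans_le (measure_mono (inter_subset_inter_right _ hAU))).ne'
  have hfin : volume (Metric.ball x r ∩ U) ≠ ⊤ :=
    ((measure_mono inter_subset_left).trans_lt Metric.isBounded_ball.measure_lt_top).ne
  have : ⨍ y in Metric.ball x r ∩ U, u y = ⨍ _y in Metric.ball x r ∩ U, c := by
    refine setAverage_congr_fun hm ?_
    filter_upwards [hu] with y hy hyy
    exact hy (hsub ⟨Metric.ball_subset_ball hr.2.le hyy.1, hyy.2⟩)
  rw [this, setAverage_const hpos hfin]

lemma volume_curve_eq_zero {γ : ℝ → Plane} {a : ℝ}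
    (hγ : DifferentiableOn ℝ γ (Icc 0 a)) : volume (γ '' Icc 0 a) = 0 := by
  let f : Plane → Plane := fun x => γ (x 0)
  let p : Plane →L[ℝ] ℝ := EuclideanSpace.proj (𝕜 := ℝ) (0 : Fin 2)
  let s : Set Plane := {x | x 0 ∈ Icc 0 a ∧ x 1 = 0}
  have himg : γ '' Icc 0 a ⊆ f '' s := by
    rintro _ ⟨t, ht, rfl⟩
    refine ⟨!₂[t, 0], ⟨by simpa using ht, by simp⟩, by simp [f]⟩
  refine measure_mono_null himg ?_
  refine addHaar_image_eq_zero_of_det_fderivWithin_eq_zero volume (s := s) (f := f)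
    (f' := fun x => (fderivWithin ℝ γ (Icc 0 a) (x 0)).comp p) (fun x hx => ?_) (fun x hx => ?_)
  · have h1 := (hγ (x 0) hx.1).hasFDerivWithinAt
    exact h1.comp x (p.hasFDerivWithinAt (s := s)) (fun y hy => hy.1)
  · by_contra hdet
    have hinj := (LinearMap.equivOfDetNeZero _ hdet).injective
    have h1 : (LinearMap.equivOfDetNeZero _ hdet) (EuclideanSpace.single (1 : Fin 2) (1 : ℝ)) = 0 := by
      change (fderivWithin ℝ γ (Icc 0 a) (x 0)) (p (EuclideanSpace.single (1 : Fin 2) (1 : ℝ))) = 0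
      have : p (EuclideanSpace.single (1 : Fin 2) (1 : ℝ)) = 0 := by simp [p]
      rw [this, map_zero]
    have h2 := hinj (h1.trans (map_zero _).symm)
    have h3 := congrArg (fun w : Plane => w 1) h2
    simp at h3

lemma ae_restrict_ball {U : Set Plane} {p : Plane → Prop} (h : ∀ᵐ y ∂volume.restrict U, p y)
    (x : Plane) (r : ℝ) : ∀ᵐ y ∂volume.restrict (Metric.ball x r ∩ U), p y :=
  ae_mono (Measure.restrict_mono inter_subset_right le_rfl) h

lemma integrable_ball {U : Set Plane} (f : Lp ℝ 2 (volume.restrict U)) (x : Plane) (r : ℝ) :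
    Integrable f (volume.restrict (Metric.ball x r ∩ U)) := by
  have hfin : volume (Metric.ball x r ∩ U) < ⊤ :=
    (measure_mono inter_subset_left).trans_lt Metric.isBounded_ball.measure_lt_top
  have : IsFiniteMeasure (volume.restrict (Metric.ball x r ∩ U)) := ⟨by simpa using hfin⟩
  exact ((Lp.memLp f).mono_measure (Measure.restrict_mono inter_subset_right le_rfl)).integrable
    (by norm_num)

lemma hasTrace_zero (U : Set Plane) (x : Plane) :
    HasTrace U (0 : Lp ℝ 2 (volume.restrict U)) x 0 := by
  refine tendsto_const_nhds.congr fun r => ?_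
  rw [setAverage_eq, integral_congr_ae (ae_restrict_ball (Lp.coeFn_zero ℝ 2 _) x r)]
  simp

lemma HasTrace.add {U : Set Plane} {x : Plane} {c d : ℝ} (f g : Lp ℝ 2 (volume.restrict U))
    (hf : HasTrace U f x c) (hg : HasTrace U g x d) : HasTrace U (f + g : Lp ℝ 2 _) x (c + d) := by
  refine (Tendsto.add hf hg).congr fun r => ?_
  rw [setAverage_eq, setAverage_eq, setAverage_eq,
    integral_congr_ae (ae_restrict_ball (Lp.coeFn_add f g) x r)]
  simp only [Pi.add_apply]
  rw [integral_add (integrable_ball f x r) (integrable_ball g x r), smul_add]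

lemma HasTrace.smul {U : Set Plane} {x : Plane} {c : ℝ} (a : ℝ) (f : Lp ℝ 2 (volume.restrict U))
    (hf : HasTrace U f x c) : HasTrace U (a • f : Lp ℝ 2 _) x (a * c) := by
  refine (Tendsto.const_mul a hf).congr fun r => ?_
  rw [setAverage_eq, setAverage_eq,
    integral_congr_ae (ae_restrict_ball (Lp.coeFn_smul a f) x r)]
  simp only [Pi.smul_apply, smul_eq_mul, integral_const_mul]
  ring

/-- The reference configuration and the prescribed crack path. The curve `γ`, parametrized by
arc length on `[0, σmax]`, is the path extended until it cuts `Ω` into the two sides `Ωplus` and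
`Ωminus`; admissible cracks have length at most `σbar < σmax`. -/
structure CrackGeometry where
  Ω : Set Plane
  isOpen_Ω : IsOpen Ω
  isConnected_Ω : IsConnected Ω
  isBounded_Ω : Bornology.IsBounded Ω
  lipschitz_Ω : HasLipschitzBoundary Ω
  /-- the Dirichlet part of the boundary -/
  dirichlet : Set Plane
  isClosed_dirichlet : IsClosed dirichlet
  dirichlet_subset : dirichlet ⊆ frontier Ω
  dirichlet_pos : 0 < μH[1] dirichlet
  σ₀ : ℝ
  σ₁ : ℝ
  σbar : ℝ
  σmax : ℝ
  σ₀_pos : 0 < σ₀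
  σ₀_lt_σ₁ : σ₀ < σ₁
  σ₁_lt_σbar : σ₁ < σbar
  σbar_lt_σmax : σbar < σmax
  γ : ℝ → Plane
  contDiffOn_γ : ContDiffOn ℝ 3 γ (Icc 0 σmax)
  injOn_γ : InjOn γ (Icc 0 σmax)
  arcLength_γ : ∀ s ∈ Icc 0 σmax, ‖derivWithin γ (Icc 0 σmax) s‖ = 1
  γ_start : γ 0 ∈ frontier Ω \ dirichlet
  γ_end : γ σmax ∈ frontier Ω \ dirichlet
  γ_mem : ∀ s ∈ Ioo 0 σmax, γ s ∈ Ω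
  Ωplus : Set Plane
  Ωminus : Set Plane
  isOpen_Ωplus : IsOpen Ωplus
  isOpen_Ωminus : IsOpen Ωminus
  isConnected_Ωplus : IsConnected Ωplus
  isConnected_Ωminus : IsConnected Ωminus
  disjoint_sides : Disjoint Ωplus Ωminus
  diff_eq_sides : Ω \ γ '' Icc 0 σmax = Ωplus ∪ Ωminus
  lipschitz_Ωplus : HasLipschitzBoundary Ωplus
  lipschitz_Ωminus : HasLipschitzBoundary Ωminus
  dirichlet_plus_pos : 0 < μH[1] (dirichlet ∩ frontier Ωplus)
  dirichlet_minus_pos : 0 < μH[1] (dirichlet ∩ frontier Ωminus)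

namespace CrackGeometry

variable (G : CrackGeometry)

/-- The crack `Γ(σ)` of length `σ`. -/
def crack (σ : ℝ) : Set Plane := G.γ '' Icc 0 σ

/-- The Neumann part of the boundary. -/
def neumann : Set Plane := frontier G.Ω \ G.dirichlet

/-- The cracked domain `Ω \ Γ(σ₀)`. -/
def cracked : Set Plane := G.Ω \ G.crack G.σ₀

lemma isClosed_crack {σ : ℝ} (hσ : σ ≤ G.σmax) : IsClosed (G.crack σ) :=
  (isCompact_Icc.image_of_continuousOn
    (G.contDiffOn_γ.continuousOn.mono (Icc_subset_Icc_right hσ))).isClosed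

lemma σ₀_le_σmax : G.σ₀ ≤ G.σmax :=
  (G.σ₀_lt_σ₁.trans (G.σ₁_lt_σbar.trans G.σbar_lt_σmax)).le

lemma isOpen_cracked : IsOpen G.cracked :=
  G.isOpen_Ω.sdiff (G.isClosed_crack G.σ₀_le_σmax)

/-- The functions of `H¹(Ω \ Γ(σ₀))` whose trace vanishes `ℋ¹`-almost everywhere on the Dirichlet
part of the boundary. -/
def admissible : Submodule ℝ (H1 G.cracked) where
  carrier := {u | ∀ᵐ x ∂(μH[1] : Measure Plane).restrict G.dirichlet,
    HasTrace G.cracked u.1.fst x 0}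
  zero_mem' := by
    change ∀ᵐ x ∂(μH[1] : Measure Plane).restrict G.dirichlet, _
    exact Eventually.of_forall fun x => hasTrace_zero _ x
  add_mem' := by
    intro u w hu hw
    change ∀ᵐ x ∂(μH[1] : Measure Plane).restrict G.dirichlet, _
    filter_upwards [hu, hw] with x hux hwx
    have := hux.add u.1.fst w.1.fst hwx
    rwa [add_zero] at this
  smul_mem' := by
    intro c u hu
    change ∀ᵐ x ∂(μH[1] : Measure Plane).restrict G.dirichlet, _
    filter_upwards [hu] with x hux
    have := hux.smul c u.1.fst
    rwa [mul_zero] at this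

/-- The space `V` of admissible functions, with the scalar product `(v, w)_V = (Dv, Dw)_{L²}` and the
norm `‖v‖_V = ‖Dv‖_{L²}`. -/
def V : Type := G.admissible

noncomputable instance : AddCommGroup G.V := inferInstanceAs (AddCommGroup G.admissible)
noncomputable instance : Module ℝ G.V := inferInstanceAs (Module ℝ G.admissible)

/-- The gradient `v ↦ Dv`. -/
noncomputable def grad : G.V →ₗ[ℝ] Lp Plane 2 (volume.restrict G.cracked) where
  toFun v := v.1.1.snd
  map_add' _ _ := rfl
  map_smul' _ _ := rfl

lemma grad_injective : Function.Injective G.grad := by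
  rw [injective_iff_map_eq_zero]
  intro v hv
  have hw : ∀ φ : Plane → ℝ, ContDiff ℝ ∞ φ → HasCompactSupport φ → tsupport φ ⊆ G.cracked →
      ∀ e : Plane, ∫ x in G.cracked, v.1.1.fst x * fderiv ℝ φ x e = 0 := by
    intro φ h1 h2 h3 e
    rw [v.1.2 φ h1 h2 h3 e, neg_eq_zero]
    refine integral_eq_zero_of_ae ?_
    have hv' : v.1.1.snd = 0 := hv
    filter_upwards [Lp.eq_zero_iff_ae_eq_zero.1 hv'] with x hx
    simp only [hx, Pi.zero_apply, inner_zero_left, zero_mul]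
  have hcr : IsClosed (G.crack G.σmax) := G.isClosed_crack le_rfl
  -- on each side the function is constant, and the constant is its trace, namely zero
  have side : ∀ A B : Set Plane, IsOpen A → IsOpen B → IsConnected A → Disjoint A B →
      G.Ω \ G.crack G.σmax = A ∪ B → 0 < μH[1] (G.dirichlet ∩ frontier A) →
      ∀ᵐ x, x ∈ A → v.1.1.fst x = 0 := by
    intro A B hA hB hAc hd hAB hpos
    have hAU : A ⊆ G.cracked := by
      have h : A ∪ B ⊆ G.cracked := by
        rw [← hAB]
        exact sdiff_subset_sdiff_right (image_mono (Icc_subset_Icc_right G.σ₀_le_σmax))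
      exact subset_union_left.trans h
    obtain ⟨c, hc⟩ := ae_const_of_isPreconnected G.isOpen_cracked hA hAU hAc.isPreconnected
      (Lp.memLp v.1.1.fst) hw
    have htr : ∀ᵐ x ∂(μH[1] : Measure Plane).restrict G.dirichlet,
      HasTrace G.cracked v.1.1.fst x 0 := v.2
    rw [ae_restrict_iff' G.isClosed_dirichlet.measurableSet] at htr
    obtain ⟨x, hx, hxt⟩ : ∃ x ∈ G.dirichlet ∩ frontier A, HasTrace G.cracked v.1.1.fst x 0 := by
      by_contra! hcon
      refine hpos.ne' (measure_mono_null (fun x hx => ?_) (ae_iff.1 htr))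
      exact fun h => hcon x hx (h hx.1)
    have hxΓ : x ∉ G.crack G.σmax := by
      rintro ⟨s, hs, rfl⟩
      have hf := G.dirichlet_subset hx.1
      rcases hs.1.eq_or_lt with h0 | h0
      · subst h0; exact G.γ_start.2 hx.1
      rcases hs.2.eq_or_lt with h1 | h1
      · subst h1; exact G.γ_end.2 hx.1
      rw [G.isOpen_Ω.frontier_eq] at hf
      exact hf.2 (G.γ_mem s ⟨h0, h1⟩)
    obtain ⟨ρ, hρ, hsub⟩ := ball_inter_subset_side G.isOpen_Ω G.lipschitz_Ω hcr hAB hA hB hd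
      (G.dirichlet_subset hx.1) hxΓ (frontier_subset_closure hx.2)
    have hc0 : c = 0 := const_eq_of_hasTrace hAU hA hc (frontier_subset_closure hx.2) hρ
      ((inter_subset_inter_right _ sdiff_subset).trans hsub) G.isOpen_cracked.measurableSet hxt
    rw [← hc0]; exact hc
  have hp := side G.Ωplus G.Ωminus G.isOpen_Ωplus G.isOpen_Ωminus G.isConnected_Ωplus
    G.disjoint_sides G.diff_eq_sides G.dirichlet_plus_pos
  have hm := side G.Ωminus G.Ωplus G.isOpen_Ωminus G.isOpen_Ωplus G.isConnected_Ωminus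
    G.disjoint_sides.symm (by rw [union_comm]; exact G.diff_eq_sides) G.dirichlet_minus_pos
  have hnull : ∀ᵐ x : Plane, x ∉ G.crack G.σmax := by
    rw [ae_iff]; simp only [not_not]
    exact volume_curve_eq_zero (G.contDiffOn_γ.differentiableOn (by norm_num))
  have hfst : v.1.1.fst = 0 := by
    refine (Lp.eq_zero_iff_ae_eq_zero).2 ?_
    rw [EventuallyEq, ae_restrict_iff' G.isOpen_cracked.measurableSet]
    filter_upwards [hp, hm, hnull] with x h1 h2 h3 hx
    have : x ∈ G.Ωplus ∪ G.Ωminus := by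
      rw [← G.diff_eq_sides]; exact ⟨hx.1, h3⟩
    exact this.elim h1 h2
  apply Subtype.ext
  apply Subtype.ext
  exact WithLp.ofLp_injective 2 (Prod.ext hfst hv)

noncomputable instance : NormedAddCommGroup G.V :=
  NormedAddCommGroup.induced G.V (Lp Plane 2 (volume.restrict G.cracked)) G.grad G.grad_injective

noncomputable instance : InnerProductSpace ℝ G.V where
  norm_smul_le c v := by
    change ‖G.grad (c • v)‖ ≤ ‖c‖ * ‖G.grad v‖
    rw [map_smul, norm_smul]
  inner v w := inner ℝ (G.grad v) (G.grad w)
  norm_sq_eq_re_inner v := norm_sq_eq_re_inner (𝕜 := ℝ) (G.grad v)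
  conj_inner_symm v w := inner_conj_symm (𝕜 := ℝ) (G.grad v) (G.grad w)
  add_left u v w := by rw [map_add, inner_add_left]
  smul_left u v c := by rw [map_smul, inner_smul_left]

end CrackGeometry

/-- The Jacobian matrix of `Ψ` at `y`. -/
noncomputable def jacobian (Ψ : Plane → Plane) (y : Plane) : Matrix (Fin 2) (Fin 2) ℝ :=
  Matrix.of fun i j => fderiv ℝ Ψ y (EuclideanSpace.single j 1) i

/-- The matrix `A` of the bulk energy after the change of variables `x = Ψ(y)`, that is
`(A ξ | ξ) = |(DΨ(y)ᵀ)⁻¹ ξ|² det DΨ(y)`. -/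
noncomputable def pullbackCoeff (Ψ : Plane → Plane) (y : Plane) : Matrix (Fin 2) (Fin 2) ℝ :=
  (jacobian Ψ y).det • ((jacobian Ψ y)⁻¹ * ((jacobian Ψ y)⁻¹).transpose)

/-- `f ∈ W^{1,∞}(0,T; X)`, for its continuous representative: `f` is the integral of an essentially
bounded derivative. -/
def IsW1Infty {X : Type*} [NormedAddCommGroup X] [NormedSpace ℝ X] (T : ℝ) (f : ℝ → X) : Prop :=
  ∃ f' : ℝ → X, MemLp f' ⊤ (volume.restrict (Icc 0 T)) ∧
    ∀ t ∈ Icc 0 T, f t = f 0 + ∫ s in (0 : ℝ)..t, f' s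

/-- The changes of variables and the loads. `Φ σ` is a diffeomorphism of `Ω`, extended by the identity
outside `Ω`, taking the crack of length `σ` to the one of length `σ₀`; `Ψ σ` is its inverse. -/
structure CrackData (G : CrackGeometry) where
  T : ℝ
  T_pos : 0 < T
  Φ : ℝ → Plane → Plane
  Ψ : ℝ → Plane → Plane
  contDiff_Φ : ∀ σ ∈ Icc G.σ₀ G.σbar, ContDiff ℝ 1 (Φ σ)
  contDiff_Ψ : ∀ σ ∈ Icc G.σ₀ G.σbar, ContDiff ℝ 1 (Ψ σ)
  leftInverse : ∀ σ ∈ Icc G.σ₀ G.σbar, Function.LeftInverse (Ψ σ) (Φ σ)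
  rightInverse : ∀ σ ∈ Icc G.σ₀ G.σbar, Function.RightInverse (Ψ σ) (Φ σ)
  eq_id_near_boundary : ∀ σ ∈ Icc G.σ₀ G.σbar,
    ∃ K : Set Plane, IsCompact K ∧ K ⊆ G.Ω ∧ ∀ x ∉ K, Φ σ x = x
  image_Ωplus : ∀ σ ∈ Icc G.σ₀ G.σbar, Φ σ '' G.Ωplus = G.Ωplus
  image_Ωminus : ∀ σ ∈ Icc G.σ₀ G.σbar, Φ σ '' G.Ωminus = G.Ωminus
  image_crack : ∀ σ ∈ Icc G.σ₀ G.σbar, Φ σ '' G.crack σ = G.crack G.σ₀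
  /-- the coefficients are of class `C²` in `σ`, with values in the continuous functions on the
  closure of `Ω` under the uniform norm -/
  coeff_C2 : ∀ i j : Fin 2, ∃ a : ℝ → BoundedContinuousFunction (closure G.Ω) ℝ,
    ContDiffOn ℝ 2 a (Icc G.σ₀ G.σbar) ∧
    ∀ σ ∈ Icc G.σ₀ G.σbar, ∀ y : closure G.Ω, a σ y = pullbackCoeff (Ψ σ) y i j
  /-- the imposed boundary displacement -/
  ψ : ℝ → H1 G.Ω
  ψ_W1Infty : IsW1Infty T ψ
  ψ_bounded : ∃ M : ℝ, ∀ t ∈ Icc 0 T, ∀ᵐ x ∂volume.restrict G.Ω, |(ψ t).1.fst x| ≤ M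
  /-- the support of `ψ t` lies in the (closed) set where every `Ψ σ` is the identity -/
  ψ_support : ∀ t ∈ Icc 0 T, ∀ᵐ x ∂volume.restrict G.Ω,
    (∃ σ ∈ Icc G.σ₀ G.σbar, Ψ σ x ≠ x) → (ψ t).1.fst x = 0
  /-- the applied boundary force -/
  g : ℝ → Lp ℝ 2 ((μH[1] : Measure Plane).restrict G.neumann)
  g_W1Infty : IsW1Infty T g
  /-- the support of `g t` does not meet the crack path -/
  g_support : ∀ t ∈ Icc 0 T, ∀ x ∈ G.crack G.σmax, ∃ N ∈ 𝓝 x,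
    ∀ᵐ y ∂(μH[1] : Measure Plane).restrict G.neumann, y ∈ N → g t y = 0

namespace CrackData

variable {G : CrackGeometry} (D : CrackData G)

/-- The energy functional `ℱ(t, v, σ)` on the fixed cracked domain. -/
noncomputable def energy (t : ℝ) (v : G.V) (σ : ℝ) : ℝ :=
  (∫ y in G.cracked, ∑ i, ∑ j, pullbackCoeff (D.Ψ σ) y i j *
      (G.grad v y j + (D.ψ t).1.snd y j) * (G.grad v y i + (D.ψ t).1.snd y i)) + σ
    - ∫ x in G.neumann, D.g t x *
      (traceFn G.cracked v.1.1.fst x + traceFn G.Ω (D.ψ t).1.fst x) ∂(μH[1] : Measure Plane)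

/-- `w = grad_v ℱ(t, v, σ)`: the differential of `ℱ(t, ·, σ)` at `v` is `(w, ·)_V`. -/
def IsGradV (t : ℝ) (v : G.V) (σ : ℝ) (w : G.V) : Prop :=
  HasFDerivAt (fun v' : G.V => D.energy t v' σ) (innerSL ℝ w) v

/-- The partial derivative `∂_σ ℱ(t, v, σ)`, for `σ ∈ [σ₀, σbar]` (one-sided at the endpoints). -/
noncomputable def dσ (t : ℝ) (v : G.V) (σ : ℝ) : ℝ :=
  derivWithin (fun s => D.energy t v s) (Icc G.σ₀ G.σbar) σ

/-- The second differential of `ℱ(t, ·, ·)` on `V × [σ₀, σbar]` at `(v, σ)`. -/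
noncomputable def hessian (t : ℝ) (v : G.V) (σ : ℝ) : G.V × ℝ →L[ℝ] G.V × ℝ →L[ℝ] ℝ :=
  fderivWithin ℝ (fun p => fderivWithin ℝ (fun q : G.V × ℝ => D.energy t q.1 q.2)
    (univ ×ˢ Icc G.σ₀ G.σbar) p) (univ ×ˢ Icc G.σ₀ G.σbar) (v, σ)

/-- The cut-off factor: `1` for `σ ≤ σ₁`, then decreasing linearly to `0` at `σbar`. -/
noncomputable def cutoff (G : CrackGeometry) (σ : ℝ) : ℝ :=
  max (G.σbar - max σ G.σ₁) 0 / (G.σbar - G.σ₁)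

/-- `(v, σ)` solves on `[0, T]` the modified `ε`-gradient flow with initial data `(u₀, σ₀)`. -/
structure IsFlow (u₀ : G.V) (ε : ℝ) (v : ℝ → G.V) (σ : ℝ → ℝ) : Prop where
  contDiffOn_v : ContDiffOn ℝ 1 v (Icc 0 D.T)
  contDiffOn_σ : ContDiffOn ℝ 1 σ (Icc 0 D.T)
  monotoneOn_σ : MonotoneOn σ (Icc 0 D.T)
  σ_mem : ∀ t ∈ Icc 0 D.T, σ t ∈ Icc G.σ₀ G.σbar
  /-- `ε v' = -grad_v ℱ(t, v, σ)` -/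
  v_eq : ∀ t ∈ Icc 0 D.T, D.IsGradV t (v t) (σ t) (-(ε • derivWithin v (Icc 0 D.T) t))
  σ_eq : ∀ t ∈ Icc 0 D.T,
    ε * derivWithin σ (Icc 0 D.T) t = max (-D.dσ t (v t) (σ t)) 0 * cutoff G (σ t)
  v_zero : v 0 = u₀
  σ_zero : σ 0 = G.σ₀

/-- `(v, σ)` is a Lipschitz branch of critical points of `ℱ` on `[t₀, t₁]` that starts from
`(v₀, s₀)` at time `t₀` and has crack lengths in `I`. -/
structure IsBranch (t₀ t₁ : ℝ) (I : Set ℝ) (v₀ : G.V) (s₀ : ℝ) (v : ℝ → G.V) (σ : ℝ → ℝ) :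
    Prop where
  lipschitz : ∃ K : ℝ≥0, LipschitzOnWith K (fun t => (v t, σ t)) (Icc t₀ t₁)
  σ_mem : ∀ t ∈ Icc t₀ t₁, σ t ∈ I
  gradV_eq_zero : ∀ t ∈ Icc t₀ t₁, D.IsGradV t (v t) (σ t) 0
  dσ_eq_zero : ∀ t ∈ Icc t₀ t₁, D.dσ t (v t) (σ t) = 0
  v_start : v t₀ = v₀
  σ_start : σ t₀ = s₀

end CrackData

end CrackGrowth

/-! After the change of variables the energy lives on the fixed set V × [σ₀, σbar]. It is a
quadratic form in Dv + Dψ(t) with coefficients of class C² in σ, plus σ, minus a bounded load that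
is affine in v. Hence it is C² in (v, σ) up to the ends of the strip, its gradient N(t, ·) in the
Hilbert space V × ℝ is Lipschitz in t near the given critical point, and the critical points at time
t are the zeros of N(t, ·).

Since the Hessian at (v⁰, σ⁰) is bounded below by α, the field N(t, ·) is strongly monotone with
constant α/2 on the part of a small ball that lies in the strip, for all t in a short interval
(`LoadedEnergy.exists_monoFamily`). The strip is convex, so this holds even when σ⁰ = σ₀. The three
claims are consequences of monotonicity, proved for a general `MonoFamily`.

Uniqueness: N(t, ·) has at most one zero in the ball, and a continuous curve of zeros cannot leave
the ball in so short a time. Existence for σ⁰ > σ₀: the ball lies in the strip, and x ↦ x − ηN(t, x)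
is a contraction of it (`MonoFamily.exists_zero`). Zeros at times s and t are at distance at most
L|t − s|/m, so the curve is Lipschitz.

Convergence: where the crack length increases strictly and stays below σ₁, the positive part and the
cut-off are inactive and the modified flow is εż = −N(t, z). The ball is invariant. Moreover ‖N(t,
z(t))‖ = ε‖ż‖ tends to zero uniformly in t, because it does so at t⁰ and N is Lipschitz in time
(`MonoFamily.flow_norm_le`). By monotonicity the solutions are then Cauchy as ε → 0, and their limit
is a zero. This produces the branch without a fixed point, hence also for σ⁰ = σ₀.

The longer part of the proof shows that V is complete under ‖Dv‖ and that the boundary load is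
continuous on it. Traces are limits of averages over balls. In a Lipschitz chart a Sobolev function
is, on almost every vertical line, the primitive of its derivative starting from a boundary profile
(`SobolevOn.exists_isProfile`). Lebesgue differentiation identifies the profile with the trace, and
the same profiles give trace and Poincaré inequalities. They are applied on the two Lipschitz sides
of the crack path. -/

namespace CrackGrowth

/-! ### Weak derivatives along lines -/

/-- The weak-gradient identity extends to continuous compactly supported test functions that have a
continuous derivative in one direction. -/
lemma HasWeakGradient.integral_mul_lineDeriv {U : Set Plane} (hU : IsOpen U) {u : Plane → ℝ}
    {G : Plane → Plane} (hu : MemLp u 2 (volume.restrict U)) (hG : MemLp G 2 (volume.restrict U))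
    (hw : HasWeakGradient U u G) {φ ψ : Plane → ℝ} {e : Plane} (hφ : Continuous φ)
    (hψ : Continuous ψ) (hφs : HasCompactSupport φ) (hφU : tsupport φ ⊆ U)
    (hd : ∀ x, HasLineDerivAt ℝ φ (ψ x) x e) :
    ∫ x in U, u x * ψ x = -∫ x in U, inner ℝ (G x) e * φ x := by
  -- Off its support φ vanishes near the point, so its line derivative ψ vanishes there too.
  have hψsub : Function.support ψ ⊆ tsupport φ := by
    intro x hx
    by_contra hn
    have h0 : φ =ᶠ[𝓝 x] fun _ => 0 := notMem_tsupport_iff_eventuallyEq.1 hn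
    have h1 : HasLineDerivAt ℝ (fun _ : Plane => (0 : ℝ)) (ψ x) x e :=
      (hd x).congr_of_eventuallyEq h0.symm
    exact hx (h1.unique ((hasFDerivAt_const (0 : ℝ) x).hasLineDerivAt e))
  have hψs : HasCompactSupport ψ := hφs.mono' hψsub
  obtain ⟨δ, hδ, hδU⟩ := hφs.isCompact.exists_cthickening_subset_open hU hφU
  set K := Metric.cthickening δ (tsupport φ) with hK
  have hKc : IsCompact K := hφs.isCompact.cthickening
  -- Outer radii at most δ keep all mollifications supported in the thickening K, inside U.
  let B : ℕ → ContDiffBump (0 : Plane) := fun n =>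
    ⟨δ / 2 / (n + 1), δ / (n + 1), by positivity, by
      have : (0 : ℝ) < n + 1 := by positivity
      gcongr; linarith⟩
  have hout : Tendsto (fun n => (B n).rOut) atTop (𝓝 0) := by
    have := (tendsto_one_div_add_atTop_nhds_zero_nat (𝕜 := ℝ)).const_mul δ
    simp only [mul_zero] at this
    refine this.congr fun n => ?_
    change δ * (1 / ((n : ℝ) + 1)) = δ / (n + 1)
    ring
  have hrle : ∀ n, (B n).rOut ≤ δ := fun n => by
    change δ / ((n : ℝ) + 1) ≤ δ
    apply div_le_self hδ.le
    have : (0 : ℝ) ≤ n := by positivity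
    linarith
  let mol : (Plane → ℝ) → ℕ → Plane → ℝ := fun f n =>
    (B n).normed volume ⋆[ContinuousLinearMap.lsmul ℝ ℝ, volume] f
  have htend : ∀ f : Plane → ℝ, Continuous f → ∀ x, Tendsto (fun n => mol f n x) atTop (𝓝 (f x)) := by
    intro f hf x
    refine ContDiffBump.convolution_tendsto_right hout
      (Eventually.of_forall fun _ => hf.aestronglyMeasurable) ?_ tendsto_const_nhds
    exact (hf.tendsto x).comp tendsto_snd
  have hbound : ∀ f : Plane → ℝ, Continuous f → HasCompactSupport f → tsupport f ⊆ tsupport φ →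
      ∃ M, ∀ n x, ‖mol f n x‖ ≤ K.indicator (fun _ => M) x := by
    intro f hf hfs hsub
    obtain ⟨M, hM⟩ := hfs.exists_bound_of_continuous hf
    refine ⟨M, fun n x => ?_⟩
    by_cases hx : x ∈ K
    · rw [indicator_of_mem hx]
      have := dist_convolution_le (x₀ := x) (z₀ := 0) ((norm_nonneg _).trans (hM 0))
        (B n).support_normed_eq.subset (B n).nonneg_normed (B n).integral_normed
        (hf.aestronglyMeasurable (μ := volume)) (fun y _ => by simpa using hM y)
      simpa using this
    · have : mol f n x = 0 := by
        by_contra hne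
        have hmem : x ∈ Function.support (mol f n) := hne
        have h2 := support_convolution_subset (L := ContinuousLinearMap.lsmul ℝ ℝ) hmem
        obtain ⟨a, ha, b, hb, rfl⟩ := Set.mem_add.1 h2
        apply hx
        rw [hK]
        refine Metric.mem_cthickening_of_dist_le _ b _ _ (hsub (subset_tsupport _ hb)) ?_
        rw [ContDiffBump.support_normed_eq] at ha
        have : ‖a‖ < (B n).rOut := by simpa using ha
        rw [dist_eq_norm]; simpa using this.le.trans (hrle n)
      rw [this]; simp [hx]
  have hmolC : ∀ n, ContDiff ℝ ∞ (mol φ n) := fun n =>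
    (B n).hasCompactSupport_normed.contDiff_convolution_left _ (B n).contDiff_normed
      hφ.locallyIntegrable
  -- A derivative of φ is available only in the direction e. It is first put on the kernel, then
  -- moved onto φ by integration by parts along e, which produces ψ.
  have hmd : ∀ n x, fderiv ℝ (mol φ n) x e = mol ψ n x := by
    intro n x
    have hgs : HasCompactSupport ((B n).normed (volume : Measure Plane)) := (B n).hasCompactSupport_normed
    have hgc : ContDiff ℝ 1 ((B n).normed (volume : Measure Plane)) := (B n).contDiff_normed
    have h1 := hgs.hasFDerivAt_convolution_left (ContinuousLinearMap.lsmul ℝ ℝ) hgc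
      hφ.locallyIntegrable (μ := volume) x
    have h2 : fderiv ℝ (mol φ n) x = _ := h1.fderiv
    have hint := (hgs.fderiv ℝ).convolutionExists_left (μ := volume)
      ((ContinuousLinearMap.lsmul ℝ ℝ).precompL Plane) (hgc.continuous_fderiv (by simp))
      hφ.locallyIntegrable x
    have h3 : mol ψ n x = ∫ t, (ContinuousLinearMap.lsmul ℝ ℝ) ((B n).normed volume t) (ψ (x - t)) :=
      rfl
    rw [h2, convolution_def, ContinuousLinearMap.integral_apply hint, h3]
    have hxs : Continuous fun t : Plane => x - t := by fun_prop
    have ibp := integral_bilinear_hasLineDerivAt_right_eq_neg_left_of_integrable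
      (μ := (volume : Measure Plane)) (f := (B n).normed volume)
      (f' := fun t => fderiv ℝ ((B n).normed volume) t e) (g := fun t => φ (x - t))
      (g' := fun t => -ψ (x - t)) (v := e) (B := ContinuousLinearMap.lsmul ℝ ℝ) ?_ ?_ ?_ ?_ ?_
    · simp only [map_neg, integral_neg, neg_inj] at ibp
      rw [ibp]; rfl
    · refine (Continuous.integrable_of_hasCompactSupport (f := fun t =>
        fderiv ℝ ((B n).normed (volume : Measure Plane)) t e * φ (x - t)) ?_ ?_)
      · exact ((hgc.continuous_fderiv (by simp)).clm_apply continuous_const).mul (hφ.comp hxs)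
      · exact (hgs.fderiv_apply ℝ e).mul_right
    · refine (Continuous.integrable_of_hasCompactSupport (f := fun t =>
        ((B n).normed (volume : Measure Plane)) t * (-ψ (x - t))) ?_ ?_)
      · exact hgc.continuous.mul (hψ.comp hxs).neg
      · exact hgs.mul_right
    · refine (Continuous.integrable_of_hasCompactSupport (f := fun t =>
        ((B n).normed (volume : Measure Plane)) t * φ (x - t)) ?_ ?_)
      · exact hgc.continuous.mul (hφ.comp hxs)
      · exact hgs.mul_right
    · exact fun t _ => (hgc.differentiable (by simp) t).hasFDerivAt.hasLineDerivAt e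
    · intro t _
      have h4 := hd (x - t)
      unfold HasLineDerivAt at h4 ⊢
      have h5 : HasDerivAt (fun r : ℝ => -r) (-1) 0 := hasDerivAt_neg (0 : ℝ)
      have h6 := HasDerivAt.scomp (g₁ := fun r : ℝ => φ (x - t + r • e)) (0 : ℝ) (by simpa using h4) h5
      simp only [smul_eq_mul, neg_mul, one_mul] at h6
      refine h6.congr_of_eventuallyEq (Eventually.of_forall fun r => ?_)
      simp only [Function.comp]
      congr 1
      rw [neg_smul]; abel
  have key : ∀ n, ∫ x in U, u x * mol ψ n x = -∫ x in U, inner ℝ (G x) e * mol φ n x := by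
    intro n
    have hsup : Function.support (mol φ n) ⊆ K := by
      obtain ⟨M, hM⟩ := hbound φ hφ hφs Subset.rfl
      intro x hx
      by_contra hn
      have := hM n x
      rw [indicator_of_notMem hn] at this
      exact hx (norm_le_zero_iff.1 this)
    have hts : tsupport (mol φ n) ⊆ K := closure_minimal hsup Metric.isClosed_cthickening
    have := hw (mol φ n) (hmolC n) (hKc.of_isClosed_subset (isClosed_tsupport _) hts)
      (hts.trans hδU) e
    simpa only [hmd] using this
  have hlim : ∀ (w f : Plane → ℝ), MemLp w 2 (volume.restrict U) → Continuous f →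
      HasCompactSupport f → tsupport f ⊆ tsupport φ →
      Tendsto (fun n => ∫ x in U, w x * mol f n x) atTop (𝓝 (∫ x in U, w x * f x)) := by
    intro w f hwm hf hfs hsub
    obtain ⟨M, hM⟩ := hbound f hf hfs hsub
    refine tendsto_integral_of_dominated_convergence
      (fun x => ‖w x‖ * K.indicator (fun _ => M) x) (fun n => ?_) ?_ (fun n => ?_) ?_
    · refine hwm.aestronglyMeasurable.mul ?_
      have : Continuous (mol f n) := ((B n).hasCompactSupport_normed.contDiff_convolution_left (n := 0) _
        (B n).contDiff_normed hf.locallyIntegrable).continuous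
      exact this.aestronglyMeasurable
    · refine hwm.norm.integrable_mul (q := 2) ?_
      refine (memLp_indicator_const 2 hKc.isClosed.measurableSet M ?_)
      right
      exact ((Measure.restrict_apply_le _ _).trans_lt hKc.measure_lt_top).ne
    · refine Eventually.of_forall fun x => ?_
      rw [norm_mul]
      exact mul_le_mul_of_nonneg_left (hM n x) (norm_nonneg _)
    · exact Eventually.of_forall fun x => (htend f hf x).const_mul _
  refine tendsto_nhds_unique (hlim u ψ hu hψ hψs (closure_minimal hψsub (isClosed_tsupport _))) ?_
  refine ((hlim _ φ (hG.inner_const e) hφ hφs Subset.rfl).neg).congr fun n => (key n).symm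

lemma exists_Icc_of_isCompact_subset_Ioo {K : Set ℝ} (hK : IsCompact K) {a b : ℝ} (hab : a < b)
    (h : K ⊆ Ioo a b) : ∃ a' b', a < a' ∧ a' < b' ∧ b' < b ∧ K ⊆ Ioo a' b' := by
  rcases K.eq_empty_or_nonempty with rfl | hne
  · exact ⟨a + (b - a) / 3, b - (b - a) / 3, by linarith, by linarith, by linarith, by simp⟩
  obtain ⟨x, hx, hxm⟩ := hK.exists_isLeast hne
  obtain ⟨y, hy, hym⟩ := hK.exists_isGreatest hne
  have h1 := h hx
  have h2 := h hy
  have h3 := hym hx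
  refine ⟨(a + x) / 2, (y + b) / 2, ?_, ?_, ?_, fun z hz => ⟨?_, ?_⟩⟩
  · linarith [h1.1]
  · linarith [h1.1, h2.2]
  · linarith [h2.2]
  · linarith [hxm hz, h1.1]
  · linarith [hym hz, h2.2]

/-- Provides the weight by which vertical means are taken and subtracted from test functions. -/
lemma exists_bump_Ioo {h : ℝ} (hh : 0 < h) : ∃ η : ℝ → ℝ, Continuous η ∧
    (∀ s, s ∉ Ioo (h / 4) (3 * h / 4) → η s = 0) ∧ ∫ s in (0 : ℝ)..h, η s = 1 := by
  let B : ContDiffBump (h / 2) := ⟨h / 8, h / 4, by positivity, by linarith⟩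
  have hz : ∀ s, s ∉ Ioo (h / 4) (3 * h / 4) → B.normed volume s = 0 := by
    intro s hs
    by_contra hne
    have : s ∈ Function.support (B.normed volume) := hne
    rw [B.support_normed_eq, Real.ball_eq_Ioo] at this
    apply hs
    have hr : B.rOut = h / 4 := rfl
    rw [hr] at this
    exact ⟨by linarith [this.1], by linarith [this.2]⟩
  refine ⟨B.normed volume, B.contDiff_normed.continuous (n := 0), hz, ?_⟩
  rw [intervalIntegral.integral_of_le hh.le, ← integral_indicator measurableSet_Ioc,
    ← B.integral_normed (μ := (volume : Measure ℝ))]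
  congr 1
  ext s
  by_cases hs : s ∈ Ioc 0 h
  · rw [indicator_of_mem hs]
  · rw [indicator_of_notMem hs, hz s]
    intro h'
    exact hs ⟨by linarith [h'.1], by linarith [h'.2]⟩

lemma stronglyMeasurable_primitive {g : ℝ × ℝ → ℝ} (hg : StronglyMeasurable g) :
    StronglyMeasurable fun p : ℝ × ℝ => ∫ τ in Ioc 0 p.2, g (p.1, τ) := by
  have : (fun p : ℝ × ℝ => ∫ τ in Ioc 0 p.2, g (p.1, τ))
      = fun p : ℝ × ℝ => ∫ τ, ({q : (ℝ × ℝ) × ℝ | 0 < q.2 ∧ q.2 ≤ q.1.2}.indicator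
        (fun q => g (q.1.1, q.2))) (p, τ) := by
    ext p
    rw [← integral_indicator measurableSet_Ioc]
    rfl
  rw [this]
  refine StronglyMeasurable.integral_prod_right' (f := {q : (ℝ × ℝ) × ℝ | 0 < q.2 ∧ q.2 ≤ q.1.2}.indicator
        (fun q => g (q.1.1, q.2))) ?_
  refine StronglyMeasurable.indicator (hg.comp_measurable (by fun_prop)) ?_
  exact (measurableSet_lt measurable_const measurable_snd).inter
    (measurableSet_le measurable_snd (measurable_snd.comp measurable_fst))

/-- Integration by parts for absolutely continuous functions, g being merely integrable. The
boundary term at h vanishes with Φ, the one at 0 with the primitive of g. -/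
lemma integral_mul_primitive {g Φ Ψ : ℝ → ℝ} {h : ℝ} (hh : 0 < h) (hg : IntegrableOn g (Ioo 0 h))
    (hΨ : Continuous Ψ) (hd : ∀ s, HasDerivAt Φ (Ψ s) s) (h0 : Φ h = 0) :
    ∫ s in Ioo 0 h, (∫ τ in Ioc 0 s, g τ) * Ψ s = -∫ s in Ioo 0 h, g s * Φ s := by
  have hgi : IntervalIntegrable g volume 0 h := by
    rw [intervalIntegrable_iff_integrableOn_Ioo_of_le hh.le]; exact hg
  have hP : AbsolutelyContinuousOnInterval (fun s => ∫ τ in (0 : ℝ)..s, g τ) 0 h :=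
    hgi.absolutelyContinuousOnInterval_intervalIntegral left_mem_uIcc
  have hder : deriv Φ = Ψ := funext fun s => (hd s).deriv
  have hΦ1 : ContDiff ℝ 1 Φ := by
    rw [contDiff_one_iff_deriv, hder]
    exact ⟨fun s => (hd s).differentiableAt, hΨ⟩
  have hΦ : AbsolutelyContinuousOnInterval Φ 0 h :=
    hΦ1.contDiffOn.absolutelyContinuousOnInterval
  have key := hP.integral_mul_deriv_eq_deriv_mul hΦ
  simp only [h0, mul_zero, intervalIntegral.integral_same, zero_mul, sub_zero, zero_sub, hder] at key
  have e1 : ∫ s in (0 : ℝ)..h, deriv (fun s => ∫ τ in (0 : ℝ)..s, g τ) s * Φ s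
      = ∫ s in (0 : ℝ)..h, g s * Φ s := by
    refine intervalIntegral.integral_congr_ae ?_
    filter_upwards [hgi.ae_hasDerivAt_integral] with s hs hs'
    rw [(hs (uIoc_subset_uIcc hs') 0 left_mem_uIcc).deriv]
  rw [e1, intervalIntegral.integral_of_le hh.le, intervalIntegral.integral_of_le hh.le,
    integral_Ioc_eq_integral_Ioo, integral_Ioc_eq_integral_Ioo] at key
  rw [← key]
  refine setIntegral_congr_fun measurableSet_Ioo fun s hs => ?_
  rw [intervalIntegral.integral_of_le hs.1.le]

/-- A function on a rectangle with an integrable weak derivative in the second variable is, on almost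
every vertical segment, the primitive of this derivative. -/
lemma exists_eq_add_primitive {a b h : ℝ} (hab : a < b) (hh : 0 < h) {U g : ℝ × ℝ → ℝ}
    (hgm : StronglyMeasurable g)
    (hU : IntegrableOn U (Ioo a b ×ˢ Ioo 0 h)) (hg : IntegrableOn g (Ioo a b ×ˢ Ioo 0 h))
    (hw : ∀ Φ Ψ : ℝ × ℝ → ℝ, Continuous Φ → Continuous Ψ → HasCompactSupport Φ →
      tsupport Φ ⊆ Ioo a b ×ˢ Ioo 0 h → (∀ x s, HasDerivAt (fun r => Φ (x, r)) (Ψ (x, s)) s) →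
      ∫ p in Ioo a b ×ˢ Ioo 0 h, U p * Ψ p = -∫ p in Ioo a b ×ˢ Ioo 0 h, g p * Φ p) :
    ∃ T : ℝ → ℝ, Integrable T (volume.restrict (Ioo a b)) ∧
      ∀ᵐ p ∂volume.restrict (Ioo a b ×ˢ Ioo 0 h), U p = T p.1 + ∫ τ in Ioc 0 p.2, g (p.1, τ) := by
  set Q : Set (ℝ × ℝ) := Ioo a b ×ˢ Ioo 0 h with hQ
  set μ : Measure ℝ := volume.restrict (Ioo a b) with hμ
  set ν : Measure ℝ := volume.restrict (Ioo 0 h) with hν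
  have hprod : (volume : Measure (ℝ × ℝ)).restrict Q = μ.prod ν := by
    rw [hμ, hν, Measure.prod_restrict, ← Measure.volume_eq_prod]
  obtain ⟨η, hηc, hη0, hη1⟩ := exists_bump_Ioo hh
  rw [intervalIntegral.integral_of_le hh.le, integral_Ioc_eq_integral_Ioo] at hη1
  let P : ℝ × ℝ → ℝ := fun p => ∫ τ in Ioc 0 p.2, g (p.1, τ)
  have hPm : StronglyMeasurable P := stronglyMeasurable_primitive hgm
  have hg' : Integrable g (μ.prod ν) := by rw [← hprod]; exact hg
  have hU' : Integrable U (μ.prod ν) := by rw [← hprod]; exact hU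
  have hP : Integrable P (μ.prod ν) := by
    refine Integrable.mono' (g := fun p => (∫ τ, ‖g (p.1, τ)‖ ∂ν) * 1) ?_ hPm.aestronglyMeasurable ?_
    · exact hg'.integral_norm_prod_left.mul_prod (integrable_const (1 : ℝ))
    · have h1 : ∀ᵐ p ∂μ.prod ν, Integrable (fun τ => g (p.1, τ)) ν :=
        Measure.quasiMeasurePreserving_fst.ae hg'.prod_right_ae
      have h2 : ∀ᵐ p ∂μ.prod ν, p ∈ Q := by
        rw [← hprod]; exact ae_restrict_mem (measurableSet_Ioo.prod measurableSet_Ioo)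
      filter_upwards [h1, h2] with p hp hpQ
      rw [mul_one]
      refine (norm_integral_le_integral_norm _).trans ?_
      have hle : volume.restrict (Ioc 0 p.2) ≤ ν :=
        Measure.restrict_mono (show Ioc 0 p.2 ⊆ Ioo 0 h from
          fun τ hτ => ⟨hτ.1, hτ.2.trans_lt hpQ.2.2⟩) le_rfl
      exact integral_mono_measure hle (Eventually.of_forall fun _ => norm_nonneg _) hp.norm
  set D : ℝ × ℝ → ℝ := fun p => U p - P p with hD
  have hDi : Integrable D (μ.prod ν) := hU'.sub hP
  obtain ⟨Mη, hMη⟩ : ∃ M, ∀ s, ‖η s‖ ≤ M := by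
    refine (HasCompactSupport.intro (isCompact_Icc (a := h / 4) (b := 3 * h / 4)) fun s hs => ?_
      : HasCompactSupport η).exists_bound_of_continuous hηc
    exact hη0 s fun h' => hs (Ioo_subset_Icc_self h')
  have hDη : Integrable (fun p => D p * η p.2) (μ.prod ν) :=
    hDi.mul_bdd (c := Mη) (hηc.comp continuous_snd).aestronglyMeasurable
      (Eventually.of_forall fun p => hMη p.2)
  -- D has zero weak vertical derivative and so should depend on the first variable alone. Its value
  -- is then its vertical mean against η, which has integral one.
  let T : ℝ → ℝ := fun x => ∫ s, D (x, s) * η s ∂ν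
  have hT : Integrable T μ := hDη.integral_prod_left
  have hT1 : Integrable (fun p : ℝ × ℝ => T p.1) (μ.prod ν) := by
    simpa using hT.mul_prod (integrable_const (1 : ℝ) (μ := ν))
  refine ⟨T, hT, ?_⟩
  have hmain : ∀ Θ : ℝ × ℝ → ℝ, Continuous Θ → HasCompactSupport Θ → tsupport Θ ⊆ Q →
      ∫ p, Θ p * (D p - T p.1) ∂μ.prod ν = 0 := by
    intro Θ hΘ hΘs hΘQ
    obtain ⟨MΘ, hMΘ⟩ := hΘs.exists_bound_of_continuous hΘ
    let c : ℝ → ℝ := fun x => ∫ τ in (0 : ℝ)..h, Θ (x, τ)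
    have hcν : ∀ x, c x = ∫ τ, Θ (x, τ) ∂ν := fun x => by
      simp only [c]; rw [intervalIntegral.integral_of_le hh.le, integral_Ioc_eq_integral_Ioo]
    have hc : Continuous c := intervalIntegral.continuous_parametric_intervalIntegral_of_continuous'
      (f := fun x τ => Θ (x, τ)) (by simpa [Function.uncurry_def] using hΘ) 0 h
    -- An arbitrary Θ is not a vertical derivative. Subtracting η times its vertical integral gives
    -- zero vertical integral, so that Ψ is the vertical derivative of a compactly supported Φ.
    let Ψ : ℝ × ℝ → ℝ := fun p => Θ p - η p.2 * c p.1
    have hΨ : Continuous Ψ := hΘ.sub ((hηc.comp continuous_snd).mul (hc.comp continuous_fst))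
    let Φ : ℝ × ℝ → ℝ := fun p => ∫ τ in (0 : ℝ)..p.2, Ψ (p.1, τ)
    have hΦ : Continuous Φ := intervalIntegral.continuous_parametric_intervalIntegral_of_continuous
      (f := fun (p : ℝ × ℝ) τ => Ψ (p.1, τ)) (by
        simp only [Function.uncurry_def]; exact hΨ.comp (by fun_prop)) continuous_snd
    have hΨx : ∀ x, Continuous fun τ => Ψ (x, τ) := fun x => hΨ.comp (by fun_prop)
    have hd : ∀ x s, HasDerivAt (fun r => Φ (x, r)) (Ψ (x, s)) s := fun x s =>
      intervalIntegral.integral_hasDerivAt_right ((hΨx x).intervalIntegrable _ _)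
        ((hΨx x).stronglyMeasurableAtFilter _ _) (hΨx x).continuousAt
    have hΨh : ∀ x, ∫ τ in (0 : ℝ)..h, Ψ (x, τ) = 0 := by
      intro x
      have e1 : Continuous fun τ => Θ (x, τ) := hΘ.comp (by fun_prop)
      have e2 : Continuous fun τ => η τ * c x := hηc.mul continuous_const
      simp only [Ψ]
      rw [intervalIntegral.integral_sub (e1.intervalIntegrable _ _) (e2.intervalIntegrable _ _),
        intervalIntegral.integral_mul_const, intervalIntegral.integral_of_le hh.le (f := η),
        integral_Ioc_eq_integral_Ioo, hη1, one_mul]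
      exact sub_self _
    -- the support of `Φ`
    have hK1 := hΘs.isCompact.image continuous_fst
    have hK2 := hΘs.isCompact.image continuous_snd
    obtain ⟨a', b', ha', hab', hb', hK1'⟩ := exists_Icc_of_isCompact_subset_Ioo hK1 hab
      (by rintro _ ⟨p, hp, rfl⟩; exact (hΘQ hp).1)
    obtain ⟨s1, s2, hs1, hs12, hs2, hK2'⟩ := exists_Icc_of_isCompact_subset_Ioo hK2 hh
      (by rintro _ ⟨p, hp, rfl⟩; exact (hΘQ hp).2)
    have hΘ0 : ∀ x τ, (x ∉ Ioo a' b' ∨ τ ∉ Ioo s1 s2) → Θ (x, τ) = 0 := by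
      intro x τ hx
      refine image_eq_zero_of_notMem_tsupport fun hmem => ?_
      rcases hx with hx | hx
      · exact hx (hK1' ⟨_, hmem, rfl⟩)
      · exact hx (hK2' ⟨_, hmem, rfl⟩)
    set l := min s1 (h / 4) with hl
    set u := max s2 (3 * h / 4) with hu
    have hlpos : 0 < l := lt_min hs1 (by positivity)
    have huh : u < h := max_lt hs2 (by linarith)
    have hΨ0 : ∀ x τ, (x ∉ Ioo a' b' ∨ τ ∉ Ioo l u) → Ψ (x, τ) = 0 := by
      intro x τ hx
      rcases hx with hx | hx
      · have : c x = 0 := by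
          simp only [c]
          rw [intervalIntegral.integral_congr (g := fun _ => 0) fun τ _ => hΘ0 x τ (Or.inl hx)]
          simp
        simp [Ψ, this, hΘ0 x τ (Or.inl hx)]
      · have e1 : Θ (x, τ) = 0 := hΘ0 x τ (Or.inr fun h' => hx
          ⟨(min_le_left _ _).trans_lt h'.1, h'.2.trans_le (le_max_left _ _)⟩)
        have e2 : η τ = 0 := hη0 τ fun h' => hx
          ⟨(min_le_right _ _).trans_lt h'.1, h'.2.trans_le (le_max_right _ _)⟩
        simp [Ψ, e1, e2]
    -- Below l the integrand has been zero throughout; above u the primitive equals the whole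
    -- vertical integral of Ψ, which is zero.
    have hΦ0 : ∀ p : ℝ × ℝ, p ∉ Icc a' b' ×ˢ Icc l u → Φ p = 0 := by
      rintro ⟨x, s⟩ hp
      by_cases hx : x ∈ Icc a' b'
      · have hs : s ∉ Icc l u := fun hs => hp ⟨hx, hs⟩
        rcases lt_or_ge s l with hsl | hsl
        · refine intervalIntegral.integral_zero_ae (Eventually.of_forall fun τ hτ => hΨ0 x τ (Or.inr ?_))
          intro h'
          have : τ ≤ max 0 s := hτ.2
          exact absurd (this.trans_lt (max_lt hlpos hsl)) (not_lt.2 h'.1.le)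
        · have hsu : u < s := by by_contra h'; exact hs ⟨hsl, not_lt.1 h'⟩
          have hii : ∀ p q, IntervalIntegrable (fun τ => Ψ (x, τ)) volume p q := fun p q =>
            (hΨx x).intervalIntegrable _ _
          have : Φ (x, s) = (∫ τ in (0 : ℝ)..h, Ψ (x, τ)) + ∫ τ in h..s, Ψ (x, τ) :=
            (intervalIntegral.integral_add_adjacent_intervals (hii _ _) (hii _ _)).symm
          rw [this, hΨh, zero_add]
          refine intervalIntegral.integral_zero_ae (Eventually.of_forall fun τ hτ => hΨ0 x τ (Or.inr ?_))
          intro h'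
          have : min h s < τ := hτ.1
          exact absurd ((lt_min huh hsu).trans this) (not_lt.2 h'.2.le)
      · refine intervalIntegral.integral_zero_ae (Eventually.of_forall fun τ _ => hΨ0 x τ (Or.inl ?_))
        exact fun h' => hx (Ioo_subset_Icc_self h')
    have hΦsub : tsupport Φ ⊆ Icc a' b' ×ˢ Icc l u := by
      refine closure_minimal (fun p hp => ?_) (isClosed_Icc.prod isClosed_Icc)
      by_contra hn
      exact hp (hΦ0 p hn)
    have hΦs : HasCompactSupport Φ :=
      (isCompact_Icc.prod isCompact_Icc).of_isClosed_subset (isClosed_tsupport _) hΦsub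
    have hΦQ : tsupport Φ ⊆ Q := hΦsub.trans (prod_mono
      (fun x hx => ⟨ha'.trans_le hx.1, hx.2.trans_lt hb'⟩)
      (fun x hx => ⟨hlpos.trans_le hx.1, hx.2.trans_lt huh⟩))
    have hΨs : HasCompactSupport Ψ := by
      refine HasCompactSupport.intro (isCompact_Icc.prod isCompact_Icc)
        (K := Icc a' b' ×ˢ Icc l u) fun p hp => ?_
      refine hΨ0 p.1 p.2 ?_
      by_contra! h'
      exact hp ⟨Ioo_subset_Icc_self h'.1, Ioo_subset_Icc_self h'.2⟩
    obtain ⟨MΨ, hMΨ⟩ := hΨs.exists_bound_of_continuous hΨ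
    obtain ⟨MΦ, hMΦ⟩ := hΦs.exists_bound_of_continuous hΦ
    have hbd : ∀ {f k : ℝ × ℝ → ℝ} {M : ℝ}, Integrable f (μ.prod ν) → Continuous k → (∀ p, ‖k p‖ ≤ M) →
        Integrable (fun p => f p * k p) (μ.prod ν) := fun hf hk hM =>
      hf.mul_bdd hk.aestronglyMeasurable (Eventually.of_forall hM)
    have e1 := hw Φ Ψ hΦ hΨ hΦs hΦQ hd
    rw [hprod] at e1
    -- Slice by slice P satisfies the same weak identity as U, so D = U − P is orthogonal to Ψ.
    have e2 : ∫ p, P p * Ψ p ∂μ.prod ν = -∫ p, g p * Φ p ∂μ.prod ν := by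
      rw [integral_prod _ (hbd hP hΨ hMΨ), integral_prod _ (hbd hg' hΦ hMΦ), ← integral_neg]
      refine integral_congr_ae ?_
      filter_upwards [hg'.prod_right_ae] with x hx
      exact integral_mul_primitive hh hx (hΨx x) (hd x) (hΨh x)
    have e3 : ∫ p, D p * Ψ p ∂μ.prod ν = 0 := by
      have : ∀ p, D p * Ψ p = U p * Ψ p - P p * Ψ p := fun p => by simp only [hD]; ring
      simp only [this]
      rw [integral_sub (hbd hU' hΨ hMΨ) (hbd hP hΨ hMΨ), e1, e2, sub_self]
    have hDΘ := hbd hDi hΘ hMΘ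
    have hcb : ∀ x, ‖c x‖ ≤ MΘ * |h - 0| := fun x =>
      intervalIntegral.norm_integral_le_of_norm_le_const fun τ _ => hMΘ _
    have hDηc : Integrable (fun p => D p * η p.2 * c p.1) (μ.prod ν) :=
      hbd hDη (hc.comp continuous_fst) (fun p => hcb p.1)
    -- Fubini: testing D against the correction η c is testing its mean T against Θ.
    have e4 : ∫ p, D p * η p.2 * c p.1 ∂μ.prod ν = ∫ p, T p.1 * Θ p ∂μ.prod ν := by
      rw [integral_prod _ hDηc, integral_prod _ (hbd hT1 hΘ hMΘ)]
      refine integral_congr_ae (Eventually.of_forall fun x => ?_)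
      simp only
      rw [integral_mul_const, integral_const_mul, ← hcν]
    have e5 : ∀ p, Θ p * (D p - T p.1) = D p * Ψ p + D p * η p.2 * c p.1 - T p.1 * Θ p := fun p => by
      simp only [Ψ]; ring
    simp only [e5]
    have hsum : Integrable (fun p => D p * Ψ p + D p * η p.2 * c p.1) (μ.prod ν) :=
      (hbd hDi hΨ hMΨ).add hDηc
    rw [integral_sub hsum (hbd hT1 hΘ hMΘ),
      integral_add (hbd hDi hΨ hMΨ) hDηc, e3, e4, zero_add, sub_self]
  have hopen : IsOpen Q := isOpen_Ioo.prod isOpen_Ioo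
  have hzero := hopen.ae_eq_zero_of_integral_contDiff_smul_eq_zero (μ := (volume : Measure (ℝ × ℝ)))
    (f := fun p => D p - T p.1) ?_ ?_
  · rw [ae_restrict_iff' hopen.measurableSet]
    filter_upwards [hzero] with p hp hpQ
    have := hp hpQ
    simp only [hD, P] at this ⊢
    linarith
  · refine IntegrableOn.locallyIntegrableOn ?_
    unfold IntegrableOn
    rw [hprod]
    exact hDi.sub hT1
  · intro Θ h1 h2 h3
    have := hmain Θ h1.continuous h2 h3
    rw [← hprod] at this
    rw [← this, ← integral_indicator hopen.measurableSet]
    congr 1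
    ext p
    by_cases hp : p ∈ Q
    · simp [hp]
    · have : Θ p = 0 := image_eq_zero_of_notMem_tsupport fun h' => hp (h3 h')
      simp [hp, this]

/-! ### Graph coordinates and boundary profiles -/

/-- `u` is a Sobolev function on `A` with gradient `G`. -/
structure SobolevOn (A : Set Plane) (u : Plane → ℝ) (G : Plane → Plane) : Prop where
  measurable_u : StronglyMeasurable u
  measurable_G : StronglyMeasurable G
  memLp_u : MemLp u 2 (volume.restrict A)
  memLp_G : MemLp G 2 (volume.restrict A)
  weak : HasWeakGradient A u G

lemma HasWeakGradient.mono {U A : Set Plane} (hU : MeasurableSet U)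
    (hAU : A ⊆ U) {u : Plane → ℝ} {G : Plane → Plane} (h : HasWeakGradient U u G) :
    HasWeakGradient A u G := by
  intro φ h1 h2 h3 e
  have key := h φ h1 h2 (h3.trans hAU) e
  have hz : ∀ x, x ∉ A → φ x = 0 := fun x hx => image_eq_zero_of_notMem_tsupport fun h' => hx (h3 h')
  have hz' : ∀ x, x ∉ A → fderiv ℝ φ x e = 0 := fun x hx => by
    rw [fderiv_of_notMem_tsupport (𝕜 := ℝ) (fun h' => hx (h3 h'))]; rfl
  have e1 : ∀ F : Plane → ℝ, (∀ x, x ∉ A → F x = 0) → ∫ x in A, F x = ∫ x in U, F x := fun F hF =>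
    (setIntegral_eq_of_subset_of_forall_sdiff_eq_zero hU hAU fun x hx => hF x hx.2).symm
  rw [e1 _ fun x hx => by rw [hz' x hx, mul_zero], e1 _ fun x hx => by rw [hz x hx, mul_zero], key]

lemma SobolevOn.mono {U A : Set Plane} (hU : MeasurableSet U)
    (hAU : A ⊆ U) {u : Plane → ℝ} {G : Plane → Plane} (h : SobolevOn U u G) : SobolevOn A u G :=
  ⟨h.measurable_u, h.measurable_G, h.memLp_u.mono_measure (Measure.restrict_mono hAU le_rfl),
    h.memLp_G.mono_measure (Measure.restrict_mono hAU le_rfl), h.weak.mono hU hAU⟩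

lemma H1.sobolevOn {U : Set Plane} (u : H1 U) : SobolevOn U u.1.fst u.1.snd :=
  ⟨Lp.stronglyMeasurable _, Lp.stronglyMeasurable _, Lp.memLp _, Lp.memLp _, u.2⟩

/-- The unit vector of the second axis of the frame `e`. -/
noncomputable def vert (e : Plane ≃ₗᵢ[ℝ] Plane) : Plane := e.symm (EuclideanSpace.single 1 1)

lemma norm_vert (e : Plane ≃ₗᵢ[ℝ] Plane) : ‖vert e‖ = 1 := by simp [vert]

/-- The coordinates `(a, s)`, where `a` is the first coordinate in the frame `e` and `s` the height
above the graph of `f`. -/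
noncomputable def shear (e : Plane ≃ₗᵢ[ℝ] Plane) (f : C(ℝ, ℝ)) : ℝ × ℝ ≃ₜ Plane where
  toFun p := e.symm !₂[p.1, f p.1 + p.2]
  invFun y := (e y 0, e y 1 - f (e y 0))
  left_inv p := by simp
  right_inv y := by
    apply e.injective
    ext i
    fin_cases i <;> simp
  continuous_toFun := by
    refine e.symm.continuous.comp ((PiLp.continuous_toLp 2 _).comp ?_)
    refine continuous_pi fun i => ?_
    fin_cases i
    · exact continuous_fst
    · exact (f.continuous.comp continuous_fst).add continuous_snd
  continuous_invFun := by
    have h0 : Continuous fun y : Plane => e y 0 :=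
      (EuclideanSpace.proj (𝕜 := ℝ) (0 : Fin 2)).continuous.comp e.continuous
    have h1 : Continuous fun y : Plane => e y 1 :=
      (EuclideanSpace.proj (𝕜 := ℝ) (1 : Fin 2)).continuous.comp e.continuous
    exact h0.prodMk (h1.sub (f.continuous.comp h0))

section shear

variable (e : Plane ≃ₗᵢ[ℝ] Plane) (f : C(ℝ, ℝ))

@[simp] lemma shear_coord_zero (p : ℝ × ℝ) : e (shear e f p) 0 = p.1 := by simp [shear]

@[simp] lemma shear_coord_one (p : ℝ × ℝ) : e (shear e f p) 1 = f p.1 + p.2 := by simp [shear]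

lemma shear_symm_apply (y : Plane) : (shear e f).symm y = (e y 0, e y 1 - f (e y 0)) := rfl

/-- Vertical lines of the coordinates are lines of direction `vert e`, so the vertical derivative in
the coordinates is a directional derivative in the plane, although the graph is only continuous. -/
lemma shear_symm_add (y : Plane) (r : ℝ) :
    (shear e f).symm (y + r • vert e) = (((shear e f).symm y).1, ((shear e f).symm y).2 + r) := by
  simp only [shear_symm_apply, vert, map_add, map_smul, LinearIsometryEquiv.apply_symm_apply,
    PiLp.add_apply, PiLp.smul_apply, PiLp.single_apply]
  simp
  ring

/-- A translation on each vertical fibre followed by an isometry; no differentiability of f is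
involved. -/
lemma measurePreserving_shear : MeasurePreserving (shear e f) volume volume := by
  have h1 : MeasurePreserving (fun p : ℝ × ℝ => (p.1, f p.1 + p.2)) volume volume := by
    refine MeasurePreserving.skew_product (MeasurePreserving.id volume) (g := fun a s => f a + s) ?_ ?_
    · exact ((f.continuous.comp continuous_fst).add continuous_snd).measurable
    · exact Eventually.of_forall fun a => map_add_left_eq_self volume (f a)
  have h2 := (volume_preserving_finTwoArrow ℝ).symm
  have h3 := PiLp.volume_preserving_toLp (Fin 2)
  have h4 := e.symm.measurePreserving
  have := h4.comp (h3.comp (h2.comp h1))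
  exact this

lemma setLIntegral_shear (Q : Set (ℝ × ℝ)) (F : Plane → ℝ≥0∞) :
    ∫⁻ y in shear e f '' Q, F y = ∫⁻ p in Q, F (shear e f p) := by
  rw [(measurePreserving_shear e f).setLIntegral_comp_emb (shear e f).measurableEmbedding]

lemma setIntegral_shear (Q : Set (ℝ × ℝ)) (F : Plane → ℝ) :
    ∫ y in shear e f '' Q, F y = ∫ p in Q, F (shear e f p) := by
  rw [(measurePreserving_shear e f).setIntegral_image_emb (shear e f).measurableEmbedding]

lemma memLp_comp_shear {E : Type*} [NormedAddCommGroup E] {Q : Set (ℝ × ℝ)}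
    {F : Plane → E} (hF : MemLp F 2 (volume.restrict (shear e f '' Q))) :
    MemLp (fun p => F (shear e f p)) 2 (volume.restrict Q) := by
  refine hF.comp_measurePreserving ?_
  have := (measurePreserving_shear e f).restrict_image_emb (shear e f).measurableEmbedding Q
  exact this

/-- The region between the graphs of `f` and `f + h` over the interval `(a, b)`, in the frame `e`. -/
def patch (a b h : ℝ) : Set Plane := shear e f '' (Ioo a b ×ˢ Ioo 0 h)

lemma isOpen_patch (a b h : ℝ) : IsOpen (patch e f a b h) :=
  (shear e f).isOpenMap _ (isOpen_Ioo.prod isOpen_Ioo)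

variable {e f}

lemma mem_patch {a b h : ℝ} {y : Plane} :
    y ∈ patch e f a b h ↔ e y 0 ∈ Ioo a b ∧ f (e y 0) < e y 1 ∧ e y 1 < f (e y 0) + h := by
  constructor
  · rintro ⟨p, hp, rfl⟩
    simp only [shear_coord_zero, shear_coord_one]
    exact ⟨hp.1, by linarith [hp.2.1], by linarith [hp.2.2]⟩
  · rintro ⟨h0, h1, h2⟩
    refine ⟨(shear e f).symm y, ?_, by simp⟩
    rw [shear_symm_apply]
    exact ⟨h0, by simp only [mem_Ioo]; constructor <;> linarith⟩

end shear

/-- `T` is the boundary profile on `(a, b)` of the function `u` with gradient `G`: along the vertical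
lines `u` differs from `T` at most by the integral of `G`. -/
structure IsProfile (e : Plane ≃ₗᵢ[ℝ] Plane) (f : C(ℝ, ℝ)) (a b h : ℝ) (u : Plane → ℝ)
    (G : Plane → Plane) (T : ℝ → ℝ) : Prop where
  measurable : StronglyMeasurable T
  integrableOn : IntegrableOn T (Ioo a b)
  ae_le : ∀ᵐ p ∂volume.restrict (Ioo a b ×ˢ Ioo 0 h),
    ‖u (shear e f p) - T p.1‖ₑ ≤ ∫⁻ τ in Ioo 0 p.2, ‖G (shear e f (p.1, τ))‖ₑ

/-- In the sheared coordinates the function has the weak vertical derivative (G | `vert e`), and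
`exists_eq_add_primitive` applies. Pulled back test functions are only continuous with one
directional derivative, which is why `HasWeakGradient.integral_mul_lineDeriv` is needed. -/
lemma SobolevOn.exists_isProfile {A : Set Plane} (hA : IsOpen A) {u : Plane → ℝ} {G : Plane → Plane}
    (hu : SobolevOn A u G) {e : Plane ≃ₗᵢ[ℝ] Plane} {f : C(ℝ, ℝ)} {a b h : ℝ} (hab : a < b)
    (hh : 0 < h) (hsub : patch e f a b h ⊆ A) : ∃ T, IsProfile e f a b h u G T := by
  set Q : Set (ℝ × ℝ) := Ioo a b ×ˢ Ioo 0 h with hQ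
  have hfin : IsFiniteMeasure ((volume : Measure (ℝ × ℝ)).restrict Q) := by
    refine ⟨?_⟩
    rw [Measure.restrict_apply_univ, hQ, Measure.volume_eq_prod, Measure.prod_prod]
    exact ENNReal.mul_lt_top (by simp) (by simp)
  have hs : SobolevOn (patch e f a b h) u G :=
    hu.mono hA.measurableSet hsub
  have hG2 : MemLp (fun y => inner ℝ (G y) (vert e)) 2 (volume.restrict (patch e f a b h)) :=
    hs.memLp_G.inner_const (vert e)
  have hUi : IntegrableOn (fun p => u (shear e f p)) Q :=
    (memLp_comp_shear e f hs.memLp_u).integrable (by norm_num)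
  have hgi : IntegrableOn (fun p => inner ℝ (G (shear e f p)) (vert e)) Q :=
    (memLp_comp_shear e f hG2).integrable (by norm_num)
  have hmeas : Measurable (shear e f) := (shear e f).measurable
  obtain ⟨T, hT, hrep⟩ := exists_eq_add_primitive hab hh
    (U := fun p => u (shear e f p)) (g := fun p => inner ℝ (G (shear e f p)) (vert e))
    (Continuous.comp_stronglyMeasurable (g := fun z : Plane => inner ℝ z (vert e)) (by fun_prop)
      (hu.measurable_G.comp_measurable hmeas)) hUi hgi (by
      intro Φ Ψ hΦ hΨ hΦs hΦQ hd
      have hc : Continuous (shear e f).symm := (shear e f).symm.continuous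
      have hts : tsupport (Φ ∘ (shear e f).symm) = shear e f '' tsupport Φ := by
        rw [tsupport_comp_eq_preimage, ← Homeomorph.image_symm, Homeomorph.symm_symm]
      have := hs.weak.integral_mul_lineDeriv (isOpen_patch e f a b h) hs.memLp_u hs.memLp_G
        (φ := Φ ∘ (shear e f).symm) (ψ := Ψ ∘ (shear e f).symm) (e := vert e) (hΦ.comp hc)
        (hΨ.comp hc) (hΦs.comp_homeomorph _) (by rw [hts]; exact image_mono hΦQ) (fun y => by
          unfold HasLineDerivAt
          have h1 := hd ((shear e f).symm y).1 ((shear e f).symm y).2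
          have h2 := HasDerivAt.comp_const_add (f := fun r => Φ (((shear e f).symm y).1, r))
            ((shear e f).symm y).2 0 (by simpa using h1)
          refine h2.congr_of_eventuallyEq (Eventually.of_forall fun r => ?_)
          simp only [Function.comp, shear_symm_add])
      unfold patch at this
      rw [setIntegral_shear, setIntegral_shear] at this
      simpa [Function.comp] using this)
  refine ⟨hT.aestronglyMeasurable.mk T, hT.aestronglyMeasurable.stronglyMeasurable_mk,
    hT.congr hT.aestronglyMeasurable.ae_eq_mk, ?_⟩
  have hTmk : ∀ᵐ p ∂volume.restrict Q, T p.1 = hT.aestronglyMeasurable.mk T p.1 := by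
    rw [hQ, Measure.volume_eq_prod, ← Measure.prod_restrict]
    exact Measure.quasiMeasurePreserving_fst.ae hT.aestronglyMeasurable.ae_eq_mk
  filter_upwards [hrep, hTmk] with p hp hp2
  rw [← hp2, hp, add_sub_cancel_left]
  refine (enorm_integral_le_lintegral_enorm _).trans ?_
  rw [← restrict_Ioo_eq_restrict_Ioc]
  refine lintegral_mono fun τ => ?_
  rw [enorm_le_iff_norm_le]
  refine (norm_inner_le_norm _ _).trans_eq ?_
  rw [norm_vert, mul_one]

lemma sq_lintegral_le {α : Type*} [MeasurableSpace α] {μ : Measure α} {F : α → ℝ≥0∞}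
    (hF : AEMeasurable F μ) : (∫⁻ x, F x ∂μ) ^ 2 ≤ μ univ * ∫⁻ x, F x ^ 2 ∂μ := by
  have h := ENNReal.lintegral_mul_le_Lp_mul_Lq μ (Real.HolderConjugate.two_two) hF
    (aemeasurable_const (b := (1 : ℝ≥0∞)))
  simp only [Pi.mul_apply, mul_one, ENNReal.one_rpow, lintegral_const, one_mul] at h
  calc (∫⁻ x, F x ∂μ) ^ 2 ≤ ((∫⁻ x, F x ^ (2 : ℝ) ∂μ) ^ (1 / 2 : ℝ) * μ univ ^ (1 / 2 : ℝ)) ^ 2 := by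
        gcongr
    _ = μ univ * ∫⁻ x, F x ^ 2 ∂μ := by
        rw [mul_pow, ← ENNReal.rpow_natCast, ← ENNReal.rpow_natCast, ← ENNReal.rpow_mul,
          ← ENNReal.rpow_mul]
        norm_num
        rw [mul_comm]

lemma lintegral_rect_fst {a b h : ℝ} {F : ℝ → ℝ≥0∞} (hF : Measurable F) :
    ∫⁻ p in Ioo a b ×ˢ Ioo 0 h, F p.1 = ENNReal.ofReal h * ∫⁻ x in Ioo a b, F x := by
  have h1 : Measurable fun p : ℝ × ℝ => F p.1 := hF.comp measurable_fst
  rw [Measure.volume_eq_prod, ← Measure.prod_restrict, lintegral_prod _ h1.aemeasurable]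
  simp only [lintegral_const, Measure.restrict_apply_univ, Real.volume_Ioo, sub_zero]
  rw [lintegral_mul_const _ hF, mul_comm]

namespace IsProfile

variable {e : Plane ≃ₗᵢ[ℝ] Plane} {f : C(ℝ, ℝ)} {a b h : ℝ} {u : Plane → ℝ}
    {G : Plane → Plane} {T : ℝ → ℝ}

/-- Cauchy–Schwarz on a vertical segment gives one factor h; integrating the height-independent
bound over the height gives the other. -/
lemma lintegral_sq_le (hG : StronglyMeasurable G)
    (hT : IsProfile e f a b h u G T) :
    ∫⁻ y in patch e f a b h, ‖u y - T (e y 0)‖ₑ ^ 2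
      ≤ ENNReal.ofReal h ^ 2 * ∫⁻ y in patch e f a b h, ‖G y‖ₑ ^ 2 := by
  have hGm : Measurable fun p => ‖G (shear e f p)‖ₑ :=
    (hG.comp_measurable (shear e f).measurable).enorm
  unfold patch
  rw [setLIntegral_shear, setLIntegral_shear]
  simp only [shear_coord_zero]
  set κ : ℝ → ℝ≥0∞ := fun x => ∫⁻ τ in Ioo 0 h, ‖G (shear e f (x, τ))‖ₑ ^ 2 with hκ
  have hκm : Measurable κ := (hGm.pow_const 2).lintegral_prod_right'
  have h1 : ∀ᵐ p ∂volume.restrict (Ioo a b ×ˢ Ioo 0 h),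
      ‖u (shear e f p) - T p.1‖ₑ ^ 2 ≤ ENNReal.ofReal h * κ p.1 := by
    filter_upwards [hT.ae_le, ae_restrict_mem (measurableSet_Ioo.prod measurableSet_Ioo)] with p hp hpQ
    have hm : Measurable fun τ => ‖G (shear e f (p.1, τ))‖ₑ := hGm.comp (by fun_prop)
    calc ‖u (shear e f p) - T p.1‖ₑ ^ 2
        ≤ (∫⁻ τ in Ioo 0 h, ‖G (shear e f (p.1, τ))‖ₑ) ^ 2 := by
          gcongr
          exact hp.trans (lintegral_mono_set (Ioo_subset_Ioo_right hpQ.2.2.le))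
      _ ≤ _ := by
          refine (sq_lintegral_le hm.aemeasurable).trans_eq ?_
          rw [Measure.restrict_apply_univ, Real.volume_Ioo, sub_zero]
  calc _ ≤ ∫⁻ p in Ioo a b ×ˢ Ioo 0 h, ENNReal.ofReal h * κ p.1 := lintegral_mono_ae h1
    _ = ENNReal.ofReal h ^ 2 * ∫⁻ x in Ioo a b, κ x := by
        rw [lintegral_rect_fst (hκm.const_mul _), lintegral_const_mul _ hκm]
        ring
    _ = _ := by
        rw [Measure.volume_eq_prod (α := ℝ) (β := ℝ), ← Measure.prod_restrict,
          lintegral_prod _ (hGm.pow_const 2).aemeasurable]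

/-- The version for thin patches over a subinterval, which the limit of averages requires: only the
part of the gradient below height δ enters. -/
lemma lintegral_le (hG : StronglyMeasurable G) (hT : IsProfile e f a b h u G T) {a' b' δ : ℝ}
    (ha : a ≤ a') (hb : b' ≤ b) (hδ : δ ≤ h) :
    ∫⁻ y in patch e f a' b' δ, ‖u y - T (e y 0)‖ₑ
      ≤ ENNReal.ofReal δ * ∫⁻ x in Ioo a' b', ∫⁻ τ in Ioo 0 δ, ‖G (shear e f (x, τ))‖ₑ := by
  have hGm : Measurable fun p => ‖G (shear e f p)‖ₑ :=
    (hG.comp_measurable (shear e f).measurable).enorm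
  unfold patch
  rw [setLIntegral_shear]
  simp only [shear_coord_zero]
  set κ : ℝ → ℝ≥0∞ := fun x => ∫⁻ τ in Ioo 0 δ, ‖G (shear e f (x, τ))‖ₑ with hκ
  have hκm : Measurable κ := hGm.lintegral_prod_right'
  have hsub : Ioo a' b' ×ˢ Ioo 0 δ ⊆ Ioo a b ×ˢ Ioo 0 h :=
    prod_mono (Ioo_subset_Ioo ha hb) (Ioo_subset_Ioo_right hδ)
  have h1 : ∀ᵐ p ∂volume.restrict (Ioo a' b' ×ˢ Ioo 0 δ),
      ‖u (shear e f p) - T p.1‖ₑ ≤ κ p.1 := by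
    filter_upwards [ae_mono (Measure.restrict_mono hsub le_rfl) hT.ae_le,
      ae_restrict_mem (measurableSet_Ioo.prod measurableSet_Ioo)] with p hp hpQ
    exact hp.trans (lintegral_mono_set (Ioo_subset_Ioo_right hpQ.2.2.le))
  calc _ ≤ ∫⁻ p in Ioo a' b' ×ˢ Ioo 0 δ, κ p.1 := lintegral_mono_ae h1
    _ = _ := lintegral_rect_fst hκm

end IsProfile

lemma lintegral_patch_coord {e : Plane ≃ₗᵢ[ℝ] Plane} {f : C(ℝ, ℝ)} {a b h : ℝ} {F : ℝ → ℝ≥0∞}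
    (hF : Measurable F) :
    ∫⁻ y in patch e f a b h, F (e y 0) = ENNReal.ofReal h * ∫⁻ x in Ioo a b, F x := by
  unfold patch
  rw [setLIntegral_shear]
  simp only [shear_coord_zero]
  exact lintegral_rect_fst hF

/-! ### Boundary charts of Lipschitz domains -/

/-- Near the boundary point `x` the open set `A` is the region above the graph of the Lipschitz
function `f`, in the frame `e`; the region of height `h` above the graph over `(a, b)` lies in `A` and
contains a rectangle over `(a, b)`. -/
structure BoundaryChart (A : Set Plane) (x : Plane) where
  e : Plane ≃ₗᵢ[ℝ] Plane
  f : C(ℝ, ℝ)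
  K : ℝ≥0
  a : ℝ
  b : ℝ
  h : ℝ
  c : ℝ
  l : ℝ
  ρ : ℝ
  lip : LipschitzWith K f
  a_lt_b : a < b
  h_pos : 0 < h
  l_pos : 0 < l
  ρ_pos : 0 < ρ
  patch_subset : patch e f a b h ⊆ A
  rect_subset : patch e (.const ℝ c) a b l ⊆ patch e f a b h
  mem_iff : ∀ y ∈ Metric.ball x ρ, y ∈ A ↔ f (e y 0) < e y 1
  coord_mem : ∀ y ∈ Metric.ball x ρ, e y 0 ∈ Ioo a b
  height_lt : ∀ y ∈ Metric.ball x ρ, e y 1 < f (e y 0) + h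

lemma continuous_coord (e : Plane ≃ₗᵢ[ℝ] Plane) (i : Fin 2) : Continuous fun y : Plane => e y i :=
  (EuclideanSpace.proj (𝕜 := ℝ) i).continuous.comp e.continuous

/-- A frontier point of a set that is locally an open epigraph lies on the graph. -/
lemma eq_graph_of_mem_frontier {A : Set Plane} (hA : IsOpen A) {x y : Plane} {r : ℝ}
    {e : Plane ≃ₗᵢ[ℝ] Plane} {f : ℝ → ℝ} (hf : Continuous f)
    (hg : ∀ z ∈ Metric.ball x r, z ∈ A ↔ f (e z 0) < e z 1)
    (hy : y ∈ Metric.ball x r) (hyf : y ∈ frontier A) : e y 1 = f (e y 0) := by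
  rw [hA.frontier_eq] at hyf
  apply le_antisymm
  · by_contra hlt
    exact hyf.2 ((hg y hy).2 (not_le.1 hlt))
  · by_contra hlt
    have hopen : IsOpen {z : Plane | e z 1 < f (e z 0)} :=
      isOpen_lt (continuous_coord e 1) (hf.comp (continuous_coord e 0))
    obtain ⟨z, ⟨hz1, hz2⟩, hzA⟩ := mem_closure_iff.1 hyf.1 _
      (hopen.inter Metric.isOpen_ball) ⟨not_le.1 hlt, hy⟩
    exact absurd ((hg z hz2).1 hzA) (not_lt.2 (le_of_lt hz1))

lemma HasLipschitzBoundary.exists_chart {A : Set Plane} (hA : IsOpen A)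
    (hL : HasLipschitzBoundary A) {x : Plane} (hx : x ∈ frontier A) :
    Nonempty (BoundaryChart A x) := by
  obtain ⟨e, φ, K, r, hφ, hr, hgraph⟩ := hL x hx
  have hx0 := eq_graph_of_mem_frontier hA hφ.continuous hgraph (Metric.mem_ball_self hr) hx
  have hK : (0 : ℝ) ≤ K := K.2
  -- Over an interval of half-width ρ the graph stays within Kρ of the height of x. A patch of
  -- height 2ρ(1 + K) then lies within ρ + Kρ + 2ρ(1 + K) = r of x, and it contains the rectangle of
  -- height 2ρ that starts Kρ above x.
  set ρ := r / (3 * (1 + K)) with hρ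
  have hρpos : 0 < ρ := by positivity
  have hρr : 3 * (ρ * (1 + K)) = r := by rw [hρ]; field_simp
  have hρle : ρ ≤ r := by nlinarith
  have hLip : ∀ a b, |φ a - φ b| ≤ K * |a - b| := fun a b => by
    simpa [Real.dist_eq] using hφ.dist_le_mul a b
  have hLx : ∀ a, |a - e x 0| ≤ ρ → |φ a - e x 1| ≤ K * ρ := fun a ha => by
    rw [hx0]; exact (hLip _ _).trans (mul_le_mul_of_nonneg_left ha hK)
  refine ⟨⟨e, ⟨φ, hφ.continuous⟩, K, e x 0 - ρ, e x 0 + ρ, 2 * ρ * (1 + K), e x 1 + K * ρ, 2 * ρ, ρ, hφ,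
    by linarith, by positivity, by positivity, hρpos, ?_, ?_, ?_, ?_, ?_⟩⟩
  · intro y hy
    obtain ⟨h0, h1, h2⟩ := mem_patch.1 hy
    simp only [ContinuousMap.coe_mk] at h1 h2
    have ha : |e y 0 - e x 0| < ρ := by rw [abs_lt]; constructor <;> linarith [h0.1, h0.2]
    have hb := abs_le.1 (hLx _ ha.le)
    refine (hgraph y ?_).2 h1
    refine (dist_le_coord e x y).trans_lt ?_
    have : |e y 1 - e x 1| ≤ K * ρ + 2 * ρ * (1 + K) := by
      rw [abs_le]; constructor <;> nlinarith
    nlinarith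
  · intro y hy
    obtain ⟨h0, h1, h2⟩ := mem_patch.1 hy
    simp only [ContinuousMap.const_apply] at h1 h2
    have ha : |e y 0 - e x 0| < ρ := by rw [abs_lt]; constructor <;> linarith [h0.1, h0.2]
    have hb := abs_le.1 (hLx _ ha.le)
    refine mem_patch.2 ⟨h0, ?_, ?_⟩
    · simp only [ContinuousMap.coe_mk]; linarith
    · simp only [ContinuousMap.coe_mk]; nlinarith
  · exact fun y hy => hgraph y (Metric.ball_subset_ball hρle hy)
  · intro y hy
    have := abs_lt.1 ((coord_le_dist e x y 0).trans_lt hy)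
    constructor <;> linarith
  · intro y hy
    have h0 := (coord_le_dist e x y 0).trans_lt hy
    have h1 := abs_lt.1 ((coord_le_dist e x y 1).trans_lt hy)
    have hb := abs_le.1 (hLx _ h0.le)
    simp only [ContinuousMap.coe_mk]
    nlinarith

namespace BoundaryChart

variable {A : Set Plane} {x : Plane} (c : BoundaryChart A x)

lemma ball_inter_subset : Metric.ball x c.ρ ∩ A ⊆ patch c.e c.f c.a c.b c.h := fun y hy =>
  mem_patch.2 ⟨c.coord_mem y hy.1, (c.mem_iff y hy.1).1 hy.2, c.height_lt y hy.1⟩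

lemma eq_shear (hA : IsOpen A) {y : Plane} (hy : y ∈ Metric.ball x c.ρ) (hyf : y ∈ frontier A) :
    y = shear c.e c.f (c.e y 0, 0) := by
  have := eq_graph_of_mem_frontier hA c.f.continuous c.mem_iff hy hyf
  rw [← (shear c.e c.f).symm_apply_eq, shear_symm_apply, this, sub_self]

lemma lip_abs (p q : ℝ) : |c.f p - c.f q| ≤ c.K * |p - q| := by
  simpa [Real.dist_eq] using c.lip.dist_le_mul p q

/-- Together with `patch_subset_ball_inter` this squeezes small balls, cut by A, between patches of
comparable size, so that averages over balls can be estimated in graph coordinates. -/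
lemma ball_inter_subset_patch {y : Plane} (hyg : c.e y 1 = c.f (c.e y 0)) {r : ℝ}
    (hr : Metric.ball y r ⊆ Metric.ball x c.ρ) :
    Metric.ball y r ∩ A ⊆ patch c.e c.f (c.e y 0 - r) (c.e y 0 + r) ((1 + c.K) * r) := by
  rintro z ⟨hz, hzA⟩
  have h0 := (coord_le_dist c.e y z 0).trans_lt hz
  have h1 := abs_lt.1 ((coord_le_dist c.e y z 1).trans_lt hz)
  have h2 := abs_le.1 ((c.lip_abs (c.e z 0) (c.e y 0)).trans
    (mul_le_mul_of_nonneg_left h0.le c.K.2))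
  have h0' := abs_lt.1 h0
  refine mem_patch.2 ⟨⟨by linarith, by linarith⟩, (c.mem_iff z (hr hz)).1 hzA, ?_⟩
  rw [hyg] at h1
  linarith [h1.2, h2.1]

lemma patch_subset_ball_inter {y : Plane} (hyg : c.e y 1 = c.f (c.e y 0)) {r : ℝ}
    (hr : Metric.ball y ((2 + c.K) * r) ⊆ Metric.ball x c.ρ) :
    patch c.e c.f (c.e y 0 - r) (c.e y 0 + r) r ⊆ Metric.ball y ((2 + c.K) * r) ∩ A := by
  intro z hz
  obtain ⟨h0, h1, h2⟩ := mem_patch.1 hz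
  have ha : |c.e z 0 - c.e y 0| < r := by rw [abs_lt]; constructor <;> linarith [h0.1, h0.2]
  have hb := abs_le.1 ((c.lip_abs (c.e z 0) (c.e y 0)).trans
    (mul_le_mul_of_nonneg_left ha.le c.K.2))
  have hmem : z ∈ Metric.ball y ((2 + c.K) * r) := by
    refine (dist_le_coord c.e y z).trans_lt ?_
    have : |c.e z 1 - c.e y 1| ≤ c.K * r + r := by
      rw [hyg, abs_le]; constructor <;> linarith
    linarith
  exact ⟨hmem, (c.mem_iff z (hr hmem)).2 h1⟩

end BoundaryChart

/-! ### Traces as limits of averages, and the trace inequality -/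

lemma ae_tendsto_lintegral_closedBall_div {F : ℝ → ℝ≥0∞} (hF : Measurable F) (hfin : ∫⁻ x, F x ≠ ⊤) :
    ∀ᵐ x, Tendsto (fun r => (∫⁻ y in Metric.closedBall x r, F y) / volume (Metric.closedBall x r))
      (𝓝[>] 0) (𝓝 (F x)) := by
  filter_upwards [(IsUnifLocDoublingMeasure.vitaliFamily (volume : Measure ℝ) 1).ae_tendsto_lintegral_div
    hF.aemeasurable hfin] with x hx
  refine hx.comp (IsUnifLocDoublingMeasure.tendsto_closedBall_filterAt volume _ _ tendsto_id ?_)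
  filter_upwards [self_mem_nhdsWithin] with r hr
  exact Metric.mem_closedBall_self (by simpa using le_of_lt (mem_Ioi.1 hr))

lemma ae_tendsto_lintegral_sub_closedBall_div {T : ℝ → ℝ} (hT : LocallyIntegrable T) :
    ∀ᵐ x, Tendsto (fun r => (∫⁻ y in Metric.closedBall x r, ‖T y - T x‖ₑ)
      / volume (Metric.closedBall x r)) (𝓝[>] 0) (𝓝 0) := by
  filter_upwards [(IsUnifLocDoublingMeasure.vitaliFamily (volume : Measure ℝ)
    1).ae_tendsto_lintegral_enorm_sub_div hT] with x hx
  refine hx.comp (IsUnifLocDoublingMeasure.tendsto_closedBall_filterAt volume _ _ tendsto_id ?_)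
  filter_upwards [self_mem_nhdsWithin] with r hr
  exact Metric.mem_closedBall_self (by simpa using le_of_lt (mem_Ioi.1 hr))

lemma volume_patch (e : Plane ≃ₗᵢ[ℝ] Plane) (f : C(ℝ, ℝ)) (a b h : ℝ) :
    volume (patch e f a b h) = ENNReal.ofReal h * ENNReal.ofReal (b - a) := by
  have := lintegral_patch_coord (e := e) (f := f) (a := a) (b := b) (h := h)
    (F := fun _ => 1) measurable_const
  simpa using this

lemma enorm_setAverage_sub_le {B : Set Plane} (hpos : volume B ≠ 0) (hfin : volume B ≠ ⊤)
    {u : Plane → ℝ} (hu : IntegrableOn u B) (c : ℝ) :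
    ‖(⨍ y in B, u y) - c‖ₑ ≤ (∫⁻ y in B, ‖u y - c‖ₑ) / volume B := by
  have h1 : (⨍ y in B, u y) - c = ⨍ y in B, (u y - c) := by
    have h2 := setAverage_const hpos hfin c
    rw [setAverage_eq] at h2
    rw [setAverage_eq, setAverage_eq, integral_sub hu (integrableOn_const hfin), smul_sub, h2]
  rw [h1, setAverage_eq, enorm_smul, ENNReal.div_eq_inv_mul]
  gcongr
  · rw [measureReal_def, Real.enorm_eq_ofReal (by positivity), ← ENNReal.toReal_inv,
      ENNReal.ofReal_toReal (by simpa using hpos)]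
  · exact enorm_integral_le_lintegral_enorm _

/-- The boundary profile is the trace almost everywhere. -/
lemma BoundaryChart.ae_hasTrace {A : Set Plane} {x : Plane} (c : BoundaryChart A x)
    {u : Plane → ℝ} {G : Plane → Plane} {T : ℝ → ℝ} (hA : IsOpen A) (hu : SobolevOn A u G)
    (hT : IsProfile c.e c.f c.a c.b c.h u G T) :
    ∀ᵐ p, ∀ y ∈ Metric.ball x c.ρ ∩ frontier A, c.e y 0 = p → HasTrace A u y (T p) := by
  have hGm : Measurable fun p => ‖G (shear c.e c.f p)‖ₑ :=
    (hu.measurable_G.comp_measurable (shear c.e c.f).measurable).enorm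
  -- A bound for the variation of u across the lowest layer, of height h/(n+1). Only countably many
  -- layers are used, so almost every p is a differentiation point of all of them.
  let F : ℕ → ℝ → ℝ≥0∞ := fun n =>
    (Ioo c.a c.b).indicator fun p => ∫⁻ τ in Ioo 0 (c.h / (n + 1)), ‖G (shear c.e c.f (p, τ))‖ₑ
  have hFm : ∀ n, Measurable (F n) := fun n =>
    hGm.lintegral_prod_right'.indicator measurableSet_Ioo
  have hfin0 : ∫⁻ p, F 0 p ≠ ⊤ := by
    have hs : SobolevOn (patch c.e c.f c.a c.b c.h) u G := hu.mono hA.measurableSet c.patch_subset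
    have hfv : IsFiniteMeasure (volume.restrict (patch c.e c.f c.a c.b c.h)) := by
      refine ⟨?_⟩
      rw [Measure.restrict_apply_univ, volume_patch]
      exact ENNReal.mul_lt_top ENNReal.ofReal_lt_top ENNReal.ofReal_lt_top
    have h1 : ∫⁻ y in patch c.e c.f c.a c.b c.h, ‖G y‖ₑ < ⊤ :=
      (hs.memLp_G.integrable (by norm_num)).hasFiniteIntegral
    unfold patch at h1
    rw [setLIntegral_shear, Measure.volume_eq_prod, ← Measure.prod_restrict,
      lintegral_prod _ hGm.aemeasurable] at h1
    simp only [F]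
    rw [lintegral_indicator measurableSet_Ioo]
    simpa using h1.ne
  have hmono : ∀ n p, F n p ≤ F 0 p := by
    intro n p
    refine indicator_le_indicator (lintegral_mono_set (Ioo_subset_Ioo_right ?_))
    have : (0 : ℝ) ≤ n := by positivity
    simp only [Nat.cast_zero, zero_add, div_one]
    exact div_le_self c.h_pos.le (by linarith)
  have hfin : ∀ n, ∫⁻ p, F n p ≠ ⊤ := fun n =>
    ((lintegral_mono (hmono n)).trans_lt hfin0.lt_top).ne
  let T' : ℝ → ℝ := (Ioo c.a c.b).indicator T
  have hT' : LocallyIntegrable T' :=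
    ((integrable_indicator_iff measurableSet_Ioo).2 hT.integrableOn).locallyIntegrable
  have hae := ae_all_iff.2 fun n => ae_tendsto_lintegral_closedBall_div (hFm n) (hfin n)
  filter_upwards [hae, ae_tendsto_lintegral_sub_closedBall_div hT', ae_lt_top (hFm 0) hfin0]
    with p hF hTp hlt y hy hyp
  have hpI : p ∈ Ioo c.a c.b := hyp ▸ c.coord_mem y hy.1
  have hyg : c.e y 1 = c.f (c.e y 0) :=
    eq_graph_of_mem_frontier hA c.f.continuous c.mem_iff hy.1 hy.2
  have hF0 : Tendsto (fun n => F n p) atTop (𝓝 0) := by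
    simp only [F, indicator_of_mem hpI]
    refine tendsto_setLIntegral_zero (μ := (volume : Measure ℝ).restrict (Ioo 0 c.h))
      (f := fun τ => ‖G (shear c.e c.f (p, τ))‖ₑ)
      (s := fun n : ℕ => Ioo 0 (c.h / (n + 1))) ?_ ?_ |>.congr fun n => ?_
    · simpa [F, indicator_of_mem hpI] using hlt.ne
    · have h1 : Tendsto (fun n : ℕ => ENNReal.ofReal (c.h / (n + 1))) atTop (𝓝 0) := by
        have := (tendsto_one_div_add_atTop_nhds_zero_nat (𝕜 := ℝ)).const_mul c.h
        rw [← ENNReal.ofReal_zero]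
        refine (ENNReal.continuous_ofReal.tendsto 0).comp ?_
        simpa [div_eq_mul_inv] using this
      refine tendsto_of_tendsto_of_tendsto_of_le_of_le tendsto_const_nhds h1 (fun _ => zero_le)
        (fun n => ?_)
      refine (Measure.restrict_apply_le _ _).trans_eq ?_
      rw [Real.volume_Ioo, sub_zero]
    · rw [Measure.restrict_restrict measurableSet_Ioo, inter_eq_left.2]
      refine Ioo_subset_Ioo_right ?_
      have : (0 : ℝ) ≤ n := by positivity
      exact div_le_self c.h_pos.le (by linarith)
  -- the comparison constant
  have hK : (0 : ℝ) ≤ c.K := c.K.2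
  -- The enclosing patch contributes the height (1 + K)r, and the volume of the cut ball is at least
  -- 2δ² with δ = r/(2 + K). Their quotient is C divided by the length 2r.
  set C : ℝ≥0∞ := ENNReal.ofReal ((1 + c.K) * (2 + c.K) ^ 2) with hC
  have hCtop : C ≠ ⊤ := ENNReal.ofReal_ne_top
  have hbound : ∀ n, ∀ᶠ r in 𝓝[>] (0 : ℝ), ‖(⨍ z in Metric.ball y r ∩ A, u z) - T p‖ₑ ≤
      C * ((∫⁻ q in Metric.closedBall p r, F n q) / volume (Metric.closedBall p r)
        + (∫⁻ q in Metric.closedBall p r, ‖T' q - T' p‖ₑ) / volume (Metric.closedBall p r)) := by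
    intro n
    have e1 : ∀ᶠ r in 𝓝[>] (0 : ℝ), Metric.ball y r ⊆ Metric.ball x c.ρ := by
      filter_upwards [Ioo_mem_nhdsGT (sub_pos.2 (Metric.mem_ball.1 hy.1))] with r hr
      exact Metric.ball_subset_ball' (by linarith [hr.2])
    have e2 : ∀ᶠ r in 𝓝[>] (0 : ℝ), r < min (p - c.a) (c.b - p) :=
      (eventually_lt_nhds (lt_min (sub_pos.2 hpI.1) (sub_pos.2 hpI.2))).filter_mono nhdsWithin_le_nhds
    have e3 : ∀ᶠ r in 𝓝[>] (0 : ℝ), r < c.h / (n + 1) / (1 + c.K) :=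
      (eventually_lt_nhds (by have := c.h_pos; positivity)).filter_mono nhdsWithin_le_nhds
    filter_upwards [e1, e2, e3, self_mem_nhdsWithin] with r hr1 hr2 hr3 hr0
    have hr0 : 0 < r := hr0
    rw [lt_min_iff] at hr2
    have hr3' : (1 + c.K) * r ≤ c.h / (n + 1) := by
      rw [lt_div_iff₀ (by positivity)] at hr3; linarith
    have hr3'' : (1 + c.K) * r ≤ c.h := hr3'.trans (div_le_self c.h_pos.le (by
      have : (0 : ℝ) ≤ n := by positivity
      linarith))
    set B := Metric.ball y r ∩ A with hB
    set δ := r / (2 + c.K) with hδ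
    have hδr : (2 + c.K) * δ = r := by rw [hδ]; field_simp
    have hδ0 : 0 < δ := by positivity
    have hlow : ENNReal.ofReal δ * ENNReal.ofReal (2 * δ) ≤ volume B := by
      have := measure_mono (μ := volume) (c.patch_subset_ball_inter hyg (r := δ) (by rwa [hδr]))
      rw [hδr, volume_patch] at this
      convert this using 3
      ring
    have hBpos : volume B ≠ 0 := by
      refine (lt_of_lt_of_le ?_ hlow).ne'
      exact ENNReal.mul_pos (by simpa using hδ0) (by simpa using hδ0)
    have hBfin : volume B ≠ ⊤ :=
      ((measure_mono inter_subset_left).trans_lt Metric.isBounded_ball.measure_lt_top).ne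
    have hBu : IntegrableOn u B := by
      have : IsFiniteMeasure (volume.restrict B) := ⟨by simpa using hBfin.lt_top⟩
      exact (hu.memLp_u.mono_measure (Measure.restrict_mono inter_subset_right le_rfl)).integrable
        (by norm_num)
    refine (enorm_setAverage_sub_le hBpos hBfin hBu _).trans ?_
    -- The function is compared with the profile on its own vertical line, which F n controls, and
    -- the profile is compared with its value at p, which the Lebesgue point property controls.
    have hup : ∫⁻ z in B, ‖u z - T p‖ₑ ≤ ENNReal.ofReal ((1 + c.K) * r) *
        ((∫⁻ q in Metric.closedBall p r, F n q) + ∫⁻ q in Metric.closedBall p r, ‖T' q - T' p‖ₑ) := by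
      have hsub := c.ball_inter_subset_patch hyg hr1
      rw [hyp] at hsub
      have hTm : Measurable fun q => ‖T q - T p‖ₑ :=
        (hT.measurable.measurable.sub_const _).enorm
      have hIoo : Ioo (p - r) (p + r) ⊆ Metric.closedBall p r := by
        rw [← Real.ball_eq_Ioo]; exact Metric.ball_subset_closedBall
      have hIab : Ioo (p - r) (p + r) ⊆ Ioo c.a c.b :=
        Ioo_subset_Ioo (by linarith) (by linarith)
      calc ∫⁻ z in B, ‖u z - T p‖ₑ
          ≤ ∫⁻ z in patch c.e c.f (p - r) (p + r) ((1 + c.K) * r), ‖u z - T p‖ₑ :=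
            lintegral_mono_set hsub
        _ ≤ ∫⁻ z in patch c.e c.f (p - r) (p + r) ((1 + c.K) * r),
              (‖u z - T (c.e z 0)‖ₑ + ‖T (c.e z 0) - T p‖ₑ) := by
            refine lintegral_mono fun z => ?_
            have : u z - T p = (u z - T (c.e z 0)) + (T (c.e z 0) - T p) := by ring
            rw [this]; exact enorm_add_le _ _
        _ = (∫⁻ z in patch c.e c.f (p - r) (p + r) ((1 + c.K) * r), ‖u z - T (c.e z 0)‖ₑ)
              + ENNReal.ofReal ((1 + c.K) * r) * ∫⁻ q in Ioo (p - r) (p + r), ‖T q - T p‖ₑ := by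
            rw [← lintegral_patch_coord (e := c.e) (f := c.f) hTm]
            exact lintegral_add_right _ (hTm.comp (continuous_coord c.e 0).measurable)
        _ ≤ ENNReal.ofReal ((1 + c.K) * r) * (∫⁻ q in Metric.closedBall p r, F n q)
              + ENNReal.ofReal ((1 + c.K) * r) * ∫⁻ q in Metric.closedBall p r, ‖T' q - T' p‖ₑ := by
            gcongr ?_ + _ * ?_
            · refine (hT.lintegral_le hu.measurable_G (by linarith) (by linarith) hr3'').trans ?_
              refine mul_le_mul' le_rfl ?_
              refine (setLIntegral_mono' (g := F n) measurableSet_Ioo fun q hq => ?_).trans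
                (lintegral_mono_set hIoo)
              simp only [F, indicator_of_mem (hIab hq)]
              exact lintegral_mono_set (Ioo_subset_Ioo_right hr3')
            · refine (setLIntegral_mono' measurableSet_Ioo fun q hq => ?_).trans
                (lintegral_mono_set hIoo)
              simp only [T', indicator_of_mem (hIab hq), indicator_of_mem hpI]
              exact le_rfl
        _ = _ := by rw [mul_add]
    rw [Real.volume_closedBall, ← ENNReal.add_div]
    set S := (∫⁻ q in Metric.closedBall p r, F n q) + ∫⁻ q in Metric.closedBall p r, ‖T' q - T' p‖ₑ
    calc (∫⁻ z in B, ‖u z - T p‖ₑ) / volume B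
        ≤ (ENNReal.ofReal ((1 + c.K) * r) * S) / (ENNReal.ofReal δ * ENNReal.ofReal (2 * δ)) := by
          gcongr
      _ = C * (S / ENNReal.ofReal (2 * r)) := by
          rw [← ENNReal.ofReal_mul hδ0.le, ENNReal.div_eq_inv_mul, ENNReal.div_eq_inv_mul, hC,
            ← ENNReal.ofReal_inv_of_pos (by positivity), ← ENNReal.ofReal_inv_of_pos (by positivity),
            ← mul_assoc, ← mul_assoc _ (ENNReal.ofReal (2 * r)⁻¹) S, ← ENNReal.ofReal_mul (by positivity),
            ← ENNReal.ofReal_mul (by positivity)]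
          congr 2
          rw [hδ]
          field_simp
  unfold HasTrace
  rw [tendsto_iff_edist_tendsto_0, ENNReal.tendsto_nhds_zero]
  intro ε hε
  -- The order of choices matters: n is fixed first, so that C · F n p is below the tolerance, and
  -- only then does the radius tend to zero.
  have hCF : Tendsto (fun n => C * (F n p + 0)) atTop (𝓝 0) := by
    have := ENNReal.Tendsto.const_mul (a := C) (hF0.add_const 0) (Or.inr hCtop)
    simpa using this
  obtain ⟨n, hn⟩ := (hCF.eventually (gt_mem_nhds hε)).exists
  have hlim := ENNReal.Tendsto.const_mul (a := C) ((hF n).add hTp) (Or.inr hCtop)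
  filter_upwards [hbound n, hlim.eventually (gt_mem_nhds hn)] with r h1 h2
  rw [edist_eq_enorm_sub]
  exact h1.trans h2.le

lemma enorm_add_sq_le (x y : ℝ) : ‖x + y‖ₑ ^ 2 ≤ 2 * (‖x‖ₑ ^ 2 + ‖y‖ₑ ^ 2) := by
  refine (pow_le_pow_left' (enorm_add_le x y) 2).trans ?_
  have := ENNReal.rpow_add_le_mul_rpow_add_rpow ‖x‖ₑ ‖y‖ₑ (p := 2) (by norm_num)
  norm_num at this
  exact this

lemma HasTrace.traceFn_eq {U : Set Plane} {u : Plane → ℝ} {x : Plane} {t : ℝ}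
    (h : HasTrace U u x t) : traceFn U u x = t := h.limUnder_eq

lemma lintegral_add_sq_le {α : Type*} [MeasurableSpace α] {μ : Measure α} {v w : α → ℝ}
    (hw : Measurable w) :
    ∫⁻ y, ‖v y + w y‖ₑ ^ 2 ∂μ ≤ 2 * ((∫⁻ y, ‖v y‖ₑ ^ 2 ∂μ) + ∫⁻ y, ‖w y‖ₑ ^ 2 ∂μ) := by
  rw [← lintegral_add_right _ (hw.enorm.pow_const 2), ← lintegral_const_mul' _ _ (by simp)]
  exact lintegral_mono fun y => enorm_add_sq_le _ _

namespace BoundaryChart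

variable {A : Set Plane} {x : Plane} (c : BoundaryChart A x)

lemma lipschitzWith_graph : LipschitzWith (1 + c.K) fun p : ℝ => shear c.e c.f (p, 0) := by
  refine LipschitzWith.of_dist_le_mul fun p q => (dist_le_coord c.e _ _).trans ?_
  simp only [shear_coord_zero, shear_coord_one, add_zero, NNReal.coe_add, NNReal.coe_one,
    Real.dist_eq]
  linarith [c.lip_abs p q]

lemma hausdorffMeasure_graph_le (N : Set ℝ) :
    μH[1] ((fun p : ℝ => shear c.e c.f (p, 0)) '' N) ≤ (1 + c.K : ℝ≥0) * volume N := by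
  have := c.lipschitzWith_graph.hausdorffMeasure_image_le (d := 1) zero_le_one N
  simpa [hausdorffMeasure_real] using this

lemma restrict_frontier_le (hA : IsOpen A) :
    (μH[1] : Measure Plane).restrict (Metric.ball x c.ρ ∩ frontier A) ≤
      ((1 + c.K : ℝ≥0) : ℝ≥0∞) •
        Measure.map (fun p : ℝ => shear c.e c.f (p, 0)) (volume.restrict (Ioo c.a c.b)) := by
  have hg : Measurable fun p : ℝ => shear c.e c.f (p, 0) := c.lipschitzWith_graph.continuous.measurable
  refine Measure.le_iff.2 fun s hs => ?_
  rw [Measure.restrict_apply hs, Measure.smul_apply, Measure.map_apply hg hs,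
    Measure.restrict_apply (hg hs), smul_eq_mul]
  refine (measure_mono ?_).trans (c.hausdorffMeasure_graph_le _)
  rintro y ⟨hys, hyb, hyf⟩
  have := c.eq_shear hA hyb hyf
  exact ⟨c.e y 0, ⟨by rw [mem_preimage, ← this]; exact hys, c.coord_mem y hyb⟩, this.symm⟩

/-- The frontier near x is parametrized by a Lipschitz map from the line, which sends Lebesgue null
sets to ℋ¹ null sets. -/
lemma ae_restrict_frontier (hA : IsOpen A) {P : Plane → Prop}
    (h : ∀ᵐ p, ∀ y ∈ Metric.ball x c.ρ ∩ frontier A, c.e y 0 = p → P y) :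
    ∀ᵐ y ∂(μH[1] : Measure Plane).restrict (Metric.ball x c.ρ ∩ frontier A), P y := by
  rw [ae_restrict_iff' (Metric.isOpen_ball.measurableSet.inter isClosed_frontier.measurableSet), ae_iff]
  refine measure_mono_null (fun y hy => ?_)
    (le_antisymm ((c.hausdorffMeasure_graph_le _).trans_eq (by rw [ae_iff.1 h, mul_zero])) zero_le)
  rw [mem_ofPred_eq, Classical.not_imp] at hy
  exact ⟨c.e y 0, fun h' => hy.2 (h' y hy.1 rfl), (c.eq_shear hA hy.1.1 hy.1.2).symm⟩

/-- On the patch T is (T − u) + u; as T does not depend on the height, integrating over the patch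
multiplies its square integral by h. -/
lemma lintegral_profile_le {u : Plane → ℝ} {G : Plane → Plane} {T : ℝ → ℝ}
    (hum : StronglyMeasurable u) (hGm : StronglyMeasurable G)
    (hT : IsProfile c.e c.f c.a c.b c.h u G T) :
    ENNReal.ofReal c.h * ∫⁻ p in Ioo c.a c.b, ‖T p‖ₑ ^ 2 ≤
      2 * (ENNReal.ofReal c.h ^ 2 * (∫⁻ y in A, ‖G y‖ₑ ^ 2) + ∫⁻ y in A, ‖u y‖ₑ ^ 2) := by
  rw [← lintegral_patch_coord (e := c.e) (f := c.f) (hT.measurable.measurable.enorm.pow_const 2)]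
  have e1 : ∀ y, ‖T (c.e y 0)‖ₑ ^ 2 = ‖(T (c.e y 0) - u y) + u y‖ₑ ^ 2 := fun y => by
    rw [sub_add_cancel]
  simp only [e1]
  refine (lintegral_add_sq_le hum.measurable).trans ?_
  gcongr 2 * (?_ + ?_)
  · refine le_trans (le_of_eq ?_) ((hT.lintegral_sq_le hGm).trans ?_)
    · refine lintegral_congr fun y => ?_
      rw [← enorm_neg, neg_sub]
    · exact mul_le_mul' le_rfl (lintegral_mono_set c.patch_subset)
  · exact lintegral_mono_set c.patch_subset

end BoundaryChart

/-- Sobolev functions on bounded Lipschitz domains have square integrable traces. -/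
theorem exists_trace_bound {A : Set Plane} (hA : IsOpen A) (hb : Bornology.IsBounded A)
    (hL : HasLipschitzBoundary A) : ∃ C : ℝ≥0∞, C ≠ ⊤ ∧ ∀ u G, SobolevOn A u G →
      (∀ᵐ y ∂(μH[1] : Measure Plane).restrict (frontier A), ∃ t, HasTrace A u y t) ∧
      ∫⁻ y in frontier A, ‖traceFn A u y‖ₑ ^ 2 ∂(μH[1] : Measure Plane) ≤
        C * ((∫⁻ y in A, ‖u y‖ₑ ^ 2) + ∫⁻ y in A, ‖G y‖ₑ ^ 2) := by
  have hcpt : IsCompact (frontier A) :=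
    hb.isCompact_closure.of_isClosed_subset isClosed_frontier frontier_subset_closure
  have key : ∃ C : ℝ≥0∞, C ≠ ⊤ ∧ ∀ u G, SobolevOn A u G →
      (∀ᵐ y ∂(μH[1] : Measure Plane).restrict (frontier A ∩ frontier A), ∃ t, HasTrace A u y t) ∧
      ∫⁻ y in frontier A ∩ frontier A, ‖traceFn A u y‖ₑ ^ 2 ∂(μH[1] : Measure Plane) ≤
        C * ((∫⁻ y in A, ‖u y‖ₑ ^ 2) + ∫⁻ y in A, ‖G y‖ₑ ^ 2) := by
    -- The bound passes to subsets and to finite unions, so by compactness of the frontier it is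
    -- enough to have it near each point.
    refine hcpt.induction_on (p := fun s => ∃ C : ℝ≥0∞, C ≠ ⊤ ∧ ∀ u G, SobolevOn A u G →
      (∀ᵐ y ∂(μH[1] : Measure Plane).restrict (s ∩ frontier A), ∃ t, HasTrace A u y t) ∧
      ∫⁻ y in s ∩ frontier A, ‖traceFn A u y‖ₑ ^ 2 ∂(μH[1] : Measure Plane) ≤
        C * ((∫⁻ y in A, ‖u y‖ₑ ^ 2) + ∫⁻ y in A, ‖G y‖ₑ ^ 2)) ?_ ?_ ?_ ?_
    · exact ⟨0, by simp, fun u G _ => by simp⟩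
    · rintro s t hst ⟨C, hC, h⟩
      refine ⟨C, hC, fun u G hu => ⟨?_, ?_⟩⟩
      · exact ae_mono (Measure.restrict_mono (inter_subset_inter_left _ hst) le_rfl) (h u G hu).1
      · exact (lintegral_mono_set (inter_subset_inter_left _ hst)).trans (h u G hu).2
    · rintro s t ⟨C, hC, h⟩ ⟨C', hC', h'⟩
      refine ⟨C + C', by simp [hC, hC'], fun u G hu => ?_⟩
      rw [union_inter_distrib_right]
      refine ⟨(ae_restrict_union_iff _ _ _).2 ⟨(h u G hu).1, (h' u G hu).1⟩, ?_⟩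
      refine (lintegral_union_le _ _ _).trans ?_
      rw [add_mul]
      exact add_le_add (h u G hu).2 (h' u G hu).2
    · intro x hx
      obtain ⟨c⟩ := hL.exists_chart hA hx
      refine ⟨Metric.ball x c.ρ, mem_nhdsWithin_of_mem_nhds (Metric.ball_mem_nhds x c.ρ_pos), ?_⟩
      have hh0 : ENNReal.ofReal c.h ≠ 0 := by simpa using c.h_pos
      refine ⟨(1 + c.K : ℝ≥0) * ((ENNReal.ofReal c.h)⁻¹ * (2 * (ENNReal.ofReal c.h ^ 2 + 1))), ?_,
        fun u G hu => ?_⟩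
      · refine ENNReal.mul_ne_top ENNReal.coe_ne_top (ENNReal.mul_ne_top (by simpa using hh0) ?_)
        exact ENNReal.mul_ne_top (by simp) (by simp)
      obtain ⟨T, hT⟩ := hu.exists_isProfile hA c.a_lt_b c.h_pos c.patch_subset
      have htr := c.ae_restrict_frontier hA (P := fun y => HasTrace A u y (T (c.e y 0))) (by
        filter_upwards [c.ae_hasTrace hA hu hT] with p hp y hy hyp
        rw [hyp]; exact hp y hy hyp)
      refine ⟨htr.mono fun y hy => ⟨_, hy⟩, ?_⟩
      have hTm : Measurable fun y : Plane => ‖T (c.e y 0)‖ₑ ^ 2 :=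
        (hT.measurable.measurable.comp (continuous_coord c.e 0).measurable).enorm.pow_const 2
      calc ∫⁻ y in Metric.ball x c.ρ ∩ frontier A, ‖traceFn A u y‖ₑ ^ 2 ∂(μH[1] : Measure Plane)
          = ∫⁻ y in Metric.ball x c.ρ ∩ frontier A, ‖T (c.e y 0)‖ₑ ^ 2 ∂(μH[1] : Measure Plane) := by
            refine lintegral_congr_ae ?_
            filter_upwards [htr] with y hy
            rw [hy.traceFn_eq]
        _ ≤ (1 + c.K : ℝ≥0) * ∫⁻ p in Ioo c.a c.b, ‖T p‖ₑ ^ 2 := by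
            refine (lintegral_mono' (c.restrict_frontier_le hA) le_rfl).trans_eq ?_
            rw [lintegral_smul_measure, lintegral_map hTm
              c.lipschitzWith_graph.continuous.measurable, smul_eq_mul]
            simp only [shear_coord_zero]
        _ ≤ (1 + c.K : ℝ≥0) * ((ENNReal.ofReal c.h)⁻¹ * (2 * (ENNReal.ofReal c.h ^ 2 *
              (∫⁻ y in A, ‖G y‖ₑ ^ 2) + ∫⁻ y in A, ‖u y‖ₑ ^ 2))) := by
            gcongr
            rw [← ENNReal.mul_le_iff_le_inv hh0 ENNReal.ofReal_ne_top]
            exact c.lintegral_profile_le hu.measurable_u hu.measurable_G hT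
        _ ≤ _ := by
            rw [mul_assoc, mul_assoc, mul_assoc]
            gcongr
            rw [mul_add, add_comm]
            refine add_le_add ?_ ?_
            · exact le_mul_of_one_le_left' (by simp)
            · gcongr; simp
  simpa only [inter_self] using key

/-! ### Poincaré inequalities -/

/-- The Poincaré inequality, up to constants, for Sobolev functions of `A` on the subset `W`. -/
def PoincareOn (A W : Set Plane) : Prop :=
  ∃ C : ℝ≥0∞, C ≠ ⊤ ∧ ∀ u G, SobolevOn A u G →
    ∃ k : ℝ, ∫⁻ y in W, ‖u y - k‖ₑ ^ 2 ≤ C * ∫⁻ y in A, ‖G y‖ₑ ^ 2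

lemma PoincareOn.mono {A W W' : Set Plane} (h : PoincareOn A W') (hW : W ⊆ W') :
    PoincareOn A W := by
  obtain ⟨C, hC, h⟩ := h
  refine ⟨C, hC, fun u G hu => ?_⟩
  obtain ⟨k, hk⟩ := h u G hu
  exact ⟨k, (lintegral_mono_set hW).trans hk⟩

lemma lintegral_sub_sq_le {α : Type*} [MeasurableSpace α] {μ : Measure α} {u v w : α → ℝ}
    (hv : Measurable v) (hw : Measurable w) :
    ∫⁻ y, ‖u y - w y‖ₑ ^ 2 ∂μ ≤
      2 * ((∫⁻ y, ‖u y - v y‖ₑ ^ 2 ∂μ) + ∫⁻ y, ‖v y - w y‖ₑ ^ 2 ∂μ) := by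
  have := lintegral_add_sq_le (μ := μ) (v := fun y => u y - v y) (w := fun y => v y - w y) (hv.sub hw)
  simpa only [sub_add_sub_cancel] using this

lemma enorm_sub_sq_comm (x y : ℝ) : ‖x - y‖ₑ ^ 2 = ‖y - x‖ₑ ^ 2 := by
  rw [← enorm_neg, neg_sub]

/-- The frame with the axes exchanged. -/
noncomputable def swapFrame (e : Plane ≃ₗᵢ[ℝ] Plane) : Plane ≃ₗᵢ[ℝ] Plane :=
  e.trans (LinearIsometryEquiv.piLpCongrLeft 2 ℝ ℝ (Equiv.swap (0 : Fin 2) 1))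

lemma swapFrame_zero (e : Plane ≃ₗᵢ[ℝ] Plane) (y : Plane) : swapFrame e y 0 = e y 1 := by
  simp [swapFrame, LinearIsometryEquiv.piLpCongrLeft_apply]

lemma swapFrame_one (e : Plane ≃ₗᵢ[ℝ] Plane) (y : Plane) : swapFrame e y 1 = e y 0 := by
  simp [swapFrame, LinearIsometryEquiv.piLpCongrLeft_apply]

lemma patch_swapFrame (e : Plane ≃ₗᵢ[ℝ] Plane) (a b c l : ℝ) :
    patch (swapFrame e) (.const ℝ a) c (c + l) (b - a) = patch e (.const ℝ c) a b l := by
  ext y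
  simp only [mem_patch, swapFrame_zero, swapFrame_one, ContinuousMap.const_apply, mem_Ioo,
    add_sub_cancel]
  tauto

/-- Profiles along both axes show that u is close in L² to a function T of the first coordinate and
to a function S of the second. Then T and S are close to each other, and freezing the second
coordinate makes T close to a constant. -/
lemma poincareOn_rect {A : Set Plane} (hA : IsOpen A) {e : Plane ≃ₗᵢ[ℝ] Plane} {a b c l : ℝ}
    (hab : a < b) (hl : 0 < l) (hsub : patch e (.const ℝ c) a b l ⊆ A) :
    PoincareOn A (patch e (.const ℝ c) a b l) := by
  set R := patch e (.const ℝ c) a b l with hR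
  set M : ℝ≥0∞ := 2 * (ENNReal.ofReal l ^ 2 + ENNReal.ofReal (b - a) ^ 2) with hM
  have hMtop : M ≠ ⊤ := ENNReal.mul_ne_top (by simp) (by simp)
  refine ⟨2 * (ENNReal.ofReal l ^ 2 + M), ENNReal.mul_ne_top (by simp) (by simp [hMtop]),
    fun u G hu => ?_⟩
  have hsw := patch_swapFrame e a b c l
  obtain ⟨T, hT⟩ := hu.exists_isProfile hA hab hl hsub
  obtain ⟨S, hS⟩ := hu.exists_isProfile hA (e := swapFrame e) (f := .const ℝ a) (a := c) (b := c + l)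
    (h := b - a) (by linarith) (by linarith) (by rw [hsw]; exact hsub)
  have h1 := hT.lintegral_sq_le hu.measurable_G
  have h2 := hS.lintegral_sq_le hu.measurable_G
  rw [hsw] at h2
  simp only [swapFrame_zero] at h2
  rw [← hR] at h1 h2
  set q := ∫⁻ y in R, ‖G y‖ₑ ^ 2 with hq
  have hTm : Measurable fun y : Plane => T (e y 0) :=
    hT.measurable.measurable.comp (continuous_coord e 0).measurable
  have hSm : Measurable fun y : Plane => S (e y 1) :=
    hS.measurable.measurable.comp (continuous_coord e 1).measurable
  have h3 : ∫⁻ y in R, ‖T (e y 0) - S (e y 1)‖ₑ ^ 2 ≤ M * q := by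
    refine (lintegral_sub_sq_le (v := u) hu.measurable_u.measurable hSm).trans ?_
    simp only [enorm_sub_sq_comm (T _)]
    rw [hM, mul_assoc, add_mul]
    gcongr
  have hJ : Measurable fun s => ∫⁻ p in Ioo a b, ‖T p - S (c + s)‖ₑ ^ 2 := by
    have : Measurable fun z : ℝ × ℝ => ‖T z.2 - S (c + z.1)‖ₑ ^ 2 :=
      ((hT.measurable.measurable.comp measurable_snd).sub
        (hS.measurable.measurable.comp (by fun_prop))).enorm.pow_const 2
    exact this.lintegral_prod_right'
  have h4 : ∫⁻ s in Ioo 0 l, ∫⁻ p in Ioo a b, ‖T p - S (c + s)‖ₑ ^ 2 ≤ M * q := by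
    refine le_trans (le_of_eq ?_) h3
    rw [hR]
    unfold patch
    rw [setLIntegral_shear]
    simp only [shear_coord_zero, shear_coord_one, ContinuousMap.const_apply]
    rw [Measure.volume_eq_prod, ← Measure.prod_restrict, lintegral_prod_symm]
    refine Measurable.aemeasurable ?_
    exact ((hT.measurable.measurable.comp measurable_fst).sub
        (hS.measurable.measurable.comp (by fun_prop))).enorm.pow_const 2
  -- A height where the slice integral does not exceed its average; S at this height is the
  -- constant.
  obtain ⟨s, -, hs⟩ := exists_le_setLAverage (μ := (volume : Measure ℝ)) (s := Ioo 0 l)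
    (by simpa using hl) (by simp) hJ.aemeasurable
  have h5 : ∫⁻ y in R, ‖T (e y 0) - S (c + s)‖ₑ ^ 2 ≤ M * q := by
    rw [hR, lintegral_patch_coord (F := fun p => ‖T p - S (c + s)‖ₑ ^ 2)
      ((hT.measurable.measurable.sub_const _).enorm.pow_const 2)]
    rw [setLAverage_eq, Real.volume_Ioo, sub_zero] at hs
    calc _ ≤ ENNReal.ofReal l * (M * q / ENNReal.ofReal l) := by
          refine mul_le_mul' le_rfl (hs.trans ?_)
          exact ENNReal.div_le_div_right h4 _
      _ = M * q := ENNReal.mul_div_cancel (by simpa using hl) ENNReal.ofReal_ne_top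
  refine ⟨S (c + s), ?_⟩
  refine (lintegral_sub_sq_le (w := fun _ => S (c + s)) hTm measurable_const).trans ?_
  rw [mul_assoc, add_mul]
  have hqA : q ≤ ∫⁻ y in A, ‖G y‖ₑ ^ 2 := lintegral_mono_set hsub
  exact mul_le_mul' le_rfl (add_le_add (h1.trans (mul_le_mul' le_rfl hqA))
    (h5.trans (mul_le_mul' le_rfl hqA)))

/-- The rectangle and the whole patch lie over the same interval and share the profile. The constant
found on the rectangle is thus close to the profile, hence to u on the whole patch. -/
lemma BoundaryChart.poincareOn {A : Set Plane} (hA : IsOpen A) {x : Plane} (c : BoundaryChart A x) :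
    PoincareOn A (patch c.e c.f c.a c.b c.h) := by
  obtain ⟨C, hC, hP⟩ := poincareOn_rect hA c.a_lt_b c.l_pos (c.rect_subset.trans c.patch_subset)
  have hl0 : ENNReal.ofReal c.l ≠ 0 := by simpa using c.l_pos
  set H : ℝ≥0∞ := ENNReal.ofReal c.h with hH
  have hHt : H ≠ ⊤ := ENNReal.ofReal_ne_top
  set L : ℝ≥0∞ := ENNReal.ofReal c.l with hL
  set M : ℝ≥0∞ := H * (L⁻¹ * (2 * (H ^ 2 + C))) with hM
  have hMtop : M ≠ ⊤ := by
    refine ENNReal.mul_ne_top hHt (ENNReal.mul_ne_top (by simpa using hl0)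
      (ENNReal.mul_ne_top (by simp) ?_))
    simp [hC, hHt]
  refine ⟨2 * (H ^ 2 + M), ENNReal.mul_ne_top (by simp) (by simp [hHt, hMtop]), fun u G hu => ?_⟩
  obtain ⟨k, hk⟩ := hP u G hu
  obtain ⟨T, hT⟩ := hu.exists_isProfile hA c.a_lt_b c.h_pos c.patch_subset
  have h1 := (hT.lintegral_sq_le hu.measurable_G).trans
    (mul_le_mul' le_rfl (lintegral_mono_set c.patch_subset))
  set q := ∫⁻ y in A, ‖G y‖ₑ ^ 2 with hq
  have hTm : Measurable fun y : Plane => T (c.e y 0) :=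
    hT.measurable.measurable.comp (continuous_coord c.e 0).measurable
  have hFm : Measurable fun p => ‖T p - k‖ₑ ^ 2 :=
    (hT.measurable.measurable.sub_const _).enorm.pow_const 2
  have h2 : L * ∫⁻ p in Ioo c.a c.b, ‖T p - k‖ₑ ^ 2 ≤ 2 * (H ^ 2 + C) * q := by
    rw [← lintegral_patch_coord (e := c.e) (f := .const ℝ c.c) hFm]
    refine (lintegral_sub_sq_le (v := u) (w := fun _ => k) hu.measurable_u.measurable
      measurable_const).trans ?_
    simp only [enorm_sub_sq_comm (T _)]
    rw [mul_assoc, add_mul]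
    exact mul_le_mul' le_rfl (add_le_add ((lintegral_mono_set c.rect_subset).trans h1) hk)
  have h3 : ∫⁻ y in patch c.e c.f c.a c.b c.h, ‖T (c.e y 0) - k‖ₑ ^ 2 ≤ M * q := by
    rw [lintegral_patch_coord hFm, hM, mul_assoc, mul_assoc]
    refine mul_le_mul' le_rfl ?_
    rw [← ENNReal.mul_le_iff_le_inv hl0 ENNReal.ofReal_ne_top]
    exact h2
  refine ⟨k, (lintegral_sub_sq_le (w := fun _ => k) hTm measurable_const).trans ?_⟩
  rw [mul_assoc, add_mul]
  exact mul_le_mul' le_rfl (add_le_add h1 h3)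

/-- On the overlap, which has positive measure, u is close to both constants, so these differ little
and one of them serves for the union. -/
lemma PoincareOn.union {A W W' : Set Plane} (h : PoincareOn A W) (h' : PoincareOn A W')
    (ho : volume (W ∩ W') ≠ 0) (hfin : volume W' ≠ ⊤) :
    PoincareOn A (W ∪ W') := by
  obtain ⟨C, hC, h⟩ := h
  obtain ⟨C', hC', h'⟩ := h'
  set O := W ∩ W' with hO
  have hOfin : volume O ≠ ⊤ := ((measure_mono inter_subset_right).trans_lt hfin.lt_top).ne
  set M : ℝ≥0∞ := (volume O)⁻¹ * (2 * (C + C')) * volume W' with hM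
  have hMtop : M ≠ ⊤ := ENNReal.mul_ne_top (ENNReal.mul_ne_top (by simpa using ho)
    (ENNReal.mul_ne_top (by simp) (by simp [hC, hC']))) hfin
  refine ⟨C + 2 * (C' + M), by simp [hC, ENNReal.mul_ne_top, hC', hMtop], fun u G hu => ?_⟩
  obtain ⟨k, hk⟩ := h u G hu
  obtain ⟨k', hk'⟩ := h' u G hu
  set q := ∫⁻ y in A, ‖G y‖ₑ ^ 2 with hq
  have h1 : volume O * ‖k' - k‖ₑ ^ 2 ≤ 2 * (C + C') * q := by
    have e1 : ∫⁻ _y in O, ‖k' - k‖ₑ ^ 2 = volume O * ‖k' - k‖ₑ ^ 2 := by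
      rw [lintegral_const, Measure.restrict_apply_univ, mul_comm]
    rw [← e1]
    refine (lintegral_sub_sq_le (u := fun _ => k') (v := u) (w := fun _ => k)
      hu.measurable_u.measurable measurable_const).trans ?_
    simp only [enorm_sub_sq_comm k']
    rw [mul_assoc, add_mul, add_comm]
    exact mul_le_mul' le_rfl (add_le_add ((lintegral_mono_set inter_subset_left).trans hk)
      ((lintegral_mono_set inter_subset_right).trans hk'))
  have h2 : ‖k' - k‖ₑ ^ 2 * volume W' ≤ M * q := by
    rw [ENNReal.mul_le_iff_le_inv ho hOfin, ← mul_assoc] at h1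
    rw [hM, mul_right_comm]
    exact mul_le_mul' h1 le_rfl
  refine ⟨k, (lintegral_union_le _ _ _).trans ?_⟩
  rw [add_mul]
  refine add_le_add hk ?_
  refine (lintegral_sub_sq_le (v := fun _ => k') (w := fun _ => k) measurable_const
    measurable_const).trans ?_
  rw [mul_assoc, add_mul, lintegral_const, Measure.restrict_apply_univ]
  exact mul_le_mul' le_rfl (add_le_add hk' h2)

lemma exists_ball_poincareOn {A : Set Plane} (hA : IsOpen A) (hL : HasLipschitzBoundary A)
    {x : Plane} (hx : x ∈ closure A) : ∃ ρ > 0, PoincareOn A (Metric.ball x ρ ∩ A) := by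
  by_cases hxA : x ∈ A
  · obtain ⟨r, hr, hball⟩ := Metric.isOpen_iff.1 hA x hxA
    let e : Plane ≃ₗᵢ[ℝ] Plane := LinearIsometryEquiv.refl ℝ Plane
    have hsub : patch e (.const ℝ (e x 1 - r / 2)) (e x 0 - r / 2) (e x 0 + r / 2) r ⊆ A := by
      intro y hy
      obtain ⟨h0, h1, h2⟩ := mem_patch.1 hy
      simp only [ContinuousMap.const_apply] at h1 h2
      apply hball
      have ha : |e y 0 - e x 0| < r / 2 := by rw [abs_lt]; constructor <;> linarith [h0.1, h0.2]
      have hb : |e y 1 - e x 1| < r / 2 := by rw [abs_lt]; constructor <;> linarith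
      exact (dist_le_coord e x y).trans_lt (by linarith)
    refine ⟨r / 2, half_pos hr, (poincareOn_rect hA (by linarith) hr hsub).mono ?_⟩
    rintro y ⟨hy, -⟩
    have h0 := abs_lt.1 ((coord_le_dist e x y 0).trans_lt hy)
    have h1 := abs_lt.1 ((coord_le_dist e x y 1).trans_lt hy)
    refine mem_patch.2 ⟨⟨by linarith, by linarith⟩, ?_, ?_⟩
    · simp only [ContinuousMap.const_apply]; linarith
    · simp only [ContinuousMap.const_apply]; linarith
  · obtain ⟨c⟩ := hL.exists_chart hA (by rw [hA.frontier_eq]; exact ⟨hx, hxA⟩)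
    exact ⟨c.ρ, c.ρ_pos, (c.poincareOn hA).mono c.ball_inter_subset⟩

/-- The Poincaré inequality on bounded connected Lipschitz domains. -/
theorem poincareOn_self {A : Set Plane} (hA : IsOpen A) (hc : IsConnected A)
    (hb : Bornology.IsBounded A) (hL : HasLipschitzBoundary A) : PoincareOn A A := by
  classical
  choose! ρ hρ hP using fun x (hx : x ∈ closure A) => exists_ball_poincareOn hA hL hx
  obtain ⟨t, ht, hcov⟩ := hb.isCompact_closure.elim_nhds_subcover (fun x => Metric.ball x (ρ x))
    fun x hx => Metric.ball_mem_nhds x (hρ x hx)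
  let W : Plane → Set Plane := fun x => Metric.ball x (ρ x) ∩ A
  have hWo : ∀ x, IsOpen (W x) := fun x => Metric.isOpen_ball.inter hA
  have hWne : ∀ x ∈ t, (W x).Nonempty := fun x hx => by
    obtain ⟨z, hz, hzA⟩ := mem_closure_iff.1 (ht x hx) _ Metric.isOpen_ball
      (Metric.mem_ball_self (hρ x (ht x hx)))
    exact ⟨z, hz, hzA⟩
  have hfin : ∀ V ⊆ A, volume V ≠ ⊤ := fun V hV =>
    ((measure_mono hV).trans_lt hb.measure_lt_top).ne
  let P : Finset Plane → Prop := fun S => S.Nonempty ∧ PoincareOn A (⋃ x ∈ S, W x)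
  obtain ⟨x₁, hx₁⟩ := hc.nonempty
  have hx₁' := hcov (subset_closure hx₁)
  simp only [mem_iUnion, exists_prop] at hx₁'
  obtain ⟨x₀, hx₀, -⟩ := hx₁'
  -- A largest subfamily of the finite cover on whose union the inequality holds. If this union
  -- missed a point of A, connectedness would give a further set overlapping it, against maximality.
  obtain ⟨S, hS, hmax⟩ := Finset.exists_max_image (t.powerset.filter P) Finset.card
    ⟨{x₀}, by
      rw [Finset.mem_filter, Finset.mem_powerset]
      refine ⟨by simpa using hx₀, by simp, ?_⟩
      simpa using hP x₀ (ht x₀ hx₀)⟩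
  rw [Finset.mem_filter, Finset.mem_powerset] at hS
  obtain ⟨hSt, hSne, hSP⟩ := hS
  refine hSP.mono ?_
  by_contra hnot
  obtain ⟨z, hzA, hz⟩ := not_subset.1 hnot
  have hcovA : ∀ y ∈ A, ∃ x ∈ t, y ∈ W x := fun y hy => by
    have := hcov (subset_closure hy)
    simp only [mem_iUnion, exists_prop] at this
    obtain ⟨x, hx, hyx⟩ := this
    exact ⟨x, hx, hyx, hy⟩
  obtain ⟨y, hyA, hy1, hy2⟩ := hc.isPreconnected (⋃ x ∈ S, W x) (⋃ x ∈ t \ S, W x)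
    (isOpen_biUnion fun x _ => hWo x) (isOpen_biUnion fun x _ => hWo x)
    (fun y hy => by
      obtain ⟨x, hx, hyx⟩ := hcovA y hy
      by_cases hxS : x ∈ S
      · exact Or.inl (mem_biUnion hxS hyx)
      · exact Or.inr (mem_biUnion (Finset.mem_sdiff.2 ⟨hx, hxS⟩) hyx))
    (by
      obtain ⟨s, hs⟩ := hSne
      obtain ⟨w, hw⟩ := hWne s (hSt hs)
      exact ⟨w, hw.2, mem_biUnion hs hw⟩)
    (by
      obtain ⟨x, hx, hzx⟩ := hcovA z hzA
      refine ⟨z, hzA, mem_biUnion (Finset.mem_sdiff.2 ⟨hx, fun hxS => hz (mem_biUnion hxS hzx)⟩) hzx⟩)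
  simp only [mem_iUnion, exists_prop] at hy2
  obtain ⟨x, hx, hyx⟩ := hy2
  rw [Finset.mem_sdiff] at hx
  have hun : PoincareOn A ((⋃ x ∈ S, W x) ∪ W x) := by
    refine hSP.union (hP x (ht x hx.1)) ?_ (hfin _ inter_subset_right)
    exact (((isOpen_biUnion fun x _ => hWo x).inter (hWo x)).measure_pos volume ⟨y, hy1, hyx⟩).ne'
  have := hmax (insert x S) (by
    rw [Finset.mem_filter, Finset.mem_powerset]
    refine ⟨Finset.insert_subset hx.1 hSt, by simp, ?_⟩
    rw [Finset.set_biUnion_insert, union_comm]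
    exact hun)
  rw [Finset.card_insert_of_notMem hx.2] at this
  omega

lemma hasWeakGradient_const (A : Set Plane) (k : ℝ) : HasWeakGradient A (fun _ => k) (fun _ => 0) := by
  intro φ h1 h2 h3 e
  have hz : ∫ x in A, k * fderiv ℝ φ x e = ∫ x, k * fderiv ℝ φ x e := by
    refine setIntegral_eq_integral_of_forall_compl_eq_zero fun x hx => ?_
    rw [fderiv_of_notMem_tsupport (𝕜 := ℝ) (fun h' => hx (h3 h'))]; simp
  have h0 := integral_mul_fderiv_eq_neg_fderiv_mul_of_integrable (μ := (volume : Measure Plane))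
    (f := fun _ => k) (g := φ) (v := e) (𝕜 := ℝ) (by simp) ?_ ?_
    (fun x _ => differentiableAt_const k) (fun x _ => h1.differentiable (by simp) x)
  · rw [hz, h0]; simp
  · exact ((test_fderiv h1 h2 e).1.integrable_of_hasCompactSupport (test_fderiv h1 h2 e).2).const_mul k
  · exact (h1.continuous.integrable_of_hasCompactSupport h2).const_mul k

lemma SobolevOn.sub_const {A : Set Plane} (hb : Bornology.IsBounded A) {u : Plane → ℝ}
    {G : Plane → Plane} (hu : SobolevOn A u G) (k : ℝ) : SobolevOn A (fun y => u y - k) G := by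
  have hfin : IsFiniteMeasure (volume.restrict A) := ⟨by simpa using hb.measure_lt_top⟩
  refine ⟨hu.measurable_u.sub stronglyMeasurable_const, hu.measurable_G,
    hu.memLp_u.sub (memLp_const k), hu.memLp_G, fun φ h1 h2 h3 e => ?_⟩
  have e1 := hu.weak φ h1 h2 h3 e
  have e2 := hasWeakGradient_const A k φ h1 h2 h3 e
  obtain ⟨c1, c2⟩ := test_fderiv h1 h2 e
  simp only [sub_mul]
  rw [integral_sub (integrable_mul_of_test hu.memLp_u c1 c2)
    (integrable_mul_of_test (memLp_const k) c1 c2), e1, e2]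
  simp

lemma HasTrace.sub_const {A : Set Plane} (hA : IsOpen A) {u : Plane → ℝ}
    (hu : MemLp u 2 (volume.restrict A)) {x : Plane} (hx : x ∈ frontier A) {t : ℝ}
    (h : HasTrace A u x t) (k : ℝ) : HasTrace A (fun y => u y - k) x (t - k) := by
  refine (Tendsto.sub_const h k).congr' ?_
  filter_upwards [self_mem_nhdsWithin] with r hr
  have hfin : volume (Metric.ball x r ∩ A) ≠ ⊤ :=
    ((measure_mono inter_subset_left).trans_lt Metric.isBounded_ball.measure_lt_top).ne
  have hpos : volume (Metric.ball x r ∩ A) ≠ 0 := by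
    obtain ⟨z, hz, hzA⟩ := mem_closure_iff.1 (frontier_subset_closure hx) _ Metric.isOpen_ball
      (Metric.mem_ball_self hr)
    exact ((Metric.isOpen_ball.inter hA).measure_pos volume ⟨z, hz, hzA⟩).ne'
  have hBu : IntegrableOn u (Metric.ball x r ∩ A) := by
    have : IsFiniteMeasure (volume.restrict (Metric.ball x r ∩ A)) := ⟨by simpa using hfin.lt_top⟩
    exact (hu.mono_measure (Measure.restrict_mono inter_subset_right le_rfl)).integrable (by norm_num)
  have h2 := setAverage_const hpos hfin k
  rw [setAverage_eq] at h2
  rw [setAverage_eq, setAverage_eq, integral_sub hBu (integrableOn_const hfin), smul_sub, h2]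

/-- The Poincaré inequality for functions with zero trace on a part of the boundary. -/
theorem exists_poincare_of_hasTrace_zero {A : Set Plane} (hA : IsOpen A) (hc : IsConnected A)
    (hb : Bornology.IsBounded A) (hL : HasLipschitzBoundary A) {E : Set Plane} (hE : MeasurableSet E)
    (hEA : E ⊆ frontier A) (hpos : μH[1] E ≠ 0) :
    ∃ C : ℝ≥0∞, C ≠ ⊤ ∧ ∀ u G, SobolevOn A u G →
      (∀ᵐ y ∂(μH[1] : Measure Plane).restrict E, HasTrace A u y 0) →
      ∫⁻ y in A, ‖u y‖ₑ ^ 2 ≤ C * ∫⁻ y in A, ‖G y‖ₑ ^ 2 := by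
  obtain ⟨C, hC, hP⟩ := poincareOn_self hA hc hb hL
  obtain ⟨C', hC', hT⟩ := exists_trace_bound hA hb hL
  have hvol : volume A ≠ ⊤ := hb.measure_lt_top.ne
  set M : ℝ≥0∞ := C' * (C + 1) / μH[1] E * volume A with hM
  have hMtop : M ≠ ⊤ := by
    refine ENNReal.mul_ne_top (ENNReal.div_ne_top (ENNReal.mul_ne_top hC' ?_) hpos) hvol
    simp [hC]
  refine ⟨2 * (C + M), ENNReal.mul_ne_top (by simp) (by simp [hC, hMtop]), fun u G hu htr => ?_⟩
  obtain ⟨k, hk⟩ := hP u G hu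
  have hbd := (hT _ _ (hu.sub_const hb k)).2
  set q := ∫⁻ y in A, ‖G y‖ₑ ^ 2 with hq
  have hqtop : q ≠ ⊤ := by
    have := (hu.memLp_G.integrable_norm_pow (by norm_num)).hasFiniteIntegral
    simp only [HasFiniteIntegral, enorm_pow, enorm_norm] at this
    exact this.ne
  -- On E the trace of u − k is −k, so the trace inequality bounds k by the L² norms of u − k and of
  -- the gradient.
  have h1 : ‖k‖ₑ ^ 2 * μH[1] E ≤ C' * (C + 1) * q := by
    rw [← setLIntegral_const]
    calc ∫⁻ _y in E, ‖k‖ₑ ^ 2 ∂(μH[1] : Measure Plane)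
        = ∫⁻ y in E, ‖traceFn A (fun z => u z - k) y‖ₑ ^ 2 ∂(μH[1] : Measure Plane) := by
          refine lintegral_congr_ae ?_
          filter_upwards [htr, ae_restrict_mem hE] with y hy hyE
          rw [(hy.sub_const hA hu.memLp_u (hEA hyE) k).traceFn_eq, zero_sub, enorm_neg]
      _ ≤ _ := lintegral_mono_set hEA
      _ ≤ _ := hbd
      _ ≤ _ := by
          rw [mul_assoc, add_mul, one_mul]
          gcongr
  have h2 : ‖k‖ₑ ^ 2 * volume A ≤ M * q := by
    have h3 : ‖k‖ₑ ^ 2 ≤ C' * (C + 1) * q / μH[1] E := by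
      rw [ENNReal.le_div_iff_mul_le (Or.inl hpos) (Or.inr (ENNReal.mul_ne_top
        (ENNReal.mul_ne_top hC' (by simp [hC])) hqtop))]
      exact h1
    rw [hM, mul_right_comm, ENNReal.mul_div_right_comm.symm]
    exact mul_le_mul' h3 le_rfl
  have h4 := lintegral_sub_sq_le (μ := volume.restrict A) (u := u) (v := fun _ => k) (w := fun _ => 0)
    measurable_const measurable_const
  simp only [sub_zero, setLIntegral_const] at h4
  refine h4.trans ?_
  rw [mul_assoc, add_mul]
  exact mul_le_mul' le_rfl (add_le_add hk h2)

/-! ### The trace operator and completeness of H¹ -/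

lemma lintegral_enorm_sq {α E : Type*} [MeasurableSpace α] {μ : Measure α} [NormedAddCommGroup E]
    (f : Lp E 2 μ) : ∫⁻ x, ‖f x‖ₑ ^ 2 ∂μ = ‖f‖ₑ ^ 2 := by
  rw [Lp.enorm_def, eLpNorm_eq_lintegral_rpow_enorm_toReal (by norm_num) (by norm_num),
    ← ENNReal.rpow_natCast, ← ENNReal.rpow_mul]
  norm_num

/-- On `S` the Sobolev functions of `U` have traces, controlled by the Sobolev norm. -/
def HasTraceBound (U S : Set Plane) : Prop :=
  ∃ C : ℝ≥0∞, C ≠ ⊤ ∧ ∀ u G, SobolevOn U u G →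
    (∀ᵐ y ∂(μH[1] : Measure Plane).restrict S, ∃ t, HasTrace U u y t) ∧
    ∫⁻ y in S, ‖traceFn U u y‖ₑ ^ 2 ∂(μH[1] : Measure Plane) ≤
      C * ((∫⁻ y in U, ‖u y‖ₑ ^ 2) + ∫⁻ y in U, ‖G y‖ₑ ^ 2)

lemma HasTraceBound.mono {U S S' : Set Plane} (h : HasTraceBound U S) (hS : S' ⊆ S) :
    HasTraceBound U S' := by
  obtain ⟨C, hC, h⟩ := h
  exact ⟨C, hC, fun u G hu => ⟨ae_mono (Measure.restrict_mono hS le_rfl) (h u G hu).1,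
    (lintegral_mono_set hS).trans (h u G hu).2⟩⟩

/-- The trace is an almost everywhere limit of averages along the radii 1/(n+1), each of them a
measurable function of the centre. -/
lemma aestronglyMeasurable_traceFn {U : Set Plane} (hU : MeasurableSet U) {u : Plane → ℝ}
    (hu : StronglyMeasurable u) {ν : Measure Plane} (h : ∀ᵐ y ∂ν, ∃ t, HasTrace U u y t) :
    AEStronglyMeasurable (traceFn U u) ν := by
  let r : ℕ → ℝ := fun n => 1 / ((n : ℝ) + 1)
  have hr : Tendsto r atTop (𝓝[>] 0) := by
    refine tendsto_nhdsWithin_iff.2 ⟨tendsto_one_div_add_atTop_nhds_zero_nat,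
      Eventually.of_forall fun n => ?_⟩
    change 0 < 1 / ((n : ℝ) + 1)
    positivity
  refine aestronglyMeasurable_of_tendsto_ae atTop (f := fun n y => ⨍ z in Metric.ball y (r n) ∩ U, u z)
    (fun n => ?_) ?_
  · have hS : MeasurableSet {q : Plane × Plane | dist q.2 q.1 < r n ∧ q.2 ∈ U} :=
      (measurableSet_lt (f := fun q : Plane × Plane => dist q.2 q.1) (by fun_prop)
        measurable_const).inter (measurable_snd hU)
    have key : ∀ w : Plane → ℝ, StronglyMeasurable w →
        StronglyMeasurable fun y => ∫ z in Metric.ball y (r n) ∩ U, w z := by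
      intro w hw
      have e1 : (fun y => ∫ z in Metric.ball y (r n) ∩ U, w z) = fun y => ∫ z,
          ({q : Plane × Plane | dist q.2 q.1 < r n ∧ q.2 ∈ U}.indicator fun q => w q.2) (y, z) := by
        ext y
        rw [← integral_indicator (Metric.isOpen_ball.measurableSet.inter hU)]
        rfl
      rw [e1]
      exact StronglyMeasurable.integral_prod_right'
        (f := {q : Plane × Plane | dist q.2 q.1 < r n ∧ q.2 ∈ U}.indicator fun q => w q.2)
        ((hw.comp_measurable measurable_snd).indicator hS)
    have h1 := key (fun _ => 1) stronglyMeasurable_const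
    simp only [integral_const, smul_eq_mul, mul_one, MeasurableSet.univ, measureReal_restrict_apply,
      univ_inter] at h1
    simp only [setAverage_eq, smul_eq_mul]
    exact ((h1.measurable.inv.mul (key u hu).measurable)).aestronglyMeasurable
  · filter_upwards [h] with y hy
    obtain ⟨t, ht⟩ := hy
    rw [ht.traceFn_eq]
    exact ht.comp hr

lemma H1.enorm_sq {U : Set Plane} (u : H1 U) :
    (∫⁻ y in U, ‖u.1.fst y‖ₑ ^ 2) + ∫⁻ y in U, ‖u.1.snd y‖ₑ ^ 2 = ‖u‖ₑ ^ 2 := by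
  rw [lintegral_enorm_sq, lintegral_enorm_sq]
  have h : ‖u.1‖ ^ 2 = ‖u.1.fst‖ ^ 2 + ‖u.1.snd‖ ^ 2 := WithLp.prod_norm_sq_eq_of_L2 _
  simp only [← ofReal_norm]
  rw [← ENNReal.ofReal_pow (norm_nonneg _), ← ENNReal.ofReal_pow (norm_nonneg _),
    ← ENNReal.ofReal_pow (norm_nonneg _), ← ENNReal.ofReal_add (by positivity) (by positivity), ← h]
  rfl

/-- The trace operator. -/
theorem HasTraceBound.exists_trace {U S : Set Plane} (hU : MeasurableSet U) (h : HasTraceBound U S) :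
    ∃ τ : H1 U →L[ℝ] Lp ℝ 2 ((μH[1] : Measure Plane).restrict S),
      ∀ u : H1 U, τ u =ᵐ[(μH[1] : Measure Plane).restrict S] traceFn U u.1.fst := by
  obtain ⟨C, hC, hT⟩ := h
  set ν := (μH[1] : Measure Plane).restrict S
  have hex : ∀ u : H1 U, ∀ᵐ y ∂ν, ∃ t, HasTrace U u.1.fst y t := fun u => (hT _ _ (H1.sobolevOn u)).1
  have hb : ∀ u : H1 U, eLpNorm (traceFn U u.1.fst) 2 ν ^ 2 ≤ C * ‖u‖ₑ ^ 2 := fun u => by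
    have := (hT _ _ (H1.sobolevOn u)).2
    rw [H1.enorm_sq] at this
    refine le_trans (le_of_eq ?_) this
    rw [eLpNorm_eq_lintegral_rpow_enorm_toReal (by norm_num) (by norm_num),
      ← ENNReal.rpow_natCast, ← ENNReal.rpow_mul]
    norm_num
  have hL : ∀ u : H1 U, MemLp (traceFn U u.1.fst) 2 ν := fun u => by
    refine ⟨aestronglyMeasurable_traceFn hU (Lp.stronglyMeasurable _) (hex u), ?_⟩
    by_contra hn
    have h1 := hb u
    rw [not_lt, top_le_iff] at hn
    rw [hn] at h1
    simp only [ne_eq, OfNat.ofNat_ne_zero, not_false_eq_true, ENNReal.top_pow, top_le_iff] at h1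
    exact ENNReal.mul_ne_top hC (by simp) h1
  -- `limUnder` by itself is not linear; linearity holds because the limits exist at almost every
  -- point.
  let τ₀ : H1 U →ₗ[ℝ] Lp ℝ 2 ν :=
    { toFun := fun u => (hL u).toLp
      map_add' := fun u w => by
        refine Lp.ext ?_
        filter_upwards [(hL (u + w)).coeFn_toLp, (hL u).coeFn_toLp, (hL w).coeFn_toLp,
          Lp.coeFn_add (hL u).toLp (hL w).toLp, hex u, hex w] with y h1 h2 h3 h4 h5 h6
        obtain ⟨s, hs⟩ := h5
        obtain ⟨t, ht⟩ := h6
        rw [h1, h4, Pi.add_apply, h2, h3, hs.traceFn_eq, ht.traceFn_eq]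
        exact (HasTrace.add _ _ hs ht).traceFn_eq
      map_smul' := fun a u => by
        refine Lp.ext ?_
        filter_upwards [(hL (a • u)).coeFn_toLp, (hL u).coeFn_toLp,
          Lp.coeFn_smul a (hL u).toLp, hex u] with y h1 h2 h4 h5
        obtain ⟨s, hs⟩ := h5
        rw [h1, RingHom.id_apply, h4, Pi.smul_apply, h2, hs.traceFn_eq, smul_eq_mul]
        exact (HasTrace.smul a _ hs).traceFn_eq }
  refine ⟨τ₀.mkContinuous (Real.sqrt C.toReal) fun u => ?_, fun u => (hL u).coeFn_toLp⟩
  have h1 : ‖τ₀ u‖ ^ 2 ≤ C.toReal * ‖u‖ ^ 2 := by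
    have h2 : ‖τ₀ u‖ₑ ^ 2 ≤ C * ‖u‖ₑ ^ 2 := by
      have hτ : τ₀ u =ᵐ[ν] traceFn U u.1.fst := (hL u).coeFn_toLp
      rw [Lp.enorm_def, eLpNorm_congr_ae hτ]
      exact hb u
    have h3 := ENNReal.toReal_mono (ENNReal.mul_ne_top hC (by simp)) h2
    simpa [ENNReal.toReal_mul, ENNReal.toReal_pow] using h3
  rw [← Real.sqrt_sq (norm_nonneg (τ₀ u)), ← Real.sqrt_sq (norm_nonneg u), ← Real.sqrt_mul
    ENNReal.toReal_nonneg]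
  exact Real.sqrt_le_sqrt h1

lemma tendsto_integral_inner {α E : Type*} [MeasurableSpace α] {μ : Measure α} [NormedAddCommGroup E]
    [InnerProductSpace ℝ E] {h : α → E} (hh : MemLp h 2 μ) :
    Continuous fun f : Lp E 2 μ => ∫ x, inner ℝ (h x) (f x) ∂μ := by
  have : (fun f : Lp E 2 μ => ∫ x, inner ℝ (h x) (f x) ∂μ) = fun f => inner ℝ (hh.toLp h) f := by
    ext f
    rw [L2.inner_def]
    refine integral_congr_ae ?_
    filter_upwards [hh.coeFn_toLp] with x hx
    rw [hx]
  rw [this]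
  fun_prop

/-- For a fixed test function and direction, both sides of the weak identity are continuous for L²
convergence. -/
lemma isClosed_H1 (U : Set Plane) : IsClosed (H1 U : Set (GradPair U)) := by
  have : (H1 U : Set (GradPair U)) = ⋂ (φ : Plane → ℝ) (_ : ContDiff ℝ ∞ φ) (_ : HasCompactSupport φ)
      (_ : tsupport φ ⊆ U) (e : Plane), {p : GradPair U | ∫ x in U, p.fst x * fderiv ℝ φ x e
        = -∫ x in U, inner ℝ (p.snd x) e * φ x} := by
    ext p
    simp only [mem_iInter]
    exact Iff.rfl
  rw [this]
  refine isClosed_iInter fun φ => isClosed_iInter fun h1 => isClosed_iInter fun h2 =>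
    isClosed_iInter fun _ => isClosed_iInter fun e => isClosed_eq ?_ ?_
  · obtain ⟨c1, c2⟩ := test_fderiv h1 h2 e
    have h3 : MemLp (fun x => fderiv ℝ φ x e) 2 (volume.restrict U) :=
      c1.memLp_of_hasCompactSupport c2
    refine ((tendsto_integral_inner h3).comp (WithLp.continuous_fst 2 _ _)).congr fun p => ?_
    simp [Function.comp]
  · have h3 : MemLp (fun x => φ x • e) 2 (volume.restrict U) := by
      refine Continuous.memLp_of_hasCompactSupport ?_ ?_
      · exact h1.continuous.smul continuous_const
      · exact h2.smul_right
    refine ((tendsto_integral_inner h3).comp (WithLp.continuous_snd 2 _ _)).neg.congr fun p => ?_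
    simp only [Function.comp, Pi.neg_apply]
    congr 1
    refine integral_congr_ae (Eventually.of_forall fun x => ?_)
    simp only [real_inner_smul_left]
    rw [real_inner_comm, mul_comm]

instance (U : Set Plane) : CompleteSpace (H1 U) := (isClosed_H1 U).completeSpace_coe

lemma HasTraceBound.union {U S S' : Set Plane} (h : HasTraceBound U S) (h' : HasTraceBound U S') :
    HasTraceBound U (S ∪ S') := by
  obtain ⟨C, hC, h⟩ := h
  obtain ⟨C', hC', h'⟩ := h'
  refine ⟨C + C', by simp [hC, hC'], fun u G hu => ⟨(ae_restrict_union_iff _ _ _).2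
    ⟨(h u G hu).1, (h' u G hu).1⟩, (lintegral_union_le _ _ _).trans ?_⟩⟩
  rw [add_mul]
  exact add_le_add (h u G hu).2 (h' u G hu).2

lemma hasTraceBound_of_null {U S : Set Plane} (hS : μH[1] S = 0) : HasTraceBound U S := by
  have : (μH[1] : Measure Plane).restrict S = 0 := Measure.restrict_eq_zero.2 hS
  refine ⟨0, by simp, fun u G _ => ?_⟩
  rw [this]
  simp

/-- The trace of a function on `U` at a point near which `U` coincides with `A`. -/
lemma hasTrace_congr {U A : Set Plane} (hAU : A ⊆ U) {x : Plane} {ρ : ℝ} (hρ : 0 < ρ)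
    (h : Metric.ball x ρ ∩ U ⊆ A) {u : Plane → ℝ} {t : ℝ} : HasTrace U u x t ↔ HasTrace A u x t := by
  refine tendsto_congr' ?_
  filter_upwards [Ioo_mem_nhdsGT hρ] with r hr
  have : Metric.ball x r ∩ U = Metric.ball x r ∩ A :=
    Subset.antisymm (fun z hz => ⟨hz.1, h ⟨Metric.ball_subset_ball hr.2.le hz.1, hz.2⟩⟩)
      (inter_subset_inter_right _ hAU)
  rw [this]

/-- Traces are local, and integrals over A do not exceed those over U. -/
lemma HasTraceBound.of_subset {U A S S' : Set Plane} (hU : MeasurableSet U) (hAU : A ⊆ U)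
    (h : HasTraceBound A S) (hS : S' ⊆ S) (hS'm : MeasurableSet S')
    (hloc : ∀ x ∈ S', ∃ ρ > 0, Metric.ball x ρ ∩ U ⊆ A) : HasTraceBound U S' := by
  obtain ⟨C, hC, h⟩ := h.mono hS
  refine ⟨C, hC, fun u G hu => ?_⟩
  obtain ⟨h1, h2⟩ := h u G (hu.mono hU hAU)
  have h3 : ∀ᵐ y ∂(μH[1] : Measure Plane).restrict S', ∃ t, HasTrace U u y t ∧ HasTrace A u y t := by
    filter_upwards [h1, ae_restrict_mem hS'm] with y hy hyS
    obtain ⟨ρ, hρ, hsub⟩ := hloc y hyS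
    obtain ⟨t, ht⟩ := hy
    exact ⟨t, (hasTrace_congr hAU hρ hsub).2 ht, ht⟩
  refine ⟨h3.mono fun y hy => hy.imp fun _ h' => h'.1, ?_⟩
  calc ∫⁻ y in S', ‖traceFn U u y‖ₑ ^ 2 ∂(μH[1] : Measure Plane)
      = ∫⁻ y in S', ‖traceFn A u y‖ₑ ^ 2 ∂(μH[1] : Measure Plane) := by
        refine lintegral_congr_ae ?_
        filter_upwards [h3] with y hy
        obtain ⟨t, ht, ht'⟩ := hy
        rw [ht.traceFn_eq, ht'.traceFn_eq]
    _ ≤ _ := h2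
    _ ≤ _ := by gcongr

/-! ### The cracked domain: traces, Poincaré inequality, completeness of V -/

namespace CrackGeometry

variable (G : CrackGeometry)

lemma Ωplus_subset : G.Ωplus ⊆ G.Ω := fun x hx =>
  (G.diff_eq_sides.symm ▸ Or.inl hx : x ∈ G.Ω \ G.γ '' Icc 0 G.σmax).1

lemma Ωminus_subset : G.Ωminus ⊆ G.Ω := fun x hx =>
  (G.diff_eq_sides.symm ▸ Or.inr hx : x ∈ G.Ω \ G.γ '' Icc 0 G.σmax).1

lemma crack_subset_crack_max : G.crack G.σ₀ ⊆ G.crack G.σmax :=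
  image_mono (Icc_subset_Icc_right G.σ₀_le_σmax)

lemma sides_subset_cracked : G.Ωplus ∪ G.Ωminus ⊆ G.cracked := by
  rw [← G.diff_eq_sides]
  exact sdiff_subset_sdiff_right G.crack_subset_crack_max

lemma volume_crack_max : volume (G.crack G.σmax) = 0 :=
  volume_curve_eq_zero (G.contDiffOn_γ.differentiableOn (by norm_num))

lemma lintegral_cracked (F : Plane → ℝ≥0∞) :
    ∫⁻ x in G.cracked, F x = (∫⁻ x in G.Ωplus, F x) + ∫⁻ x in G.Ωminus, F x := by
  rw [← lintegral_union G.isOpen_Ωminus.measurableSet G.disjoint_sides]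
  refine setLIntegral_congr ?_
  refine Filter.EventuallyLE.antisymm ?_ (Eventually.of_forall G.sides_subset_cracked)
  have hnull : ∀ᵐ x : Plane, x ∉ G.crack G.σmax := by
    rw [ae_iff]; simp only [not_not]; exact G.volume_crack_max
  filter_upwards [hnull] with x hx hxc
  have : x ∈ G.Ω \ G.γ '' Icc 0 G.σmax := ⟨hxc.1, hx⟩
  rw [G.diff_eq_sides] at this
  exact this

lemma frontier_inter_crack_subset : frontier G.Ω ∩ G.crack G.σmax ⊆ {G.γ 0, G.γ G.σmax} := by
  rintro x ⟨hx, s, hs, rfl⟩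
  rw [G.isOpen_Ω.frontier_eq] at hx
  rcases hs.1.eq_or_lt with h0 | h0
  · simp [← h0]
  rcases hs.2.eq_or_lt with h1 | h1
  · simp [h1]
  exact absurd (G.γ_mem s ⟨h0, h1⟩) hx.2

lemma hausdorffMeasure_frontier_inter_crack : μH[1] (frontier G.Ω ∩ G.crack G.σmax) = 0 := by
  have : NullSingletonClass (μH[1] : Measure Plane) :=
    Measure.nullSingletonClass_hausdorff _ one_pos
  exact measure_mono_null G.frontier_inter_crack_subset ((toFinite _).measure_zero _)

lemma dirichlet_inter_crack {x : Plane} (hx : x ∈ G.dirichlet) : x ∉ G.crack G.σmax := by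
  intro hxc
  rcases G.frontier_inter_crack_subset ⟨G.dirichlet_subset hx, hxc⟩ with h | h
  · exact G.γ_start.2 (h ▸ hx)
  · rw [mem_singleton_iff] at h
    exact G.γ_end.2 (h ▸ hx)

lemma exists_ball_inter_cracked_subset {A B : Set Plane} (hA : IsOpen A) (hB : IsOpen B)
    (hd : Disjoint A B) (hAB : G.Ω \ G.crack G.σmax = A ∪ B) {x : Plane} (hx : x ∈ frontier G.Ω)
    (hxc : x ∉ G.crack G.σmax) (hxA : x ∈ closure A) :
    ∃ ρ > 0, Metric.ball x ρ ∩ G.cracked ⊆ A := by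
  obtain ⟨ρ, hρ, h⟩ := ball_inter_subset_side G.isOpen_Ω G.lipschitz_Ω (G.isClosed_crack le_rfl) hAB
    hA hB hd hx hxc hxA
  exact ⟨ρ, hρ, (inter_subset_inter_right _ sdiff_subset).trans h⟩

lemma mem_frontier_of_mem_closure {A : Set Plane} (hA : IsOpen A) (hAΩ : A ⊆ G.Ω) {x : Plane}
    (hx : x ∈ frontier G.Ω) (hxA : x ∈ closure A) : x ∈ frontier A := by
  rw [hA.frontier_eq]
  rw [G.isOpen_Ω.frontier_eq] at hx
  exact ⟨hxA, fun h => hx.2 (hAΩ h)⟩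

lemma hasTraceBound_side {A B : Set Plane} (hA : IsOpen A) (hB : IsOpen B)
    (hd : Disjoint A B) (hAB : G.Ω \ G.crack G.σmax = A ∪ B) (hL : HasLipschitzBoundary A)
    (hAΩ : A ⊆ G.Ω) (hAc : A ⊆ G.cracked) :
    HasTraceBound G.cracked ((frontier G.Ω \ G.crack G.σmax) ∩ closure A) := by
  refine HasTraceBound.of_subset G.isOpen_cracked.measurableSet hAc
    (exists_trace_bound hA (G.isBounded_Ω.subset hAΩ) hL)
    (fun x hx => G.mem_frontier_of_mem_closure hA hAΩ hx.1.1 hx.2) ?_ fun x hx => ?_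
  · exact (isClosed_frontier.measurableSet.diff (G.isClosed_crack le_rfl).measurableSet).inter
      isClosed_closure.measurableSet
  · exact G.exists_ball_inter_cracked_subset hA hB hd hAB hx.1.1 hx.1.2 hx.2

/-- The cracked domain need not be Lipschitz along the crack, so the bound is taken from the two
sides. A frontier point of Ω off the crack path is in the closure of a side, and near it the cracked
domain coincides with that side. The path meets the frontier in its end points only, which are ℋ¹
null. -/
lemma hasTraceBound_cracked : HasTraceBound G.cracked (frontier G.Ω) := by
  have hp := G.hasTraceBound_side G.isOpen_Ωplus G.isOpen_Ωminus G.disjoint_sides G.diff_eq_sides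
    G.lipschitz_Ωplus G.Ωplus_subset (subset_union_left.trans G.sides_subset_cracked)
  have hm := G.hasTraceBound_side G.isOpen_Ωminus G.isOpen_Ωplus G.disjoint_sides.symm
    (by rw [union_comm]; exact G.diff_eq_sides) G.lipschitz_Ωminus G.Ωminus_subset
    (subset_union_right.trans G.sides_subset_cracked)
  refine ((hp.union hm).union (hasTraceBound_of_null G.hausdorffMeasure_frontier_inter_crack)).mono ?_
  intro x hx
  by_cases hxc : x ∈ G.crack G.σmax
  · exact Or.inr ⟨hx, hxc⟩
  left
  have h1 : x ∈ closure (G.Ωplus ∪ G.Ωminus) := by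
    rw [← G.diff_eq_sides]
    refine mem_closure_iff.2 fun o ho hxo => ?_
    obtain ⟨z, hz, hzΩ⟩ := mem_closure_iff.1 (frontier_subset_closure hx) _
      (ho.inter (G.isClosed_crack le_rfl).isOpen_compl) ⟨hxo, hxc⟩
    exact ⟨z, hz.1, hzΩ, hz.2⟩
  rw [closure_union] at h1
  rcases h1 with h1 | h1
  · exact Or.inl ⟨⟨hx, hxc⟩, h1⟩
  · exact Or.inr ⟨⟨hx, hxc⟩, h1⟩

lemma hasTraceBound_Ω : HasTraceBound G.Ω (frontier G.Ω) :=
  exists_trace_bound G.isOpen_Ω G.isBounded_Ω G.lipschitz_Ω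

/-- Dirichlet points are off the crack path, so the zero trace relative to the cracked domain is a
zero trace relative to the side. -/
lemma poincare_side {A B : Set Plane} (hA : IsOpen A) (hB : IsOpen B) (hAcon : IsConnected A)
    (hd : Disjoint A B) (hAB : G.Ω \ G.crack G.σmax = A ∪ B) (hL : HasLipschitzBoundary A)
    (hAΩ : A ⊆ G.Ω) (hAc : A ⊆ G.cracked) (hpos : 0 < μH[1] (G.dirichlet ∩ frontier A)) :
    ∃ C : ℝ≥0∞, C ≠ ⊤ ∧ ∀ v : G.V,
      ∫⁻ y in A, ‖v.1.1.fst y‖ₑ ^ 2 ≤ C * ∫⁻ y in A, ‖G.grad v y‖ₑ ^ 2 := by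
  have hEm : MeasurableSet (G.dirichlet ∩ frontier A) :=
    G.isClosed_dirichlet.measurableSet.inter isClosed_frontier.measurableSet
  obtain ⟨C, hC, h⟩ := exists_poincare_of_hasTrace_zero hA hAcon (G.isBounded_Ω.subset hAΩ) hL hEm
    inter_subset_right hpos.ne'
  refine ⟨C, hC, fun v => h _ _ ((H1.sobolevOn v.1).mono G.isOpen_cracked.measurableSet hAc) ?_⟩
  have htr : ∀ᵐ x ∂(μH[1] : Measure Plane).restrict G.dirichlet,
    HasTrace G.cracked v.1.1.fst x 0 := v.2
  filter_upwards [ae_mono (Measure.restrict_mono inter_subset_left le_rfl) htr,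
    ae_restrict_mem hEm] with x hx hxE
  obtain ⟨ρ, hρ, hsub⟩ := G.exists_ball_inter_cracked_subset hA hB hd hAB (G.dirichlet_subset hxE.1)
    (G.dirichlet_inter_crack hxE.1) (frontier_subset_closure hxE.2)
  exact (hasTrace_congr hAc hρ hsub).1 hx

/-- The Poincaré inequality in `V`. -/
lemma exists_poincare : ∃ C : ℝ≥0∞, C ≠ ⊤ ∧ ∀ v : G.V, ‖v.1.1.fst‖ₑ ^ 2 ≤ C * ‖G.grad v‖ₑ ^ 2 := by
  obtain ⟨C, hC, h⟩ := G.poincare_side G.isOpen_Ωplus G.isOpen_Ωminus G.isConnected_Ωplus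
    G.disjoint_sides G.diff_eq_sides G.lipschitz_Ωplus G.Ωplus_subset
    (subset_union_left.trans G.sides_subset_cracked) G.dirichlet_plus_pos
  obtain ⟨C', hC', h'⟩ := G.poincare_side G.isOpen_Ωminus G.isOpen_Ωplus G.isConnected_Ωminus
    G.disjoint_sides.symm (by rw [union_comm]; exact G.diff_eq_sides) G.lipschitz_Ωminus
    G.Ωminus_subset (subset_union_right.trans G.sides_subset_cracked) G.dirichlet_minus_pos
  refine ⟨C + C', by simp [hC, hC'], fun v => ?_⟩
  rw [← lintegral_enorm_sq, ← lintegral_enorm_sq, lintegral_cracked, lintegral_cracked, mul_add]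
  refine add_le_add ((h v).trans ?_) ((h' v).trans ?_)
  · gcongr; exact le_self_add
  · gcongr; exact le_add_self

/-- The identity of `V`, seen as a map into the Sobolev space. -/
noncomputable def toH1 : G.V →ₗ[ℝ] H1 G.cracked := G.admissible.subtype

lemma exists_toH1_bound : ∃ C : ℝ, ∀ v : G.V, ‖G.toH1 v‖ ≤ C * ‖v‖ := by
  obtain ⟨C, hC, h⟩ := G.exists_poincare
  refine ⟨Real.sqrt (C.toReal + 1), fun v => ?_⟩
  have h1 : ‖v.1.1.fst‖ ^ 2 ≤ C.toReal * ‖G.grad v‖ ^ 2 := by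
    have h3 := ENNReal.toReal_mono (ENNReal.mul_ne_top hC (by simp)) (h v)
    simpa [ENNReal.toReal_mul, ENNReal.toReal_pow] using h3
  have h2 : ‖G.toH1 v‖ ^ 2 = ‖v.1.1.fst‖ ^ 2 + ‖G.grad v‖ ^ 2 := WithLp.prod_norm_sq_eq_of_L2 v.1.1
  have h3 : ‖v‖ = ‖G.grad v‖ := rfl
  rw [← Real.sqrt_sq (norm_nonneg (G.toH1 v)), ← Real.sqrt_sq (norm_nonneg v), ← Real.sqrt_mul
    (by positivity), h2, h3]
  exact Real.sqrt_le_sqrt (by linarith)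

lemma norm_le_norm_toH1 (v : G.V) : ‖v‖ ≤ ‖G.toH1 v‖ := by
  have h2 : ‖G.toH1 v‖ ^ 2 = ‖v.1.1.fst‖ ^ 2 + ‖G.grad v‖ ^ 2 := WithLp.prod_norm_sq_eq_of_L2 v.1.1
  have h3 : ‖v‖ = ‖G.grad v‖ := rfl
  refine le_of_sq_le_sq ?_ (norm_nonneg _)
  rw [h2, h3]
  linarith [sq_nonneg ‖v.1.1.fst‖]

/-- The kernel of the trace operator on the Dirichlet part. That a vanishing `traceFn` is a genuine
zero trace uses existence of the limit almost everywhere. -/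
lemma isClosed_admissible : IsClosed (G.admissible : Set (H1 G.cracked)) := by
  have hb := G.hasTraceBound_cracked.mono G.dirichlet_subset
  obtain ⟨τ, hτ⟩ := hb.exists_trace G.isOpen_cracked.measurableSet
  obtain ⟨C, hC, hT⟩ := hb
  have : (G.admissible : Set (H1 G.cracked)) = {u | τ u = 0} := by
    ext u
    change (∀ᵐ x ∂(μH[1] : Measure Plane).restrict G.dirichlet, HasTrace G.cracked u.1.fst x 0)
      ↔ τ u = 0
    rw [Lp.eq_zero_iff_ae_eq_zero]
    constructor
    · intro h
      filter_upwards [h, hτ u] with x h1 h2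
      rw [h2, h1.traceFn_eq]
      rfl
    · intro h
      filter_upwards [h, hτ u, (hT _ _ (H1.sobolevOn u)).1] with x h1 h2 h3
      obtain ⟨t, ht⟩ := h3
      rw [h2, ht.traceFn_eq] at h1
      have h4 : t = 0 := h1
      exact h4 ▸ ht
  rw [this]
  exact isClosed_eq τ.continuous continuous_const

/-- By the Poincaré inequality the gradient norm is equivalent to the H¹ norm, for which V is a
closed subspace of a complete space. -/
noncomputable instance : CompleteSpace G.V := by
  obtain ⟨C, hC⟩ := G.exists_toH1_bound
  have hcl := G.isClosed_admissible.completeSpace_coe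
  refine Metric.complete_of_cauchySeq_tendsto fun v hv => ?_
  have h1 : CauchySeq fun n => G.toH1 (v n) :=
    (G.toH1.mkContinuous C hC).uniformContinuous.comp_cauchySeq hv
  obtain ⟨w, hw⟩ := cauchySeq_tendsto_of_complete h1
  have hwA : w ∈ G.admissible :=
    G.isClosed_admissible.mem_of_tendsto hw (Eventually.of_forall fun n => (v n).2)
  let w' : G.V := (⟨w, hwA⟩ : G.admissible)
  refine ⟨w', ?_⟩
  rw [tendsto_iff_norm_sub_tendsto_zero] at hw ⊢
  refine squeeze_zero (fun _ => norm_nonneg _) (fun n => G.norm_le_norm_toH1 _) ?_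
  exact hw

/-- The trace operator on `V`. -/
lemma exists_trace : ∃ τ : G.V →L[ℝ] Lp ℝ 2 ((μH[1] : Measure Plane).restrict G.neumann),
    ∀ v : G.V, τ v =ᵐ[(μH[1] : Measure Plane).restrict G.neumann] traceFn G.cracked v.1.1.fst := by
  obtain ⟨C, hC⟩ := G.exists_toH1_bound
  obtain ⟨τ, hτ⟩ := (G.hasTraceBound_cracked.mono (sdiff_subset : G.neumann ⊆ _)).exists_trace
    G.isOpen_cracked.measurableSet
  exact ⟨τ.comp (G.toH1.mkContinuous C hC), fun v => hτ _⟩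

lemma exists_trace_Ω : ∃ τ : H1 G.Ω →L[ℝ] Lp ℝ 2 ((μH[1] : Measure Plane).restrict G.neumann),
    ∀ v : H1 G.Ω, τ v =ᵐ[(μH[1] : Measure Plane).restrict G.neumann] traceFn G.Ω v.1.fst :=
  (G.hasTraceBound_Ω.mono sdiff_subset).exists_trace G.isOpen_Ω.measurableSet

end CrackGeometry

/-! ### Strongly monotone families and their gradient flows -/

/-- A barrier argument: f cannot cross the level R upwards, as it decreases whenever it is there. -/
lemma le_of_deriv_neg_on_level {f f' : ℝ → ℝ} {a b R : ℝ} (hf : ContinuousOn f (Icc a b))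
    (ha : f a < R) (hd : ∀ t ∈ Ioo a b, HasDerivAt f (f' t) t)
    (hneg : ∀ t ∈ Ioo a b, f t = R → f' t < 0) : ∀ t ∈ Icc a b, f t ≤ R := by
  intro t ht
  rcases ht.1.eq_or_lt with rfl | hat
  · exact ha.le
  have hab : a < b := hat.trans_le ht.2
  have h1 : ∀ᶠ s in 𝓝[>] a, f s < R := by
    have := (hf a (left_mem_Icc.2 hab.le)).eventually (gt_mem_nhds ha)
    rw [nhdsWithin_Icc_eq_nhdsGE hab] at this
    exact this.filter_mono (nhdsWithin_mono _ Ioi_subset_Ici_self)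
  -- Nothing is known about the derivative at a, so the comparison starts a little later, while f is
  -- still below R.
  obtain ⟨a', ha', ha'R⟩ := (h1.and (Ioo_mem_nhdsGT hat)).exists
  have hsub : Icc a' b ⊆ Icc a b := Icc_subset_Icc_left ha'R.1.le
  have hmem : ∀ x ∈ Ico a' b, x ∈ Ioo a b := fun x hx => ⟨ha'R.1.trans_le hx.1, hx.2⟩
  exact image_le_of_deriv_right_lt_deriv_boundary' (hf.mono hsub)
    (fun x hx => (hd x (hmem x hx)).hasDerivWithinAt) ha'.le continuousOn_const
    (fun x _ => hasDerivWithinAt_const _ _ _) (fun x hx hx' => hneg x (hmem x hx) hx')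
    ⟨ha'R.2.le, ht.2⟩

/-- A family of strongly monotone operators, Lipschitz in time and space, near a zero at the initial
time, on a time interval so short that the zeros cannot leave the ball. -/
structure MonoFamily {X : Type*} [NormedAddCommGroup X] [InnerProductSpace ℝ X] (S : Set X)
    (N : ℝ → X → X) (z₀ : X) (t₀ T ρ m L M : ℝ) : Prop where
  ρ_pos : 0 < ρ
  m_pos : 0 < m
  L_nonneg : 0 ≤ L
  m_le_M : m ≤ M
  small : 2 * L * (T - t₀) ≤ m * ρ
  mem : z₀ ∈ S
  zero : N t₀ z₀ = 0
  mono : ∀ t ∈ Icc t₀ T, ∀ x ∈ S ∩ Metric.closedBall z₀ ρ, ∀ y ∈ S ∩ Metric.closedBall z₀ ρ,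
    m * ‖x - y‖ ^ 2 ≤ inner ℝ (N t x - N t y) (x - y)
  lip : ∀ t ∈ Icc t₀ T, ∀ x ∈ S ∩ Metric.closedBall z₀ ρ, ∀ y ∈ S ∩ Metric.closedBall z₀ ρ,
    ‖N t x - N t y‖ ≤ M * ‖x - y‖
  lip_time : ∀ s ∈ Icc t₀ T, ∀ t ∈ Icc t₀ T, ∀ x ∈ S ∩ Metric.closedBall z₀ ρ,
    ‖N t x - N s x‖ ≤ L * |t - s|

namespace MonoFamily

variable {X : Type*} [NormedAddCommGroup X] [InnerProductSpace ℝ X] {S : Set X}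
  {N : ℝ → X → X} {z₀ : X} {t₀ T ρ m L M : ℝ}

lemma mem_ball (H : MonoFamily S N z₀ t₀ T ρ m L M) : z₀ ∈ S ∩ Metric.closedBall z₀ ρ :=
  ⟨H.mem, Metric.mem_closedBall_self H.ρ_pos.le⟩

lemma norm_sub_le (H : MonoFamily S N z₀ t₀ T ρ m L M) {t : ℝ} (ht : t ∈ Icc t₀ T) {x y : X}
    (hx : x ∈ S ∩ Metric.closedBall z₀ ρ) (hy : y ∈ S ∩ Metric.closedBall z₀ ρ) :
    m * ‖x - y‖ ≤ ‖N t x - N t y‖ := by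
  rcases (norm_nonneg (x - y)).eq_or_lt with h0 | h0
  · rw [← h0, mul_zero]; exact norm_nonneg _
  have h1 := (H.mono t ht x hx y hy).trans (real_inner_le_norm _ _)
  rw [sq, ← mul_assoc] at h1
  exact le_of_mul_le_mul_right h1 h0

/-- If x is a zero at time s, then at time t the value at x is only the time increment of N;
monotonicity turns it into a distance. Curves of zeros are therefore Lipschitz with constant L/m. -/
lemma norm_sub_le_of_zero (H : MonoFamily S N z₀ t₀ T ρ m L M) {s t : ℝ} (hs : s ∈ Icc t₀ T)
    (ht : t ∈ Icc t₀ T) {x y : X}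
    (hx : x ∈ S ∩ Metric.closedBall z₀ ρ) (hy : y ∈ S ∩ Metric.closedBall z₀ ρ)
    (hxz : N s x = 0) (hyz : N t y = 0) : m * ‖x - y‖ ≤ L * |t - s| := by
  refine (H.norm_sub_le ht hx hy).trans ?_
  have := H.lip_time s hs t ht x hx
  rw [hyz]
  rwa [hxz] at this

/-- A continuous curve of zeros leaving the ball would be at distance exactly ρ at some time, where
mρ ≤ L(T − t₀) ≤ mρ/2. Uniqueness thus covers all branches, not just those assumed to stay near z₀.
-/
lemma mem_ball_of_zero (H : MonoFamily S N z₀ t₀ T ρ m L M) {t₁ : ℝ} (ht₁ : t₁ ≤ T) {z : ℝ → X}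
    (hz : ContinuousOn z (Icc t₀ t₁)) (hzS : ∀ t ∈ Icc t₀ t₁, z t ∈ S)
    (hz0 : ∀ t ∈ Icc t₀ t₁, N t (z t) = 0) (hi : z t₀ = z₀) :
    ∀ t ∈ Icc t₀ t₁, z t ∈ S ∩ Metric.closedBall z₀ ρ := by
  intro t ht
  refine ⟨hzS t ht, ?_⟩
  by_contra hlt
  rw [Metric.mem_closedBall, not_le, dist_eq_norm] at hlt
  have hsub : Icc t₀ t ⊆ Icc t₀ t₁ := Icc_subset_Icc_right ht.2
  have hd : ContinuousOn (fun s => ‖z s - z₀‖) (Icc t₀ t) :=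
    ((hz.mono hsub).sub continuousOn_const).norm
  obtain ⟨s, hs, hsρ⟩ := intermediate_value_Icc ht.1 hd
    (show ρ ∈ Icc ‖z t₀ - z₀‖ ‖z t - z₀‖ from ⟨by rw [hi, sub_self, norm_zero]; exact H.ρ_pos.le, hlt.le⟩)
  simp only at hsρ
  have hsT : s ∈ Icc t₀ T := ⟨hs.1, (hs.2.trans ht.2).trans ht₁⟩
  have h1 := H.norm_sub_le_of_zero hsT ⟨le_rfl, hsT.1.trans hsT.2⟩ (x := z s) (y := z₀)
    ⟨hzS s (hsub hs), by rw [Metric.mem_closedBall, dist_eq_norm, hsρ]⟩ H.mem_ball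
    (hz0 s (hsub hs)) H.zero
  rw [hsρ, abs_sub_comm, abs_of_nonneg (by linarith [hs.1])] at h1
  have h2 : L * (s - t₀) ≤ L * (T - t₀) := mul_le_mul_of_nonneg_left (by linarith [hsT.2]) H.L_nonneg
  have h3 := mul_pos H.m_pos H.ρ_pos
  linarith [H.small]

/-- The map x ↦ x − ηN(t, x) contracts with ratio q. It moves the centre by at most ηL(T − t₀) ≤ (1
− q²)ρ/2 ≤ (1 − q)ρ, so it maps the ball to itself. The ball must lie in S, since monotonicity is
available only there. -/
lemma exists_zero [CompleteSpace X] (H : MonoFamily S N z₀ t₀ T ρ m L M)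
    (hS : Metric.closedBall z₀ ρ ⊆ S) {t : ℝ} (ht : t ∈ Icc t₀ T) :
    ∃ x ∈ Metric.closedBall z₀ ρ, N t x = 0 := by
  have hm := H.m_pos
  have hM : 0 < M := hm.trans_le H.m_le_M
  have hB : ∀ x ∈ Metric.closedBall z₀ ρ, x ∈ S ∩ Metric.closedBall z₀ ρ := fun x hx => ⟨hS hx, hx⟩
  -- The step that minimizes the squared ratio 1 − 2ηm + η²M².
  set η := m / M ^ 2 with hη
  have hη0 : 0 < η := by positivity
  set q := Real.sqrt (1 - m ^ 2 / M ^ 2) with hq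
  have hr0 : 0 < m ^ 2 / M ^ 2 := by positivity
  have hr1 : m ^ 2 / M ^ 2 ≤ 1 := by
    rw [div_le_one (by positivity)]
    exact pow_le_pow_left₀ hm.le H.m_le_M 2
  have hq0 : 0 ≤ q := Real.sqrt_nonneg _
  have hqsq : q ^ 2 = 1 - m ^ 2 / M ^ 2 := Real.sq_sqrt (by linarith)
  have hq1 : q < 1 := by nlinarith
  let f : X → X := fun x => x - η • N t x
  have hcon : ∀ x ∈ Metric.closedBall z₀ ρ, ∀ y ∈ Metric.closedBall z₀ ρ,
      ‖f x - f y‖ ≤ q * ‖x - y‖ := by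
    intro x hx y hy
    have e1 : f x - f y = (x - y) - η • (N t x - N t y) := by
      simp only [f, smul_sub]; abel
    refine le_of_sq_le_sq ?_ (by positivity)
    rw [e1, norm_sub_sq_real, mul_pow, hqsq, norm_smul, inner_smul_right, Real.norm_of_nonneg hη0.le,
      real_inner_comm]
    have h1 := H.mono t ht x (hB x hx) y (hB y hy)
    have h2 := pow_le_pow_left₀ (norm_nonneg _) (H.lip t ht x (hB x hx) y (hB y hy)) 2
    have h3 := mul_le_mul_of_nonneg_left h1 hη0.le
    have h4 : (η * ‖N t x - N t y‖) ^ 2 ≤ η ^ 2 * (M * ‖x - y‖) ^ 2 := by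
      rw [mul_pow]; gcongr
    have h5 : η * (m * ‖x - y‖ ^ 2) = m ^ 2 / M ^ 2 * ‖x - y‖ ^ 2 := by rw [hη]; field_simp
    have h6 : η ^ 2 * (M * ‖x - y‖) ^ 2 = m ^ 2 / M ^ 2 * ‖x - y‖ ^ 2 := by rw [hη]; field_simp
    nlinarith
  have hmaps : MapsTo f (Metric.closedBall z₀ ρ) (Metric.closedBall z₀ ρ) := by
    intro x hx
    have h1 := hcon x hx z₀ (Metric.mem_closedBall_self H.ρ_pos.le)
    have h2 : ‖f z₀ - z₀‖ ≤ η * (L * (T - t₀)) := by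
      have h3 := H.lip_time t₀ ⟨le_rfl, ht.1.trans ht.2⟩ t ht z₀ H.mem_ball
      rw [H.zero, sub_zero, abs_of_nonneg (by linarith [ht.1])] at h3
      simp only [f, sub_sub_cancel_left, norm_neg, norm_smul, Real.norm_of_nonneg hη0.le]
      refine mul_le_mul_of_nonneg_left (h3.trans ?_) hη0.le
      exact mul_le_mul_of_nonneg_left (by linarith [ht.2]) H.L_nonneg
    rw [Metric.mem_closedBall, dist_eq_norm] at hx ⊢
    have h4 : ‖f x - z₀‖ ≤ ‖f x - f z₀‖ + ‖f z₀ - z₀‖ := by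
      have : f x - z₀ = (f x - f z₀) + (f z₀ - z₀) := by abel
      rw [this]; exact norm_add_le _ _
    have h5 : q * ‖x - z₀‖ ≤ q * ρ := mul_le_mul_of_nonneg_left hx hq0
    have h6 : η * (L * (T - t₀)) ≤ η * (m * ρ / 2) :=
      mul_le_mul_of_nonneg_left (by linarith [H.small]) hη0.le
    have h7 : η * (m * ρ / 2) = (1 - q ^ 2) / 2 * ρ := by rw [hqsq, hη]; field_simp; ring
    have h8 : (1 - q ^ 2) / 2 * ρ ≤ (1 - q) * ρ :=
      mul_le_mul_of_nonneg_right (by nlinarith) H.ρ_pos.le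
    linarith
  have hcw : ContractingWith ⟨q, hq0⟩ (hmaps.restrict f _ _) := by
    refine ⟨by exact_mod_cast hq1, LipschitzWith.of_dist_le_mul fun x y => ?_⟩
    have := hcon x x.2 y y.2
    rw [← dist_eq_norm, ← dist_eq_norm] at this
    exact this
  obtain ⟨y, hy, hfix, -⟩ := hcw.exists_fixedPoint' Metric.isClosed_closedBall.isComplete hmaps
    (Metric.mem_closedBall_self H.ρ_pos.le) (edist_ne_top _ _)
  refine ⟨y, hy, ?_⟩
  have h1 : y - η • N t y = y := hfix
  have h2 : η • N t y = 0 := by simpa using h1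
  exact (smul_eq_zero.1 h2).resolve_left hη0.ne'

/-- At distance ρ from z₀ monotonicity gives (N(t, z) | z − z₀) ≥ mρ² − L(T − t₀)ρ ≥ mρ²/2, so the
distance decreases along the flow. -/
lemma flow_mem_ball (H : MonoFamily S N z₀ t₀ T ρ m L M) {t₁ ε : ℝ} (ht₁ : t₁ ≤ T) (hε : 0 < ε)
    {z : ℝ → X} (hz : ContinuousOn z (Icc t₀ t₁)) (hzS : ∀ t ∈ Icc t₀ t₁, z t ∈ S)
    (hd : ∀ t ∈ Ioo t₀ t₁, HasDerivAt z (-(ε⁻¹ • N t (z t))) t) (hi : ‖z t₀ - z₀‖ < ρ) :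
    ∀ t ∈ Icc t₀ t₁, z t ∈ S ∩ Metric.closedBall z₀ ρ := by
  have key := le_of_deriv_neg_on_level (f := fun t => ‖z t - z₀‖ ^ 2)
    (f' := fun t => 2 * inner ℝ (z t - z₀) (-(ε⁻¹ • N t (z t)))) (a := t₀) (b := t₁) (R := ρ ^ 2)
    ((hz.sub continuousOn_const).norm.pow 2) (pow_lt_pow_left₀ hi (norm_nonneg _) (by norm_num))
    (fun t ht => ((hd t ht).sub_const z₀).norm_sq) (fun t ht hR => by
      have hnorm : ‖z t - z₀‖ = ρ := by
        exact (pow_left_inj₀ (norm_nonneg _) H.ρ_pos.le (by norm_num)).1 hR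
      have htT : t ∈ Icc t₀ T := ⟨ht.1.le, ht.2.le.trans ht₁⟩
      have hzt : z t ∈ S ∩ Metric.closedBall z₀ ρ :=
        ⟨hzS t ⟨ht.1.le, ht.2.le⟩, by rw [Metric.mem_closedBall, dist_eq_norm, hnorm]⟩
      have h1 := H.mono t htT _ hzt _ H.mem_ball
      have h2 := H.lip_time t₀ ⟨le_rfl, htT.1.trans htT.2⟩ t htT z₀ H.mem_ball
      rw [H.zero, sub_zero, abs_of_nonneg (by linarith [ht.1])] at h2
      have h3 := (abs_le.1 (abs_real_inner_le_norm (N t z₀) (z t - z₀))).1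
      rw [inner_sub_left, hnorm] at h1
      rw [hnorm] at h3
      have h4 : ‖N t z₀‖ * ρ ≤ L * (T - t₀) * ρ := by
        refine mul_le_mul_of_nonneg_right (h2.trans ?_) H.ρ_pos.le
        exact mul_le_mul_of_nonneg_left (by linarith [htT.2]) H.L_nonneg
      have h5 : 2 * L * (T - t₀) * ρ ≤ m * ρ * ρ := mul_le_mul_of_nonneg_right H.small H.ρ_pos.le
      have h6 : 0 < m * ρ * ρ := by have := H.m_pos; have := H.ρ_pos; positivity
      have h7 : 0 < inner ℝ (N t (z t)) (z t - z₀) := by nlinarith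
      rw [inner_neg_right, inner_smul_right, real_inner_comm]
      have : 0 < ε⁻¹ * inner ℝ (N t (z t)) (z t - z₀) := mul_pos (inv_pos.2 hε) h7
      linarith)
  intro t ht
  refine ⟨hzS t ht, ?_⟩
  rw [Metric.mem_closedBall, dist_eq_norm]
  exact le_of_sq_le_sq (key t ht) H.ρ_pos.le

lemma continuousOn_comp (H : MonoFamily S N z₀ t₀ T ρ m L M) {t₁ : ℝ} (ht₁ : t₁ ≤ T)
    {z : ℝ → X} (hz : ContinuousOn z (Icc t₀ t₁))
    (hzB : ∀ t ∈ Icc t₀ t₁, z t ∈ S ∩ Metric.closedBall z₀ ρ) :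
    ContinuousOn (fun t => N t (z t)) (Icc t₀ t₁) := by
  intro s hs
  have hI : Icc t₀ t₁ ⊆ Icc t₀ T := Icc_subset_Icc_right ht₁
  rw [ContinuousWithinAt, tendsto_iff_norm_sub_tendsto_zero]
  have h1 : Tendsto (fun t => M * ‖z t - z s‖ + L * |t - s|) (𝓝[Icc t₀ t₁] s) (𝓝 0) := by
    have e1 : Tendsto (fun t => ‖z t - z s‖) (𝓝[Icc t₀ t₁] s) (𝓝 0) :=
      tendsto_iff_norm_sub_tendsto_zero.1 (hz s hs)
    have e2 : Tendsto (fun t : ℝ => |t - s|) (𝓝[Icc t₀ t₁] s) (𝓝 0) := by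
      have : Tendsto (fun t : ℝ => |t - s|) (𝓝 s) (𝓝 |s - s|) := by
        exact (continuous_id.sub continuous_const).abs.tendsto s
      rw [sub_self, abs_zero] at this
      exact this.mono_left nhdsWithin_le_nhds
    simpa using (e1.const_mul M).add (e2.const_mul L)
  refine squeeze_zero' (Eventually.of_forall fun _ => norm_nonneg _) ?_ h1
  filter_upwards [self_mem_nhdsWithin] with t ht
  have e1 : N t (z t) - N s (z s) = (N t (z t) - N t (z s)) + (N t (z s) - N s (z s)) := by abel
  rw [e1]
  exact (norm_add_le _ _).trans (add_le_add (H.lip t (hI ht) _ (hzB t ht) _ (hzB s hs))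
    (H.lip_time s (hI hs) t (hI ht) _ (hzB s hs)))

/-- N(t, z) is −ε times the velocity. As N is only Lipschitz, the equation is not differentiated;
instead increments z(s + h) − z(s) are followed. When such an increment has norm μh, the damping
m(μh)² exceeds the drift Lh · μh caused by time, so the norm cannot grow past μh. Letting h tend to
zero bounds the velocity by μ. -/
lemma flow_norm_le_of_lt (H : MonoFamily S N z₀ t₀ T ρ m L M) {t₁ ε : ℝ} (ht₁ : t₁ ≤ T) (hε : 0 < ε)
    {z : ℝ → X} (hz : ContinuousOn z (Icc t₀ t₁))
    (hzB : ∀ t ∈ Icc t₀ t₁, z t ∈ S ∩ Metric.closedBall z₀ ρ)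
    (hd : ∀ t ∈ Ioo t₀ t₁, HasDerivAt z (-(ε⁻¹ • N t (z t))) t) {η : ℝ} (hηL : ε * L < m * η)
    {a t : ℝ} (ha : a ∈ Ioo t₀ t₁) (hat : t ∈ Ico a t₁) (hη : ‖N a (z a)‖ < η) :
    ‖N t (z t)‖ ≤ η := by
  -- The bound η on N is the bound μ on the velocity, and εL < mη becomes L < mμ.
  set μ := η / ε with hμ
  have hη0 : 0 < η := (norm_nonneg _).trans_lt hη
  have hμ0 : 0 < μ := by positivity
  have hμL : L < m * μ := by
    rw [hμ, ← mul_div_assoc, lt_div_iff₀ hε, mul_comm]; exact hηL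
  have hda : ‖-(ε⁻¹ • N a (z a))‖ < μ := by
    rw [norm_neg, norm_smul, Real.norm_of_nonneg (inv_nonneg.2 hε.le), hμ, inv_mul_eq_div]
    exact (div_lt_div_iff_of_pos_right hε).2 hη
  have hslope : ∀ s ∈ Ioo t₀ t₁, Tendsto (fun h : ℝ => h⁻¹ • (z (s + h) - z s)) (𝓝[>] 0)
      (𝓝 (-(ε⁻¹ • N s (z s)))) := fun s hs =>
    (hasDerivAt_iff_tendsto_slope_zero.1 (hd s hs)).mono_left
      (nhdsWithin_mono _ fun x hx => (ne_of_gt hx : x ≠ 0))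
  have hnorm : ∀ (s h : ℝ), 0 < h → ‖h⁻¹ • (z (s + h) - z s)‖ = ‖z (s + h) - z s‖ / h := by
    intro s h hh
    rw [norm_smul, Real.norm_of_nonneg (inv_nonneg.2 hh.le), inv_mul_eq_div]
  have hev : ∀ᶠ h in 𝓝[>] (0 : ℝ), ‖z (t + h) - z t‖ / h ≤ μ := by
    have h1 := (hslope a ha).norm.eventually (gt_mem_nhds hda)
    have h2 : Ioo 0 (t₁ - t) ∈ 𝓝[>] (0 : ℝ) := Ioo_mem_nhdsGT (sub_pos.2 hat.2)
    filter_upwards [h1, h2] with h hh1 hh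
    rw [hnorm a h hh.1, div_lt_iff₀ hh.1] at hh1
    rw [div_le_iff₀ hh.1]
    have hin : ∀ s ∈ Icc a (t₁ - h), s ∈ Icc t₀ t₁ ∧ s + h ∈ Icc t₀ t₁ := fun s hs =>
      ⟨⟨ha.1.le.trans hs.1, by linarith [hs.2, hh.1]⟩, by linarith [hs.1, ha.1, hh.1],
        by linarith [hs.2]⟩
    have hsh : ContinuousOn (fun s => z (s + h)) (Icc a (t₁ - h)) :=
      hz.comp (by fun_prop) fun s hs => (hin s hs).2
    have key := le_of_deriv_neg_on_level (f := fun s => ‖z (s + h) - z s‖ ^ 2)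
      (f' := fun s => 2 * inner ℝ (z (s + h) - z s)
        (-(ε⁻¹ • N (s + h) (z (s + h))) - -(ε⁻¹ • N s (z s))))
      (a := a) (b := t₁ - h) (R := (μ * h) ^ 2)
      ((hsh.sub (hz.mono fun s hs => (hin s hs).1)).norm.pow 2)
      (pow_lt_pow_left₀ hh1 (norm_nonneg _) (by norm_num))
      (fun s hs => by
        have hs1 : s ∈ Ioo t₀ t₁ := ⟨ha.1.trans hs.1, by linarith [hs.2, hh.1]⟩
        have hs2 : s + h ∈ Ioo t₀ t₁ := ⟨by linarith [hs1.1, hh.1], by linarith [hs.2]⟩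
        exact (((hd _ hs2).comp_add_const s h).sub (hd s hs1)).norm_sq)
      (fun s hs hR => by
        have hnr : ‖z (s + h) - z s‖ = μ * h :=
          (pow_left_inj₀ (norm_nonneg _) (mul_pos hμ0 hh.1).le (by norm_num)).1 hR
        obtain ⟨hs1, hs2⟩ := hin s (Ioo_subset_Icc_self hs)
        have hI : Icc t₀ t₁ ⊆ Icc t₀ T := Icc_subset_Icc_right ht₁
        have e1 := H.mono (s + h) (hI hs2) _ (hzB _ hs2) _ (hzB _ hs1)
        have e2 := H.lip_time s (hI hs1) (s + h) (hI hs2) _ (hzB _ hs1)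
        rw [add_sub_cancel_left, abs_of_pos hh.1] at e2
        have e3 := (abs_le.1 (abs_real_inner_le_norm (N (s + h) (z s) - N s (z s))
          (z (s + h) - z s))).1
        have e4 : N (s + h) (z (s + h)) - N s (z s) = (N (s + h) (z (s + h)) - N (s + h) (z s))
          + (N (s + h) (z s) - N s (z s)) := by abel
        have e5 : inner ℝ (N (s + h) (z (s + h)) - N s (z s)) (z (s + h) - z s) > 0 := by
          rw [e4, inner_add_left]
          rw [hnr] at e1 e3
          have e6 : ‖N (s + h) (z s) - N s (z s)‖ * (μ * h) ≤ L * h * (μ * h) :=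
            mul_le_mul_of_nonneg_right e2 (mul_pos hμ0 hh.1).le
          have e7 : L * h * (μ * h) < m * (μ * h) ^ 2 := by
            have : 0 < (m * μ - L) * (h * (μ * h)) :=
              mul_pos (by linarith) (mul_pos hh.1 (mul_pos hμ0 hh.1))
            nlinarith
          linarith
        have e8 : -(ε⁻¹ • N (s + h) (z (s + h))) - -(ε⁻¹ • N s (z s))
            = -(ε⁻¹ • (N (s + h) (z (s + h)) - N s (z s))) := by rw [smul_sub]; abel
        rw [e8, inner_neg_right, inner_smul_right, real_inner_comm]
        have := mul_pos (inv_pos.2 hε) e5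
        linarith)
    exact le_of_sq_le_sq (key t ⟨hat.1, by linarith [hh.2]⟩) (mul_pos hμ0 hh.1).le
  have htI : t ∈ Ioo t₀ t₁ := ⟨ha.1.trans_le hat.1, hat.2⟩
  have hlim := le_of_tendsto (hslope t htI).norm (by
    filter_upwards [hev, self_mem_nhdsWithin] with h h1 h2
    rw [hnorm t h h2]; exact h1)
  rw [norm_neg, norm_smul, Real.norm_of_nonneg (inv_nonneg.2 hε.le), hμ, inv_mul_eq_div,
    div_le_div_iff_of_pos_right hε] at hlim
  exact hlim

/-- The flow starts near a zero, so N is smaller than η at t₀ and, by continuity, at times just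
after t₀, where the flow equation is available. From there the bound propagates, and continuity
recovers the end points. -/
lemma flow_norm_le (H : MonoFamily S N z₀ t₀ T ρ m L M) {t₁ ε : ℝ} (ht₀₁ : t₀ < t₁) (ht₁ : t₁ ≤ T)
    (hε : 0 < ε) {z : ℝ → X} (hz : ContinuousOn z (Icc t₀ t₁))
    (hzB : ∀ t ∈ Icc t₀ t₁, z t ∈ S ∩ Metric.closedBall z₀ ρ)
    (hd : ∀ t ∈ Ioo t₀ t₁, HasDerivAt z (-(ε⁻¹ • N t (z t))) t) {η : ℝ} (hηL : ε * L < m * η)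
    (hη : M * ‖z t₀ - z₀‖ < η) : ∀ t ∈ Icc t₀ t₁, ‖N t (z t)‖ ≤ η := by
  have hcont := (H.continuousOn_comp ht₁ hz hzB).norm
  have hl : t₀ ∈ Icc t₀ t₁ := left_mem_Icc.2 ht₀₁.le
  have h0 : ‖N t₀ (z t₀)‖ < η := by
    have := H.lip t₀ ⟨le_rfl, ht₀₁.le.trans ht₁⟩ _ (hzB t₀ hl) _ H.mem_ball
    rw [H.zero, sub_zero] at this
    exact this.trans_lt hη
  have h1 : ∀ᶠ s in 𝓝[>] t₀, ‖N s (z s)‖ < η := by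
    have := (hcont t₀ hl).eventually (gt_mem_nhds h0)
    rw [nhdsWithin_Icc_eq_nhdsGE ht₀₁] at this
    exact this.filter_mono (nhdsWithin_mono _ Ioi_subset_Ici_self)
  have hint : ∀ t ∈ Ioo t₀ t₁, ‖N t (z t)‖ ≤ η := by
    intro t ht
    obtain ⟨a, ha, ha'⟩ := (h1.and (Ioo_mem_nhdsGT ht.1)).exists
    exact H.flow_norm_le_of_lt ht₁ hε hz hzB hd hηL ⟨ha'.1, ha'.2.trans ht.2⟩ ⟨ha'.2.le, ht.2⟩ ha
  have hcl : Icc t₀ t₁ ⊆ closure (Ioo t₀ t₁) := by rw [closure_Ioo ht₀₁.ne]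
  intro t ht
  have : (𝓝[Ioo t₀ t₁] t).NeBot := mem_closure_iff_nhdsWithin_neBot.1 (hcl ht)
  exact le_of_tendsto ((hcont t ht).mono_left (nhdsWithin_mono _ Ioo_subset_Icc_self))
    (by filter_upwards [self_mem_nhdsWithin] with s hs using hint s hs)

/-- The solutions of the gradient flow converge to a curve of zeros. -/
theorem exists_flow_limit [CompleteSpace X] (H : MonoFamily S N z₀ t₀ T ρ m L M) (hS : IsClosed S)
    {t₁ : ℝ} (ht₀₁ : t₀ < t₁) (ht₁ : t₁ ≤ T) {z : ℝ → ℝ → X}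
    (hi : Tendsto (fun ε => z ε t₀) (𝓝[>] 0) (𝓝 z₀))
    (hz : ∀ᶠ ε in 𝓝[>] (0 : ℝ), ContinuousOn (z ε) (Icc t₀ t₁) ∧ (∀ t ∈ Icc t₀ t₁, z ε t ∈ S) ∧
      ∀ t ∈ Ioo t₀ t₁, HasDerivAt (z ε) (-(ε⁻¹ • N t (z ε t))) t) :
    ∃ w : ℝ → X, ∀ t ∈ Icc t₀ t₁, w t ∈ S ∩ Metric.closedBall z₀ ρ ∧ N t (w t) = 0 ∧
      Tendsto (fun ε => z ε t) (𝓝[>] 0) (𝓝 (w t)) := by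
  have hi' := tendsto_iff_norm_sub_tendsto_zero.1 hi
  have hball : ∀ᶠ ε in 𝓝[>] (0 : ℝ), ∀ t ∈ Icc t₀ t₁, z ε t ∈ S ∩ Metric.closedBall z₀ ρ := by
    filter_upwards [hz, hi'.eventually (gt_mem_nhds H.ρ_pos), self_mem_nhdsWithin] with ε h1 h2 h3
    exact H.flow_mem_ball ht₁ h3 h1.1 h1.2.1 h1.2.2 h2
  -- For fixed η both conditions of `flow_norm_le` hold for small ε, since the initial points tend
  -- to z₀ and εL tends to zero. There is no initial layer: the bound is uniform up to t₀.
  have hN : ∀ η > 0, ∀ᶠ ε in 𝓝[>] (0 : ℝ), ∀ t ∈ Icc t₀ t₁, ‖N t (z ε t)‖ ≤ η := by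
    intro η hη
    have h4 : Tendsto (fun ε => M * ‖z ε t₀ - z₀‖) (𝓝[>] 0) (𝓝 0) := by
      simpa using hi'.const_mul M
    have h5 : Tendsto (fun ε : ℝ => ε * L) (𝓝[>] 0) (𝓝 0) := by
      have : Tendsto (fun ε : ℝ => ε * L) (𝓝 0) (𝓝 (0 * L)) :=
        (continuous_id.mul continuous_const).tendsto 0
      rw [zero_mul] at this
      exact this.mono_left nhdsWithin_le_nhds
    filter_upwards [hz, hball, h4.eventually (gt_mem_nhds hη),
      h5.eventually (gt_mem_nhds (mul_pos H.m_pos hη)), self_mem_nhdsWithin] with ε h1 h2 h6 h7 h3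
    exact H.flow_norm_le ht₀₁ ht₁ h3 h1.1 h2 h1.2.2 h7 h6
  have hex : ∀ t ∈ Icc t₀ t₁, ∃ w, w ∈ S ∩ Metric.closedBall z₀ ρ ∧ N t w = 0 ∧
      Tendsto (fun ε => z ε t) (𝓝[>] 0) (𝓝 w) := by
    intro t ht
    have htT : t ∈ Icc t₀ T := ⟨ht.1, ht.2.trans ht₁⟩
    have hcau : Cauchy (map (fun ε => z ε t) (𝓝[>] 0)) := by
      rw [Metric.cauchy_iff]
      refine ⟨inferInstance, fun η hη => ?_⟩
      -- With both residuals at most mη/3, monotonicity puts two solutions within 2η/3 of each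
      -- other.
      set E := {ε | z ε t ∈ S ∩ Metric.closedBall z₀ ρ ∧ ‖N t (z ε t)‖ ≤ m * η / 3} with hE
      have hEm : E ∈ 𝓝[>] (0 : ℝ) := by
        filter_upwards [hball, hN (m * η / 3) (by have := H.m_pos; positivity)] with ε h1 h2
        exact ⟨h1 t ht, h2 t ht⟩
      refine ⟨(fun ε => z ε t) '' E, image_mem_map hEm, ?_⟩
      rintro _ ⟨ε, hε, rfl⟩ _ ⟨ε', hε', rfl⟩
      have h1 := H.norm_sub_le htT hε.1 hε'.1
      have h2 := _root_.norm_sub_le (N t (z ε t)) (N t (z ε' t))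
      rw [dist_eq_norm]
      have h3 : m * ‖z ε t - z ε' t‖ < m * η := by
        have := mul_pos H.m_pos hη
        linarith [hε.2, hε'.2]
      exact lt_of_mul_lt_mul_left h3 H.m_pos.le
    obtain ⟨w, hw⟩ := cauchy_map_iff_exists_tendsto.1 hcau
    have hwB : w ∈ S ∩ Metric.closedBall z₀ ρ :=
      (hS.inter Metric.isClosed_closedBall).mem_of_tendsto hw (hball.mono fun ε h => h t ht)
    refine ⟨w, hwB, ?_, hw⟩
    have h1 : Tendsto (fun ε => N t (z ε t)) (𝓝[>] 0) (𝓝 0) := by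
      rw [Metric.tendsto_nhds]
      intro η hη
      filter_upwards [hN (η / 2) (half_pos hη)] with ε h
      rw [dist_zero_right]
      exact (h t ht).trans_lt (half_lt_self hη)
    have h2 : Tendsto (fun ε => N t (z ε t)) (𝓝[>] 0) (𝓝 (N t w)) := by
      rw [tendsto_iff_norm_sub_tendsto_zero]
      have h3 : Tendsto (fun ε => M * ‖z ε t - w‖) (𝓝[>] 0) (𝓝 0) := by
        simpa using (tendsto_iff_norm_sub_tendsto_zero.1 hw).const_mul M
      refine squeeze_zero' (Eventually.of_forall fun _ => norm_nonneg _) ?_ h3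
      filter_upwards [hball] with ε h
      exact H.lip t htT _ (h t ht) _ hwB
    exact tendsto_nhds_unique h2 h1
  choose! w hw using hex
  exact ⟨w, hw⟩

end MonoFamily

/-! ### Abstract loaded energies near a nondegenerate critical point -/

/-- A function of class `C¹` on a convex set is strictly differentiable there. -/
lemma exists_norm_sub_sub_le {Y Z : Type*} [NormedAddCommGroup Y] [NormedSpace ℝ Y]
    [NormedAddCommGroup Z] [NormedSpace ℝ Z] {s : Set Y} (hs : Convex ℝ s) {f : Y → Z}
    {f' : Y → Y →L[ℝ] Z} (hf : ∀ x ∈ s, HasFDerivWithinAt f (f' x) s x) (hc : ContinuousOn f' s)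
    {y₀ : Y} (hy₀ : y₀ ∈ s) {κ : ℝ} (hκ : 0 < κ) :
    ∃ δ > 0, ∀ x ∈ s ∩ Metric.ball y₀ δ, ∀ y ∈ s ∩ Metric.ball y₀ δ,
      ‖f x - f y - f' y₀ (x - y)‖ ≤ κ * ‖x - y‖ := by
  have h0 : Tendsto f' (𝓝[s] y₀) (𝓝 (f' y₀)) := hc y₀ hy₀
  have h1 : ∀ᶠ x in 𝓝[s] y₀, ‖f' x - f' y₀‖ < κ :=
    (tendsto_iff_norm_sub_tendsto_zero.1 h0).eventually (gt_mem_nhds hκ)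
  obtain ⟨δ, hδ, h⟩ := Metric.mem_nhdsWithin_iff.1 h1
  refine ⟨δ, hδ, fun x hx y hy => ?_⟩
  exact (hs.inter (convex_ball _ _)).norm_image_sub_le_of_norm_hasFDerivWithin_le'
    (fun z hz => (hf z hz.1).mono inter_subset_left)
    (fun z hz => le_of_lt (h ⟨hz.2, hz.1⟩)) hy hx

/-- An energy `R(Ev + p(t), σ) + σ - ℓ(t)(v) - c(t)`, with a density `R` of class `C²` and Lipschitz
loads. -/
structure LoadedEnergy (V W : Type*) [NormedAddCommGroup V] [InnerProductSpace ℝ V]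
    [NormedAddCommGroup W] [NormedSpace ℝ W] where
  a : ℝ
  b : ℝ
  a_lt_b : a < b
  T : ℝ
  R : W × ℝ → ℝ
  contDiffOn_R : ContDiffOn ℝ 2 R (univ ×ˢ Icc a b)
  E : V →L[ℝ] W
  norm_E : ∀ v, ‖E v‖ = ‖v‖
  p : ℝ → W
  Lp : ℝ
  Lp_nonneg : 0 ≤ Lp
  p_lip : ∀ s ∈ Icc 0 T, ∀ t ∈ Icc 0 T, ‖p t - p s‖ ≤ Lp * |t - s|
  l : ℝ → V →L[ℝ] ℝ
  Ll : ℝ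
  Ll_nonneg : 0 ≤ Ll
  l_lip : ∀ s ∈ Icc 0 T, ∀ t ∈ Icc 0 T, ‖l t - l s‖ ≤ Ll * |t - s|
  c : ℝ → ℝ

namespace LoadedEnergy

variable {V W : Type*} [NormedAddCommGroup V] [InnerProductSpace ℝ V]
    [NormedAddCommGroup W] [NormedSpace ℝ W] (F : LoadedEnergy V W)

/-- The value of the energy. -/
noncomputable def val (t : ℝ) (z : V × ℝ) : ℝ := F.R (F.E z.1 + F.p t, z.2) + z.2 - F.l t z.1 - F.c t

/-- The linear part of the change of variables in the density. -/
noncomputable def J : V × ℝ →L[ℝ] W × ℝ := F.E.prodMap (ContinuousLinearMap.id ℝ ℝ)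

/-- The argument of the density. -/
noncomputable def arg (t : ℝ) (z : V × ℝ) : W × ℝ := (F.E z.1 + F.p t, z.2)

/-- The domain of the density. -/
def dom : Set (W × ℝ) := univ ×ˢ Icc F.a F.b

/-- The derivative of the density. -/
noncomputable def R1 : W × ℝ → W × ℝ →L[ℝ] ℝ := fderivWithin ℝ F.R F.dom

/-- The second derivative of the density. -/
noncomputable def R2 : W × ℝ → W × ℝ →L[ℝ] W × ℝ →L[ℝ] ℝ := fderivWithin ℝ F.R1 F.dom

/-- The differential of the energy. -/
noncomputable def P (t : ℝ) (z : V × ℝ) : V × ℝ →L[ℝ] ℝ :=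
  (F.R1 (F.arg t z)).comp F.J + ContinuousLinearMap.snd ℝ V ℝ
    - (F.l t).comp (ContinuousLinearMap.fst ℝ V ℝ)

lemma uniqueDiffOn_strip (X : Type*) [NormedAddCommGroup X] [NormedSpace ℝ X] :
    UniqueDiffOn ℝ ((univ : Set X) ×ˢ Icc F.a F.b) :=
  uniqueDiffOn_univ.prod (uniqueDiffOn_Icc F.a_lt_b)

lemma arg_mem {t : ℝ} {z : V × ℝ} (hz : z.2 ∈ Icc F.a F.b) : F.arg t z ∈ F.dom := ⟨mem_univ _, hz⟩

lemma hasFDerivAt_arg (t : ℝ) (z : V × ℝ) : HasFDerivAt (F.arg t) F.J z :=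
  ((F.E.hasFDerivAt.comp z hasFDerivAt_fst).add_const (F.p t)).prodMk hasFDerivAt_snd

lemma hasFDerivWithinAt_R {y : W × ℝ} (hy : y ∈ F.dom) :
    HasFDerivWithinAt F.R (F.R1 y) F.dom y :=
  ((F.contDiffOn_R.differentiableOn (by norm_num)) y hy).hasFDerivWithinAt

lemma contDiffOn_R1 : ContDiffOn ℝ 1 F.R1 F.dom :=
  F.contDiffOn_R.fderivWithin (F.uniqueDiffOn_strip W) (by norm_num)

lemma hasFDerivWithinAt_R1 {y : W × ℝ} (hy : y ∈ F.dom) :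
    HasFDerivWithinAt F.R1 (F.R2 y) F.dom y :=
  ((F.contDiffOn_R1.differentiableOn (by norm_num)) y hy).hasFDerivWithinAt

lemma continuousOn_R2 : ContinuousOn F.R2 F.dom :=
  F.contDiffOn_R1.continuousOn_fderivWithin (F.uniqueDiffOn_strip W) (by norm_num)

lemma hasFDerivWithinAt_val (t : ℝ) {z : V × ℝ} (hz : z.2 ∈ Icc F.a F.b) :
    HasFDerivWithinAt (F.val t) (F.P t z) (univ ×ˢ Icc F.a F.b) z := by
  have h1 : HasFDerivWithinAt (fun z => F.R (F.arg t z)) ((F.R1 (F.arg t z)).comp F.J)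
      (univ ×ˢ Icc F.a F.b) z :=
    (F.hasFDerivWithinAt_R (F.arg_mem hz)).comp z (F.hasFDerivAt_arg t z).hasFDerivWithinAt
      fun y hy => F.arg_mem hy.2
  have h2 := ((h1.add hasFDerivWithinAt_snd).sub
    ((F.l t).hasFDerivAt.comp_hasFDerivWithinAt z hasFDerivWithinAt_fst)).sub_const (F.c t)
  exact h2

lemma hasFDerivAt_val_left (t : ℝ) {v : V} {σ : ℝ} (hσ : σ ∈ Icc F.a F.b) :
    HasFDerivAt (fun v' => F.val t (v', σ)) ((F.P t (v, σ)).comp (.inl ℝ V ℝ)) v := by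
  have h1 : HasFDerivAt (fun v' : V => (v', σ)) (.inl ℝ V ℝ) v := hasFDerivAt_prodMk_left v σ
  have hm : MapsTo (fun v' : V => (v', σ)) univ (univ ×ˢ Icc F.a F.b) :=
    fun _ _ => ⟨mem_univ _, hσ⟩
  have h2 := (F.hasFDerivWithinAt_val t (z := (v, σ)) hσ).comp v
    (h1.hasFDerivWithinAt (s := univ)) hm
  exact hasFDerivWithinAt_univ.1 h2

lemma hasDerivWithinAt_val_right (t : ℝ) {v : V} {σ : ℝ} (hσ : σ ∈ Icc F.a F.b) :
    HasDerivWithinAt (fun s => F.val t (v, s)) (F.P t (v, σ) (0, 1)) (Icc F.a F.b) σ := by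
  have h1 : HasDerivWithinAt (fun s : ℝ => (v, s)) ((0 : V), (1 : ℝ)) (Icc F.a F.b) σ :=
    (hasDerivWithinAt_const _ _ _).prodMk (hasDerivWithinAt_id _ _)
  have hm : MapsTo (fun s : ℝ => (v, s)) (Icc F.a F.b) (univ ×ˢ Icc F.a F.b) :=
    fun s hs => ⟨mem_univ _, hs⟩
  exact (F.hasFDerivWithinAt_val t (z := (v, σ)) hσ).comp_hasDerivWithinAt σ h1 hm

lemma fderivWithin_val (t : ℝ) {z : V × ℝ} (hz : z.2 ∈ Icc F.a F.b) :
    fderivWithin ℝ (F.val t) (univ ×ˢ Icc F.a F.b) z = F.P t z :=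
  (F.hasFDerivWithinAt_val t hz).fderivWithin (F.uniqueDiffOn_strip V z ⟨mem_univ _, hz⟩)

/-- The loads are affine and `arg` is affine with linear part `J`, so only the second derivative of
the density survives. -/
lemma fderivWithin_fderivWithin_val (t : ℝ) {z : V × ℝ} (hz : z.2 ∈ Icc F.a F.b) (x y : V × ℝ) :
    fderivWithin ℝ (fun z' => fderivWithin ℝ (F.val t) (univ ×ˢ Icc F.a F.b) z')
      (univ ×ˢ Icc F.a F.b) z x y = F.R2 (F.arg t z) (F.J x) (F.J y) := by
  have hz' : z ∈ (univ : Set V) ×ˢ Icc F.a F.b := ⟨mem_univ _, hz⟩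
  have h1 : HasFDerivWithinAt (fun z => F.R1 (F.arg t z)) ((F.R2 (F.arg t z)).comp F.J)
      (univ ×ˢ Icc F.a F.b) z :=
    (F.hasFDerivWithinAt_R1 (F.arg_mem hz)).comp z (F.hasFDerivAt_arg t z).hasFDerivWithinAt
      fun y hy => F.arg_mem hy.2
  have h2 := (((ContinuousLinearMap.compL ℝ (V × ℝ) (W × ℝ) ℝ).flip
    F.J).hasFDerivAt.comp_hasFDerivWithinAt z h1).add_const
      (ContinuousLinearMap.snd ℝ V ℝ - (F.l t).comp (ContinuousLinearMap.fst ℝ V ℝ))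
  have h3 : HasFDerivWithinAt (fun z' => fderivWithin ℝ (F.val t) (univ ×ˢ Icc F.a F.b) z') _
      (univ ×ˢ Icc F.a F.b) z := h2.congr (fun y hy => by
        rw [F.fderivWithin_val t hy.2, P, add_sub_assoc]; rfl) (by
        rw [F.fderivWithin_val t hz, P, add_sub_assoc]; rfl)
  rw [h3.fderivWithin (F.uniqueDiffOn_strip V z hz')]
  rfl

lemma exists_R1_sub_le {y₀ : W × ℝ} (hy₀ : y₀ ∈ F.dom) {κ : ℝ} (hκ : 0 < κ) :
    ∃ δ > 0, ∀ x ∈ F.dom ∩ Metric.ball y₀ δ, ∀ y ∈ F.dom ∩ Metric.ball y₀ δ,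
      ‖F.R1 x - F.R1 y - F.R2 y₀ (x - y)‖ ≤ κ * ‖x - y‖ :=
  exists_norm_sub_sub_le (convex_univ.prod (convex_Icc _ _)) (fun _ hx => F.hasFDerivWithinAt_R1 hx)
    F.continuousOn_R2 hy₀ hκ

/-- Plain products carry the sup norm, while gradients need the Hilbert norm of `WithLp 2`. Passing
from the latter to the former, with E an isometry, does not increase norms. -/
lemma norm_J (x : WithLp 2 (V × ℝ)) : ‖F.J x.ofLp‖ ≤ ‖x‖ := by
  have h := WithLp.prod_norm_sq_eq_of_L2 x
  have e : ‖F.J x.ofLp‖ = max ‖x.fst‖ ‖x.snd‖ := by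
    rw [← F.norm_E]; rfl
  rw [e]
  refine max_le ?_ ?_ <;> refine le_of_sq_le_sq ?_ (norm_nonneg _) <;> rw [h]
  · linarith [sq_nonneg ‖x.snd‖]
  · linarith [sq_nonneg ‖x.fst‖]

lemma norm_le_of_inner_le {X : Type*} [NormedAddCommGroup X] [InnerProductSpace ℝ X] {x : X} {C : ℝ}
    (hC : 0 ≤ C) (h : inner ℝ x x ≤ C * ‖x‖) : ‖x‖ ≤ C := by
  rcases (norm_nonneg x).eq_or_lt with h0 | h0
  · rwa [← h0]
  · rw [real_inner_self_eq_norm_sq] at h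
    nlinarith

section Hilbert

variable [CompleteSpace V]

/-- The gradient of the energy, in the Hilbert norm of the product. -/
noncomputable def N (t : ℝ) (x : WithLp 2 (V × ℝ)) : WithLp 2 (V × ℝ) :=
  (InnerProductSpace.toDual ℝ (WithLp 2 (V × ℝ))).symm
    ((F.P t x.ofLp).comp (WithLp.prodContinuousLinearEquiv 2 ℝ V ℝ : WithLp 2 (V × ℝ) →L[ℝ] V × ℝ))

lemma inner_N (t : ℝ) (x y : WithLp 2 (V × ℝ)) : inner ℝ (F.N t x) y = F.P t x.ofLp y.ofLp := by
  rw [N, InnerProductSpace.toDual_symm_apply]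
  rfl

/-- Near a nondegenerate critical point the gradient is strongly monotone. -/
theorem exists_monoFamily {t₀ : ℝ} (ht₀ : t₀ ∈ Ico 0 F.T) {x₀ : WithLp 2 (V × ℝ)}
    (hx₀ : x₀.snd ∈ Icc F.a F.b) (h0 : F.N t₀ x₀ = 0) {α : ℝ} (hα : 0 < α)
    (hpos : ∀ x : WithLp 2 (V × ℝ),
      α * ‖x‖ ^ 2 ≤ F.R2 (F.arg t₀ x₀.ofLp) (F.J x.ofLp) (F.J x.ofLp)) {r : ℝ} (hr : 0 < r) :
    ∃ ρ T' m L M, ρ ≤ r ∧ T' ∈ Ioc t₀ F.T ∧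
      MonoFamily {x : WithLp 2 (V × ℝ) | x.snd ∈ Icc F.a F.b} F.N x₀ t₀ T' ρ m L M := by
  set y₀ := F.arg t₀ x₀.ofLp with hy₀
  -- Within δ of y₀ the derivative of the density deviates from its linearization by at most α/2
  -- times the increment, which leaves α/2 of the positivity.
  obtain ⟨δ, hδ, hR⟩ := F.exists_R1_sub_le (F.arg_mem hx₀ : y₀ ∈ F.dom) (half_pos hα)
  set K := ‖F.R2 y₀‖ + α / 2 with hK
  have hK0 : 0 ≤ K := by positivity
  have hRlip : ∀ x ∈ F.dom ∩ Metric.ball y₀ δ, ∀ y ∈ F.dom ∩ Metric.ball y₀ δ,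
      ‖F.R1 x - F.R1 y‖ ≤ K * ‖x - y‖ := by
    intro x hx y hy
    have e : F.R1 x - F.R1 y = F.R2 y₀ (x - y) + (F.R1 x - F.R1 y - F.R2 y₀ (x - y)) := by abel
    rw [e, hK, add_mul]
    exact (norm_add_le _ _).trans (add_le_add ((F.R2 y₀).le_opNorm _) (hR x hx y hy))
  set ρ := min r (δ / 2) with hρ
  have hρ0 : 0 < ρ := lt_min hr (half_pos hδ)
  set L := K * F.Lp + F.Ll with hL
  have hL0 : 0 ≤ L := add_nonneg (mul_nonneg hK0 F.Lp_nonneg) F.Ll_nonneg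
  -- Three demands: not to pass the final time, to move the load by at most δ/4, so that with ρ ≤
  -- δ/2 the arguments stay within δ of y₀, and to satisfy `small` with m = α/2. Adding 1 avoids
  -- zero denominators.
  set s := min (F.T - t₀) (min (δ / (4 * (F.Lp + 1))) (α / 2 * ρ / (2 * (L + 1)))) with hs
  have hLp1 : 0 < F.Lp + 1 := by linarith [F.Lp_nonneg]
  have hs0 : 0 < s := lt_min (sub_pos.2 ht₀.2) (lt_min (by positivity) (by positivity))
  have hTs : t₀ + s ≤ F.T := by
    have : s ≤ F.T - t₀ := min_le_left _ _
    linarith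
  have hsδ : (F.Lp + 1) * s ≤ δ / 4 := by
    have h1 : s ≤ δ / (4 * (F.Lp + 1)) := (min_le_right _ _).trans (min_le_left _ _)
    rw [le_div_iff₀ (by positivity)] at h1
    linarith
  have hsL : 2 * (L + 1) * s ≤ α / 2 * ρ := by
    have h1 : s ≤ α / 2 * ρ / (2 * (L + 1)) := (min_le_right _ _).trans (min_le_right _ _)
    rw [le_div_iff₀ (by positivity)] at h1
    linarith
  have hT0 : ∀ t ∈ Icc t₀ (t₀ + s), t ∈ Icc 0 F.T := fun t ht =>
    ⟨ht₀.1.trans ht.1, ht.2.trans hTs⟩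
  have harg : ∀ (t : ℝ) (x y : WithLp 2 (V × ℝ)), F.arg t x.ofLp - F.arg t y.ofLp
      = F.J (x - y).ofLp := by
    intro t x y
    refine Prod.ext ?_ rfl
    change F.E x.fst + F.p t - (F.E y.fst + F.p t) = F.E (x.fst - y.fst)
    rw [map_sub]; abel
  have hargt : ∀ (t t' : ℝ) (x : WithLp 2 (V × ℝ)), F.arg t x.ofLp - F.arg t' x.ofLp
      = (F.p t - F.p t', 0) := by
    intro t t' x
    refine Prod.ext ?_ (sub_self _)
    change F.E x.fst + F.p t - (F.E x.fst + F.p t') = F.p t - F.p t'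
    abel
  have hnargt : ∀ t ∈ Icc 0 F.T, ∀ t' ∈ Icc 0 F.T, ∀ x : WithLp 2 (V × ℝ),
      ‖F.arg t x.ofLp - F.arg t' x.ofLp‖ ≤ F.Lp * |t - t'| := by
    intro t ht t' ht' x
    rw [hargt, Prod.norm_mk, norm_zero, max_eq_left (norm_nonneg _)]
    exact F.p_lip t' ht' t ht
  have hmem : ∀ t ∈ Icc t₀ (t₀ + s), ∀ x ∈ {x : WithLp 2 (V × ℝ) | x.snd ∈ Icc F.a F.b} ∩
      Metric.closedBall x₀ ρ, F.arg t x.ofLp ∈ F.dom ∩ Metric.ball y₀ δ := by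
    intro t ht x hx
    refine ⟨F.arg_mem hx.1, ?_⟩
    rw [Metric.mem_ball, dist_eq_norm]
    have e : F.arg t x.ofLp - y₀ = (F.arg t x.ofLp - F.arg t x₀.ofLp) +
      (F.arg t x₀.ofLp - F.arg t₀ x₀.ofLp) := by rw [hy₀]; abel
    have h1 := F.norm_J (x - x₀)
    have h2 := hnargt t (hT0 t ht) t₀ (Ico_subset_Icc_self ht₀) x₀
    have h3 : ‖x - x₀‖ ≤ δ / 2 := by
      have := hx.2
      rw [Metric.mem_closedBall, dist_eq_norm] at this
      exact this.trans (min_le_right _ _)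
    have h4 : F.Lp * |t - t₀| ≤ F.Lp * s := by
      rw [abs_of_nonneg (by linarith [ht.1])]
      exact mul_le_mul_of_nonneg_left (by linarith [ht.2]) F.Lp_nonneg
    rw [e, harg]
    refine (norm_add_le _ _).trans_lt ?_
    linarith
  have hNdiff : ∀ (t : ℝ) (x y d : WithLp 2 (V × ℝ)), inner ℝ (F.N t x - F.N t y) d
      = (F.R1 (F.arg t x.ofLp) - F.R1 (F.arg t y.ofLp)) (F.J d.ofLp) := by
    intro t x y d
    rw [inner_sub_left, inner_N, inner_N]
    simp only [P, _root_.sub_apply, _root_.add_apply,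
      ContinuousLinearMap.comp_apply]
    ring
  -- The maximum only serves to have m ≤ M.
  refine ⟨ρ, t₀ + s, α / 2, L, max (α / 2) K, min_le_left _ _, ⟨by linarith, hTs⟩, ?_⟩
  constructor
  · exact hρ0
  · exact half_pos hα
  · exact hL0
  · exact le_max_left _ _
  · rw [add_sub_cancel_left]
    linarith
  · exact hx₀
  · exact h0
  · intro t ht x hx y hy
    rw [hNdiff, ← harg t]
    have h1 := hR _ (hmem t ht x hx) _ (hmem t ht y hy)
    have h2 := hpos (x - y)
    rw [← harg t] at h2
    set ζ := F.arg t x.ofLp - F.arg t y.ofLp with hζ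
    have h3 : ‖ζ‖ ≤ ‖x - y‖ := by rw [hζ, harg]; exact F.norm_J _
    have h4 := (abs_le.1 ((F.R1 (F.arg t x.ofLp) - F.R1 (F.arg t y.ofLp) - F.R2 y₀ ζ).le_of_opNorm_le
      h1 ζ)).1
    have h5 : α / 2 * ‖ζ‖ * ‖ζ‖ ≤ α / 2 * ‖x - y‖ ^ 2 := by
      rw [mul_assoc, ← sq]
      gcongr
    rw [_root_.sub_apply _ (F.R2 y₀ ζ)] at h4
    linarith
  · intro t ht x hx y hy
    refine norm_le_of_inner_le (by positivity) ?_
    rw [hNdiff]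
    refine (le_abs_self _).trans (((F.R1 (F.arg t x.ofLp) - F.R1 (F.arg t y.ofLp)).le_opNorm _).trans ?_)
    refine mul_le_mul ?_ (F.norm_J _) (norm_nonneg _) (by positivity)
    refine (hRlip _ (hmem t ht x hx) _ (hmem t ht y hy)).trans ?_
    rw [harg]
    exact mul_le_mul (le_max_right _ _) (F.norm_J _) (norm_nonneg _) (by positivity)
  · intro t ht t' ht' x hx
    refine norm_le_of_inner_le (mul_nonneg hL0 (abs_nonneg _)) ?_
    generalize hd : F.N t' x - F.N t x = d
    have e : inner ℝ d d = (F.R1 (F.arg t' x.ofLp) - F.R1 (F.arg t x.ofLp)) (F.J d.ofLp)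
        - (F.l t' - F.l t) d.ofLp.1 := by
      nth_rewrite 1 [← hd]
      rw [inner_sub_left, inner_N, inner_N]
      simp only [P, _root_.sub_apply, _root_.add_apply,
        ContinuousLinearMap.comp_apply, ContinuousLinearMap.coe_fst']
      ring
    have h1 := (F.R1 (F.arg t' x.ofLp) - F.R1 (F.arg t x.ofLp)).le_of_opNorm_le
      ((hRlip _ (hmem t' ht' x hx) _ (hmem t ht x hx)).trans
        (mul_le_mul_of_nonneg_left (hnargt t' (hT0 t' ht') t (hT0 t ht) x) hK0)) (F.J d.ofLp)
    have h2 := (F.l t' - F.l t).le_of_opNorm_le (F.l_lip t (hT0 t ht) t' (hT0 t' ht')) d.ofLp.1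
    have h3 : K * (F.Lp * |t' - t|) * ‖F.J d.ofLp‖ ≤ K * (F.Lp * |t' - t|) * ‖d‖ :=
      mul_le_mul_of_nonneg_left (F.norm_J d)
        (mul_nonneg hK0 (mul_nonneg F.Lp_nonneg (abs_nonneg _)))
    have h4 : F.Ll * |t' - t| * ‖d.ofLp.1‖ ≤ F.Ll * |t' - t| * ‖d‖ :=
      mul_le_mul_of_nonneg_left (WithLp.norm_fst_le _ d) (mul_nonneg F.Ll_nonneg (abs_nonneg _))
    have h5 := (abs_le.1 h2).1
    have h6 := (abs_le.1 h1).2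
    rw [e, hL]
    linarith

end Hilbert

end LoadedEnergy

/-! ### The crack energy as a loaded energy -/

lemma IsW1Infty.exists_lipschitz {X : Type*} [NormedAddCommGroup X] [NormedSpace ℝ X] {T : ℝ}
    {f : ℝ → X} (hf : IsW1Infty T f) :
    ∃ L, 0 ≤ L ∧ ∀ s ∈ Icc 0 T, ∀ t ∈ Icc 0 T, ‖f t - f s‖ ≤ L * |t - s| := by
  obtain ⟨f', hf', h⟩ := hf
  have hint : IntegrableOn f' (Icc 0 T) := hf'.integrable (by simp)
  have hii : ∀ t ∈ Icc 0 T, IntervalIntegrable f' volume 0 t := fun t ht =>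
    (intervalIntegrable_iff_integrableOn_Icc_of_le ht.1).2 (hint.mono_set (Icc_subset_Icc_right ht.2))
  refine ⟨(eLpNormEssSup f' (volume.restrict (Icc 0 T))).toReal, ENNReal.toReal_nonneg,
    fun s hs t ht => ?_⟩
  have e : f t - f s = ∫ u in s..t, f' u := by
    rw [h t ht, h s hs, add_sub_add_left_eq_sub,
      intervalIntegral.integral_interval_sub_left (hii t ht) (hii s hs)]
  rw [e]
  refine intervalIntegral.norm_integral_le_of_norm_le_const_ae ?_
  have htop : eLpNormEssSup f' (volume.restrict (Icc 0 T)) ≠ ⊤ := by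
    have := hf'.2
    rw [eLpNorm_exponent_top] at this
    exact this.ne
  have h1 := ae_le_eLpNormEssSup (f := f') (μ := volume.restrict (Icc 0 T))
  rw [ae_restrict_iff' measurableSet_Icc] at h1
  filter_upwards [h1] with u hu hmem
  have hu' : u ∈ Icc 0 T := by
    rw [uIoc] at hmem
    exact ⟨(le_min hs.1 ht.1).trans hmem.1.le, hmem.2.trans (max_le hs.2 ht.2)⟩
  have := ENNReal.toReal_mono htop (hu hu')
  simpa using this

lemma norm_extend_le {K : Set Plane} (a : BoundedContinuousFunction K ℝ) (x : Plane) :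
    ‖Function.extend Subtype.val a (0 : Plane → ℝ) x‖ ≤ ‖a‖ := by
  by_cases hx : ∃ y : K, (y : Plane) = x
  · obtain ⟨y, rfl⟩ := hx
    rw [Subtype.val_injective.extend_apply]
    exact a.norm_coe_le_norm _
  · simp [Function.extend_apply' _ _ _ hx]

lemma memLp_extend {K : Set Plane} (hK : MeasurableSet K) (μ : Measure Plane)
    (a : BoundedContinuousFunction K ℝ) :
    MemLp (Function.extend Subtype.val a (0 : Plane → ℝ)) ⊤ μ :=
  memLp_top_of_bound (((MeasurableEmbedding.subtype_coe hK).measurable_extend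
    a.continuous.measurable measurable_zero).aestronglyMeasurable) ‖a‖
    (Eventually.of_forall (norm_extend_le a))

/-- The extension by zero of a bounded continuous function, as a bounded measurable function. -/
noncomputable def boundedToLp {K : Set Plane} (hK : MeasurableSet K) (μ : Measure Plane)
    [IsFiniteMeasure μ] : BoundedContinuousFunction K ℝ →L[ℝ] Lp ℝ ⊤ μ :=
  LinearMap.mkContinuous
    { toFun := fun a => (memLp_extend hK μ a).toLp
      map_add' := fun a b => by
        rw [← MemLp.toLp_add]
        congr 1
        ext x
        by_cases hx : ∃ y : K, (y : Plane) = x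
        · obtain ⟨y, rfl⟩ := hx
          simp
        · simp [Function.extend_apply' _ _ _ hx]
      map_smul' := fun c a => by
        rw [RingHom.id_apply, ← MemLp.toLp_const_smul]
        congr 1
        ext x
        by_cases hx : ∃ y : K, (y : Plane) = x
        · obtain ⟨y, rfl⟩ := hx
          simp
        · simp [Function.extend_apply' _ _ _ hx] } 1 fun a => by
    rw [one_mul]
    refine (Lp.norm_le_of_ae_bound (C := ‖a‖) (norm_nonneg _) ?_).trans (by simp)
    refine (memLp_extend hK μ a).coeFn_toLp.mono fun x hx => ?_
    simp only [LinearMap.coe_mk, AddHom.coe_mk]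
    rw [hx]
    exact norm_extend_le a x

lemma boundedToLp_ae {K : Set Plane} (hK : MeasurableSet K) (μ : Measure Plane)
    [IsFiniteMeasure μ] (a : BoundedContinuousFunction K ℝ) :
    ∀ᵐ x ∂μ, ∀ hx : x ∈ K, boundedToLp hK μ a x = a ⟨x, hx⟩ := by
  have h : boundedToLp hK μ a =ᵐ[μ] Function.extend Subtype.val a (0 : Plane → ℝ) :=
    (memLp_extend hK μ a).coeFn_toLp
  filter_upwards [h] with x hx hxK
  rw [hx]
  exact Subtype.val_injective.extend_apply a (0 : Plane → ℝ) (⟨x, hxK⟩ : K)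

/-- The bilinear map `(s, ξ) ↦ s ξᵢ`. -/
noncomputable def coordMul (i : Fin 2) : ℝ →L[ℝ] Plane →L[ℝ] ℝ :=
  (ContinuousLinearMap.mul ℝ ℝ).bilinearComp (.id ℝ ℝ) (EuclideanSpace.proj i)

/-- The form `(ξ, η) ↦ ∫ a ξⱼ ηᵢ`, depending linearly on the bounded function `a`. -/
noncomputable def coeffForm (μ : Measure Plane) (i j : Fin 2) (a : Lp ℝ ⊤ μ) :
    Lp Plane 2 μ →L[ℝ] Lp Plane 2 μ →L[ℝ] ℝ :=
  ((coordMul i).lpPairing μ 2 2).comp ((coordMul j).holderL μ ⊤ 2 2 a)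

lemma coeffForm_apply (μ : Measure Plane) (i j : Fin 2) (a : Lp ℝ ⊤ μ) (ξ η : Lp Plane 2 μ) :
    coeffForm μ i j a ξ η = ∫ x, a x * ξ x j * η x i ∂μ := by
  rw [coeffForm, ContinuousLinearMap.comp_apply, ContinuousLinearMap.lpPairing_eq_integral]
  refine integral_congr_ae ?_
  filter_upwards [(coordMul j).coeFn_holder (r := 2) a ξ] with x hx
  rw [ContinuousLinearMap.holderL_apply_apply, hx]
  rfl

lemma integrable_coeff {μ : Measure Plane} (i j : Fin 2) (a : Lp ℝ ⊤ μ) (ξ η : Lp Plane 2 μ) :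
    Integrable (fun x => a x * ξ x j * η x i) μ := by
  have h1 : MemLp (fun x => a x * ξ x j) 2 μ :=
    ((Lp.memLp ξ).continuousLinearMap_comp (EuclideanSpace.proj (𝕜 := ℝ) j)).mul (Lp.memLp a)
  exact h1.integrable_mul (q := 2)
    ((Lp.memLp η).continuousLinearMap_comp (EuclideanSpace.proj (𝕜 := ℝ) i))

lemma contDiffOn_coeffForm {μ : Measure Plane} (i j : Fin 2) {a : ℝ → Lp ℝ ⊤ μ} {s : Set ℝ}
    (ha : ContDiffOn ℝ 2 a s) : ContDiffOn ℝ 2 (fun σ => coeffForm μ i j (a σ)) s :=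
  contDiffOn_const.clm_comp
    (((coordMul j).holderL μ ⊤ 2 2).contDiff.comp_contDiffOn ha)

/-- The restriction of square integrable fields to a smaller set. -/
noncomputable def restrictLp {U A : Set Plane} (h : A ⊆ U) (f : Lp Plane 2 (volume.restrict U)) :
    Lp Plane 2 (volume.restrict A) :=
  ((Lp.memLp f).mono_measure (Measure.restrict_mono h le_rfl)).toLp

lemma restrictLp_ae {U A : Set Plane} (h : A ⊆ U) (f : Lp Plane 2 (volume.restrict U)) :
    restrictLp h f =ᵐ[volume.restrict A] f :=
  MemLp.coeFn_toLp _

lemma norm_restrictLp_sub_le {U A : Set Plane} (h : A ⊆ U) (f g : Lp Plane 2 (volume.restrict U)) :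
    ‖restrictLp h f - restrictLp h g‖ ≤ ‖f - g‖ := by
  have hm : volume.restrict A ≤ volume.restrict U := Measure.restrict_mono h le_rfl
  rw [Lp.norm_def, Lp.norm_def]
  refine ENNReal.toReal_mono (Lp.eLpNorm_ne_top _) ?_
  refine le_trans (le_of_eq (eLpNorm_congr_ae ?_)) (eLpNorm_mono_measure _ hm)
  filter_upwards [Lp.coeFn_sub (restrictLp h f) (restrictLp h g), restrictLp_ae h f,
    restrictLp_ae h g, ae_mono hm (Lp.coeFn_sub f g)] with x h1 h2 h3 h4
  rw [h1, h4, Pi.sub_apply, Pi.sub_apply, h2, h3]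

lemma ae_add_restrictLp {U A : Set Plane} (h : A ⊆ U) (f : Lp Plane 2 (volume.restrict A))
    (g : Lp Plane 2 (volume.restrict U)) (φ : Plane → Plane → ℝ) :
    (fun y => φ y (f y + g y)) =ᵐ[volume.restrict A] fun y => φ y ((f + restrictLp h g) y) := by
  filter_upwards [Lp.coeFn_add f (restrictLp h g), restrictLp_ae h g] with y e1 e2
  rw [e1, Pi.add_apply, e2]

namespace CrackData

variable {G : CrackGeometry} (D : CrackData G)

lemma cracked_subset : G.cracked ⊆ G.Ω := sdiff_subset

instance : IsFiniteMeasure (volume.restrict G.cracked) :=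
  ⟨by
    rw [Measure.restrict_apply_univ]
    exact (G.isBounded_Ω.subset cracked_subset).measure_lt_top⟩

/-- The quadratic part of the energy, as a function of the crack length. -/
lemma exists_quadForm : ∃ Q : ℝ → Lp Plane 2 (volume.restrict G.cracked) →L[ℝ]
      Lp Plane 2 (volume.restrict G.cracked) →L[ℝ] ℝ,
    ContDiffOn ℝ 2 Q (Icc G.σ₀ G.σbar) ∧ ∀ σ ∈ Icc G.σ₀ G.σbar, ∀ ξ,
      Q σ ξ ξ = ∫ y in G.cracked, ∑ i, ∑ j, pullbackCoeff (D.Ψ σ) y i j * ξ y j * ξ y i := by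
  choose a ha ha' using D.coeff_C2
  have hK : MeasurableSet (closure G.Ω) := isClosed_closure.measurableSet
  set μ := volume.restrict G.cracked with hμ
  -- As elements of L^∞ the coefficients enter through a bounded linear map, so the form inherits
  -- their C² dependence on σ.
  refine ⟨fun σ => ∑ i, ∑ j, coeffForm μ i j (boundedToLp hK μ (a i j σ)), ?_, ?_⟩
  · refine ContDiffOn.sum fun i _ => ContDiffOn.sum fun j _ => contDiffOn_coeffForm i j ?_
    exact (boundedToLp hK μ).contDiff.comp_contDiffOn (ha i j)
  · intro σ hσ ξ
    simp only [_root_.sum_apply, coeffForm_apply]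
    simp_rw [← integral_finsetSum _ fun j _ => integrable_coeff _ j _ ξ ξ]
    rw [← integral_finsetSum _ fun i _ => integrable_finsetSum _ fun j _ => integrable_coeff i j _ ξ ξ]
    refine integral_congr_ae ?_
    have h : ∀ᵐ y ∂μ, ∀ i j, ∀ hy : y ∈ closure G.Ω,
        boundedToLp hK μ (a i j σ) y = a i j σ ⟨y, hy⟩ :=
      ae_all_iff.2 fun i => ae_all_iff.2 fun j => boundedToLp_ae hK μ _
    filter_upwards [h, ae_restrict_mem G.isOpen_cracked.measurableSet] with y hy hyc
    refine Finset.sum_congr rfl fun i _ => Finset.sum_congr rfl fun j _ => ?_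
    rw [hy i j (subset_closure hyc.1), ha' i j σ hσ]

/-- The gradient, as an isometry. -/
noncomputable def gradL (G : CrackGeometry) : G.V →L[ℝ] Lp Plane 2 (volume.restrict G.cracked) :=
  LinearIsometry.toContinuousLinearMap ⟨G.grad, fun _ => rfl⟩

/-- The bulk term sees v only through the isometry v ↦ Dv. The trace operator makes the boundary
load a bounded functional of v, and the work done on ψ(t) is the constant c(t). The W^{1,∞} loads
are Lipschitz in time. -/
lemma exists_loadedEnergy : ∃ F : LoadedEnergy G.V (Lp Plane 2 (volume.restrict G.cracked)),
    F.a = G.σ₀ ∧ F.b = G.σbar ∧ F.T = D.T ∧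
      ∀ t v, ∀ σ ∈ Icc G.σ₀ G.σbar, D.energy t v σ = F.val t (v, σ) := by
  obtain ⟨Q, hQ, hQ'⟩ := D.exists_quadForm
  obtain ⟨τ, hτ⟩ := G.exists_trace
  obtain ⟨τΩ, hτΩ⟩ := G.exists_trace_Ω
  obtain ⟨L, hL0, hL⟩ := D.ψ_W1Infty.exists_lipschitz
  obtain ⟨M, hM0, hM⟩ := D.g_W1Infty.exists_lipschitz
  refine ⟨{ a := G.σ₀
            b := G.σbar
            a_lt_b := G.σ₀_lt_σ₁.trans G.σ₁_lt_σbar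
            T := D.T
            R := fun y => Q y.2 y.1 y.1
            contDiffOn_R := ?_
            E := gradL G
            norm_E := fun _ => rfl
            p := fun t => restrictLp cracked_subset (D.ψ t).1.snd
            Lp := L
            Lp_nonneg := hL0
            p_lip := ?_
            l := fun t => (innerSL ℝ (D.g t)).comp τ
            Ll := M * ‖τ‖
            Ll_nonneg := by positivity
            l_lip := ?_
            c := fun t => inner ℝ (D.g t) (τΩ (D.ψ t)) }, rfl, rfl, rfl, ?_⟩
  · have h1 : ContDiffOn ℝ 2 (fun y : Lp Plane 2 (volume.restrict G.cracked) × ℝ => Q y.2)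
        (univ ×ˢ Icc G.σ₀ G.σbar) := hQ.comp contDiff_snd.contDiffOn fun y hy => hy.2
    exact (h1.clm_apply contDiff_fst.contDiffOn).clm_apply contDiff_fst.contDiffOn
  · intro s hs t ht
    refine (norm_restrictLp_sub_le _ _ _).trans (le_trans ?_ (hL s hs t ht))
    exact WithLp.norm_snd_le _ (D.ψ t - D.ψ s).1
  · intro s hs t ht
    rw [← ContinuousLinearMap.sub_comp, ← map_sub]
    refine (ContinuousLinearMap.opNorm_comp_le _ _).trans ?_
    rw [innerSL_apply_norm, mul_right_comm]
    exact mul_le_mul_of_nonneg_right (hM s hs t ht) (norm_nonneg _)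
  · intro t v σ hσ
    have h1 : ∫ x in G.neumann, D.g t x *
        (traceFn G.cracked v.1.1.fst x + traceFn G.Ω (D.ψ t).1.fst x) ∂(μH[1] : Measure Plane)
        = inner ℝ (D.g t) (τ v) + inner ℝ (D.g t) (τΩ (D.ψ t)) := by
      rw [← inner_add_right, L2.inner_def]
      refine integral_congr_ae ?_
      filter_upwards [hτ v, hτΩ (D.ψ t), Lp.coeFn_add (τ v) (τΩ (D.ψ t))] with x e1 e2 e3
      rw [e3, Pi.add_apply, e1, e2]
      simp [mul_comm]
    have h2 : ∫ y in G.cracked, ∑ i, ∑ j, pullbackCoeff (D.Ψ σ) y i j *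
        (G.grad v y j + (D.ψ t).1.snd y j) * (G.grad v y i + (D.ψ t).1.snd y i)
        = Q σ (gradL G v + restrictLp cracked_subset (D.ψ t).1.snd)
          (gradL G v + restrictLp cracked_subset (D.ψ t).1.snd) := by
      rw [hQ' σ hσ]
      refine integral_congr_ae ?_
      exact ae_add_restrictLp cracked_subset (G.grad v) (D.ψ t).1.snd
        (fun y z => ∑ i, ∑ j, pullbackCoeff (D.Ψ σ) y i j * z j * z i)
    exact (congrArg₂ (fun a b : ℝ => a + σ - b) h2 h1).trans (sub_add_eq_sub_sub _ _ _)

section Derivatives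

variable {D} {F : LoadedEnergy G.V (Lp Plane 2 (volume.restrict G.cracked))}

lemma isGradV_iff (ha : F.a = G.σ₀) (hb : F.b = G.σbar)
    (hF : ∀ t v, ∀ σ ∈ Icc G.σ₀ G.σbar, D.energy t v σ = F.val t (v, σ))
    {t : ℝ} {v w : G.V} {σ : ℝ} (hσ : σ ∈ Icc G.σ₀ G.σbar) :
    D.IsGradV t v σ w ↔ ∀ u, F.P t (v, σ) (u, 0) = inner ℝ w u := by
  have h1 := F.hasFDerivAt_val_left t (v := v) (σ := σ) (by rwa [ha, hb])
  have h2 : (fun v' : G.V => D.energy t v' σ) = fun v' => F.val t (v', σ) :=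
    funext fun v' => hF t v' σ hσ
  rw [IsGradV, h2]
  constructor
  · intro h u
    have := DFunLike.congr_fun (h1.unique h) u
    simpa using this
  · intro h
    have e : innerSL ℝ w = (F.P t (v, σ)).comp (.inl ℝ G.V ℝ) := by
      ext u
      simpa using (h u).symm
    rw [e]
    exact h1

lemma dσ_eq (ha : F.a = G.σ₀) (hb : F.b = G.σbar)
    (hF : ∀ t v, ∀ σ ∈ Icc G.σ₀ G.σbar, D.energy t v σ = F.val t (v, σ))
    {t : ℝ} {v : G.V} {σ : ℝ} (hσ : σ ∈ Icc G.σ₀ G.σbar) :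
    D.dσ t v σ = F.P t (v, σ) (0, 1) := by
  have h1 := F.hasDerivWithinAt_val_right t (v := v) (σ := σ) (by rwa [ha, hb])
  rw [ha, hb] at h1
  rw [dσ, derivWithin_congr (fun s hs => hF t v s hs) (hF t v σ hσ)]
  exact h1.derivWithin (uniqueDiffOn_Icc (G.σ₀_lt_σ₁.trans G.σ₁_lt_σbar) σ hσ)

lemma hessian_eq (ha : F.a = G.σ₀) (hb : F.b = G.σbar)
    (hF : ∀ t v, ∀ σ ∈ Icc G.σ₀ G.σbar, D.energy t v σ = F.val t (v, σ))
    {t : ℝ} {v : G.V} {σ : ℝ} (hσ : σ ∈ Icc G.σ₀ G.σbar) (x y : G.V × ℝ) :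
    D.hessian t v σ x y = F.R2 (F.arg t (v, σ)) (F.J x) (F.J y) := by
  have h1 := F.fderivWithin_fderivWithin_val t (z := (v, σ)) (by rwa [ha, hb]) x y
  rw [ha, hb] at h1
  rw [← h1, hessian]
  have hc : ∀ p ∈ (univ : Set G.V) ×ˢ Icc G.σ₀ G.σbar, D.energy t p.1 p.2 = F.val t p :=
    fun p hp => hF t p.1 p.2 hp.2
  rw [fderivWithin_congr (fun p hp => fderivWithin_congr hc (hc p hp))
    (fderivWithin_congr hc (hc _ ⟨mem_univ _, hσ⟩))]

end Derivatives

end CrackData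

/-! ### Branches and flows as zeros and flows of the gradient field -/

namespace CrackData

variable {G : CrackGeometry} {D : CrackData G}
  {F : LoadedEnergy G.V (Lp Plane 2 (volume.restrict G.cracked))}

lemma cutoff_of_lt {σ : ℝ} (h : σ < G.σ₁) : cutoff G σ = 1 := by
  have := G.σ₁_lt_σbar
  rw [cutoff, max_eq_right h.le, max_eq_left (by linarith), div_self (by linarith)]

lemma N_eq (ha : F.a = G.σ₀) (hb : F.b = G.σbar)
    (hF : ∀ t v, ∀ σ ∈ Icc G.σ₀ G.σbar, D.energy t v σ = F.val t (v, σ))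
    {t : ℝ} {v w : G.V} {σ : ℝ} (hσ : σ ∈ Icc G.σ₀ G.σbar) (h : D.IsGradV t v σ w) :
    F.N t (WithLp.toLp 2 (v, σ)) = WithLp.toLp 2 (w, D.dσ t v σ) := by
  refine ext_inner_right ℝ fun y => ?_
  have h1 := (isGradV_iff ha hb hF hσ).1 h y.fst
  have h2 := dσ_eq ha hb hF (t := t) (v := v) hσ
  have e : y.ofLp = (y.fst, 0) + y.snd • ((0 : G.V), (1 : ℝ)) := by
    refine Prod.ext ?_ ?_
    · change y.fst = y.fst + y.snd • (0 : G.V)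
      rw [smul_zero, add_zero]
    · change y.snd = 0 + y.snd * 1
      ring
  rw [F.inner_N, e, map_add, map_smul, WithLp.prod_inner_apply]
  change F.P t (v, σ) (y.fst, 0) + y.snd * F.P t (v, σ) (0, 1)
    = inner ℝ w y.fst + inner ℝ (D.dσ t v σ) y.snd
  rw [h1, ← h2]
  rfl

lemma N_eq_zero_iff (ha : F.a = G.σ₀) (hb : F.b = G.σbar)
    (hF : ∀ t v, ∀ σ ∈ Icc G.σ₀ G.σbar, D.energy t v σ = F.val t (v, σ))
    {t : ℝ} {v : G.V} {σ : ℝ} (hσ : σ ∈ Icc G.σ₀ G.σbar) :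
    F.N t (WithLp.toLp 2 (v, σ)) = 0 ↔ D.IsGradV t v σ 0 ∧ D.dσ t v σ = 0 := by
  constructor
  · intro h
    have h1 : ∀ y : G.V × ℝ, F.P t (v, σ) y = 0 := fun y => by
      have := F.inner_N t (WithLp.toLp 2 (v, σ)) (WithLp.toLp 2 y)
      rw [h, inner_zero_left] at this
      exact this.symm
    refine ⟨(isGradV_iff ha hb hF hσ).2 fun u => ?_, ?_⟩
    · rw [h1, inner_zero_left]
    · rw [dσ_eq ha hb hF hσ, h1]
  · rintro ⟨h1, h2⟩
    rw [N_eq ha hb hF hσ h1, h2]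
    rfl

/-- Any choice of zeros in the ball is Lipschitz in time, by monotonicity, and starts from the only
zero at the initial time. -/
lemma isBranch_of_zeros (ha : F.a = G.σ₀) (hb : F.b = G.σbar)
    (hF : ∀ t v, ∀ σ ∈ Icc G.σ₀ G.σbar, D.energy t v σ = F.val t (v, σ))
    {t₀ t₁ T' ρ m L M s₀ : ℝ} {v₀ : G.V}
    (H : MonoFamily {x : WithLp 2 (G.V × ℝ) | x.snd ∈ Icc F.a F.b} F.N (WithLp.toLp 2 (v₀, s₀))
      t₀ T' ρ m L M) (h₀₁ : t₀ ≤ t₁) (ht₁ : t₁ ≤ T') {w : ℝ → WithLp 2 (G.V × ℝ)}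
    (hw : ∀ t ∈ Icc t₀ t₁, w t ∈ {x : WithLp 2 (G.V × ℝ) | x.snd ∈ Icc F.a F.b} ∩
      Metric.closedBall (WithLp.toLp 2 (v₀, s₀)) ρ ∧ F.N t (w t) = 0)
    {I : Set ℝ} (hI : ∀ t ∈ Icc t₀ t₁, (w t).snd ∈ I) :
    D.IsBranch t₀ t₁ I v₀ s₀ (fun t => (w t).fst) (fun t => (w t).snd) := by
  have hT : ∀ t ∈ Icc t₀ t₁, t ∈ Icc t₀ T' := fun t ht => ⟨ht.1, ht.2.trans ht₁⟩
  have hlip : ∀ s ∈ Icc t₀ t₁, ∀ t ∈ Icc t₀ t₁, ‖w s - w t‖ ≤ L / m * |t - s| := by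
    intro s hs t ht
    have := H.norm_sub_le_of_zero (hT s hs) (hT t ht) (hw s hs).1 (hw t ht).1 (hw s hs).2 (hw t ht).2
    rw [div_mul_eq_mul_div, le_div_iff₀ H.m_pos, mul_comm]
    exact this
  have hstart : w t₀ = WithLp.toLp 2 (v₀, s₀) := by
    have hl : t₀ ∈ Icc t₀ t₁ := left_mem_Icc.2 h₀₁
    have := H.norm_sub_le_of_zero (hT t₀ hl) (hT t₀ hl) (hw t₀ hl).1 H.mem_ball (hw t₀ hl).2 H.zero
    rw [sub_self, abs_zero, mul_zero] at this
    have h1 : ‖w t₀ - WithLp.toLp 2 (v₀, s₀)‖ ≤ 0 := by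
      by_contra hcon
      push Not at hcon
      linarith [mul_pos H.m_pos hcon]
    exact sub_eq_zero.1 (norm_le_zero_iff.1 h1)
  have hzero : ∀ t ∈ Icc t₀ t₁, D.IsGradV t (w t).fst (w t).snd 0 ∧ D.dσ t (w t).fst (w t).snd = 0 := by
    intro t ht
    have h1 := (hw t ht).1.1
    rw [mem_ofPred_eq, ha, hb] at h1
    exact (N_eq_zero_iff ha hb hF h1).1 (hw t ht).2
  refine ⟨⟨⟨L / m, div_nonneg H.L_nonneg H.m_pos.le⟩, ?_⟩, hI, fun t ht => (hzero t ht).1,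
    fun t ht => (hzero t ht).2, by rw [hstart]; rfl, by rw [hstart]; rfl⟩
  refine LipschitzOnWith.of_dist_le_mul fun s hs t ht => ?_
  rw [dist_comm s t, Real.dist_eq]
  refine le_trans ?_ (hlip s hs t ht)
  rw [dist_eq_norm]
  exact max_le (WithLp.norm_fst_le _ (w s - w t)) (WithLp.norm_snd_le _ (w s - w t))

lemma IsBranch.curve_mem (ha : F.a = G.σ₀) (hb : F.b = G.σbar)
    (hF : ∀ t v, ∀ σ ∈ Icc G.σ₀ G.σbar, D.energy t v σ = F.val t (v, σ))
    {t₀ t₁ T' ρ m L M s₀ : ℝ} {v₀ : G.V}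
    (H : MonoFamily {x : WithLp 2 (G.V × ℝ) | x.snd ∈ Icc F.a F.b} F.N (WithLp.toLp 2 (v₀, s₀))
      t₀ T' ρ m L M) (ht₁ : t₁ ≤ T') {v : ℝ → G.V} {σ : ℝ → ℝ}
    (h : D.IsBranch t₀ t₁ (Icc G.σ₀ G.σ₁) v₀ s₀ v σ) :
    ∀ t ∈ Icc t₀ t₁, WithLp.toLp 2 (v t, σ t) ∈
      {x : WithLp 2 (G.V × ℝ) | x.snd ∈ Icc F.a F.b} ∩ Metric.closedBall (WithLp.toLp 2 (v₀, s₀)) ρ ∧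
      F.N t (WithLp.toLp 2 (v t, σ t)) = 0 := by
  have hS : ∀ t ∈ Icc t₀ t₁, σ t ∈ Icc G.σ₀ G.σbar := fun t ht =>
    Icc_subset_Icc_right G.σ₁_lt_σbar.le (h.σ_mem t ht)
  have hz : ∀ t ∈ Icc t₀ t₁, F.N t (WithLp.toLp 2 (v t, σ t)) = 0 := fun t ht =>
    (N_eq_zero_iff ha hb hF (hS t ht)).2 ⟨h.gradV_eq_zero t ht, h.dσ_eq_zero t ht⟩
  obtain ⟨K, hK⟩ := h.lipschitz
  have hc : ContinuousOn (fun t => WithLp.toLp 2 (v t, σ t)) (Icc t₀ t₁) :=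
    (WithLp.prod_continuous_toLp 2 G.V ℝ).comp_continuousOn hK.continuousOn
  exact fun t ht => ⟨H.mem_ball_of_zero ht₁ hc (fun t ht => by
    change σ t ∈ Icc F.a F.b
    rw [ha, hb]
    exact hS t ht) hz (by rw [h.v_start, h.σ_start]) t ht, hz t ht⟩

/-- A positive derivative of σ forces −∂_σℱ > 0, so the positive part does nothing, and below σ₁ the
cut-off is 1: the modified flow is the true gradient flow at such times. -/
lemma IsFlow.hasDerivAt (ha : F.a = G.σ₀) (hb : F.b = G.σbar)
    (hF : ∀ t v, ∀ σ ∈ Icc G.σ₀ G.σbar, D.energy t v σ = F.val t (v, σ))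
    {u₀ : G.V} {ε : ℝ} (hε : 0 < ε) {v : ℝ → G.V} {σ : ℝ → ℝ} (h : D.IsFlow u₀ ε v σ) {t : ℝ}
    (ht : t ∈ Ioo 0 D.T) (hpos : 0 < derivWithin σ (Icc 0 D.T) t) (hlt : σ t < G.σ₁) :
    HasDerivAt (fun s => WithLp.toLp 2 (v s, σ s)) (-(ε⁻¹ • F.N t (WithLp.toLp 2 (v t, σ t)))) t := by
  have htI : t ∈ Icc 0 D.T := Ioo_subset_Icc_self ht
  have hn : Icc 0 D.T ∈ 𝓝 t := Icc_mem_nhds ht.1 ht.2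
  have hv : HasDerivAt v (derivWithin v (Icc 0 D.T) t) t :=
    ((h.contDiffOn_v.differentiableOn (by norm_num)) t htI).hasDerivWithinAt.hasDerivAt hn
  have hσ : HasDerivAt σ (derivWithin σ (Icc 0 D.T) t) t :=
    ((h.contDiffOn_σ.differentiableOn (by norm_num)) t htI).hasDerivWithinAt.hasDerivAt hn
  have h1 := h.σ_eq t htI
  rw [cutoff_of_lt hlt, mul_one] at h1
  have h2 : 0 < -D.dσ t (v t) (σ t) := by
    by_contra hcon
    rw [max_eq_right (not_lt.1 hcon)] at h1
    exact (mul_pos hε hpos).ne' h1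
  rw [max_eq_left h2.le] at h1
  have h3 : D.dσ t (v t) (σ t) = -(ε * derivWithin σ (Icc 0 D.T) t) := by rw [h1, neg_neg]
  have h4 := (WithLp.prodContinuousLinearEquiv 2 ℝ G.V ℝ).symm.hasFDerivAt.comp_hasDerivAt t
    (hv.prodMk hσ)
  rw [N_eq ha hb hF (h.σ_mem t htI) (h.v_eq t htI), h3]
  have h5 : -(ε⁻¹ • WithLp.toLp 2 (-(ε • derivWithin v (Icc 0 D.T) t),
      -(ε * derivWithin σ (Icc 0 D.T) t))) =
      WithLp.toLp 2 (derivWithin v (Icc 0 D.T) t, derivWithin σ (Icc 0 D.T) t) := by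
    apply WithLp.ofLp_injective 2
    refine Prod.ext ?_ ?_
    · change -(ε⁻¹ • -(ε • derivWithin v (Icc 0 D.T) t)) = derivWithin v (Icc 0 D.T) t
      rw [smul_neg, neg_neg, inv_smul_smul₀ hε.ne']
    · change -(ε⁻¹ * -(ε * derivWithin σ (Icc 0 D.T) t)) = derivWithin σ (Icc 0 D.T) t
      field_simp
  rw [h5]
  exact h4

end CrackData

end CrackGrowth

theorem theorem4p2 (G : CrackGrowth.CrackGeometry) (D : CrackGrowth.CrackData G)
    (t₀ : ℝ) (ht₀ : t₀ ∈ Ico 0 D.T) (v₀ : G.V) (s₀ : ℝ) (hs₀ : s₀ ∈ Ico G.σ₀ G.σ₁)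
    (hgrad : D.IsGradV t₀ v₀ s₀ 0) (hdσ : D.dσ t₀ v₀ s₀ = 0)
    (hpos : ∃ α : ℝ, 0 < α ∧ ∀ (w : G.V) (τ : ℝ),
      α * (‖w‖ ^ 2 + |τ| ^ 2) ≤ D.hessian t₀ v₀ s₀ (w, τ) (w, τ)) :
    ∃ tmax ∈ Ioc t₀ D.T, ∀ t₁ ∈ Ioc t₀ tmax,
      -- existence of the branch, when the crack length can vary in both directions
      (G.σ₀ < s₀ → ∃ (v : ℝ → G.V) (σ : ℝ → ℝ),
        D.IsBranch t₀ t₁ (Icc G.σ₀ G.σ₁) v₀ s₀ v σ) ∧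
      -- uniqueness of the branch
      (∀ (v v' : ℝ → G.V) (σ σ' : ℝ → ℝ),
        D.IsBranch t₀ t₁ (Icc G.σ₀ G.σ₁) v₀ s₀ v σ →
        D.IsBranch t₀ t₁ (Icc G.σ₀ G.σ₁) v₀ s₀ v' σ' →
        ∀ t ∈ Icc t₀ t₁, v t = v' t ∧ σ t = σ' t) ∧
      -- existence of the branch and convergence along increasing solutions of the flow
      (∀ (u₀ : G.V) (vε : ℝ → ℝ → G.V) (σε : ℝ → ℝ → ℝ),
        (∀ ε > 0, D.IsFlow u₀ ε (vε ε) (σε ε)) →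
        Tendsto (fun ε => vε ε t₀) (𝓝[>] 0) (𝓝 v₀) →
        Tendsto (fun ε => σε ε t₀) (𝓝[>] 0) (𝓝 s₀) →
        (∀ᶠ ε in 𝓝[>] (0 : ℝ),
          (∀ t ∈ Ioc t₀ t₁, 0 < derivWithin (σε ε) (Icc 0 D.T) t) ∧
          (∀ t ∈ Icc t₀ t₁, σε ε t < G.σ₁)) →
        ∃ (v : ℝ → G.V) (σ : ℝ → ℝ),
          D.IsBranch t₀ t₁ (Icc s₀ G.σ₁) v₀ s₀ v σ ∧
          ∀ t ∈ Icc t₀ t₁,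
            Tendsto (fun ε => vε ε t) (𝓝[>] 0) (𝓝 (v t)) ∧
            Tendsto (fun ε => σε ε t) (𝓝[>] 0) (𝓝 (σ t))) := by
  obtain ⟨F, ha, hb, hT, hF⟩ := D.exists_loadedEnergy
  obtain ⟨α, hα, hpos⟩ := hpos
  have hs₀' : s₀ ∈ Icc G.σ₀ G.σbar := ⟨hs₀.1, hs₀.2.le.trans G.σ₁_lt_σbar.le⟩
  -- Within distance r the crack length stays at most σ₁, and at least σ₀ when s₀ > σ₀. For s₀ = σ₀
  -- every ball leaves the strip and no lower constraint can be met, so the fixed point argument is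
  -- confined to the first claim.
  obtain ⟨r, hr, hr1, hr2⟩ : ∃ r > 0, r ≤ G.σ₁ - s₀ ∧ (G.σ₀ < s₀ → r ≤ s₀ - G.σ₀) := by
    have h1 : 0 < G.σ₁ - s₀ := sub_pos.2 hs₀.2
    by_cases h : G.σ₀ < s₀
    · exact ⟨_, lt_min h1 (sub_pos.2 h), min_le_left _ _, fun _ => min_le_right _ _⟩
    · exact ⟨_, h1, le_rfl, fun h' => absurd h' h⟩
  obtain ⟨ρ, T', m, L, M, hρr, hT', H⟩ := F.exists_monoFamily (t₀ := t₀)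
    (x₀ := WithLp.toLp 2 (v₀, s₀)) (by rwa [hT]) (by rw [ha, hb]; exact hs₀')
    ((CrackGrowth.CrackData.N_eq_zero_iff ha hb hF hs₀').2 ⟨hgrad, hdσ⟩) hα (fun x => by
      rw [← CrackGrowth.CrackData.hessian_eq ha hb hF hs₀', WithLp.prod_norm_sq_eq_of_L2]
      exact hpos x.fst x.snd) hr
  rw [hT] at hT'
  have hsnd : ∀ x ∈ Metric.closedBall (WithLp.toLp 2 (v₀, s₀)) ρ, |x.snd - s₀| ≤ ρ := by
    intro x hx
    rw [Metric.mem_closedBall, dist_eq_norm] at hx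
    exact (WithLp.norm_snd_le _ (x - WithLp.toLp 2 (v₀, s₀))).trans hx
  have hle : ∀ x ∈ Metric.closedBall (WithLp.toLp 2 (v₀, s₀)) ρ, x.snd ≤ G.σ₁ := fun x hx => by
    linarith [(abs_le.1 (hsnd x hx)).2]
  refine ⟨T', hT', fun t₁ ht₁ => ⟨fun hlt => ?_, ?_, ?_⟩⟩
  · have hball : ∀ x ∈ Metric.closedBall (WithLp.toLp 2 (v₀, s₀)) ρ, x.snd ∈ Icc G.σ₀ G.σ₁ :=
      fun x hx => ⟨by linarith [(abs_le.1 (hsnd x hx)).1, hr2 hlt], hle x hx⟩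
    have hS : Metric.closedBall (WithLp.toLp 2 (v₀, s₀)) ρ ⊆
        {x : WithLp 2 (G.V × ℝ) | x.snd ∈ Icc F.a F.b} := fun x hx => by
      rw [mem_ofPred_eq, ha, hb]
      exact Icc_subset_Icc_right G.σ₁_lt_σbar.le (hball x hx)
    have hex : ∀ t ∈ Icc t₀ t₁, ∃ x ∈ Metric.closedBall (WithLp.toLp 2 (v₀, s₀)) ρ, F.N t x = 0 :=
      fun t ht => H.exists_zero hS ⟨ht.1, ht.2.trans ht₁.2⟩
    choose! w hw hw0 using hex
    exact ⟨_, _, CrackGrowth.CrackData.isBranch_of_zeros ha hb hF H ht₁.1.le ht₁.2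
      (fun t ht => ⟨⟨hS (hw t ht), hw t ht⟩, hw0 t ht⟩) fun t ht => hball _ (hw t ht)⟩
  · intro v v' σ σ' h h' t ht
    have h1 := h.curve_mem ha hb hF H ht₁.2 t ht
    have h2 := h'.curve_mem ha hb hF H ht₁.2 t ht
    have h3 := H.norm_sub_le ⟨ht.1, ht.2.trans ht₁.2⟩ h1.1 h2.1
    rw [h1.2, h2.2, sub_self, norm_zero] at h3
    have h4 : ‖WithLp.toLp 2 (v t, σ t) - WithLp.toLp 2 (v' t, σ' t)‖ ≤ 0 := by
      by_contra hcon
      push Not at hcon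
      linarith [mul_pos H.m_pos hcon]
    have h5 := WithLp.toLp_injective 2 (sub_eq_zero.1 (norm_le_zero_iff.1 h4))
    exact Prod.mk_inj.1 h5
  · intro u₀ vε σε hflow hv hσ hmono
    have hS : IsClosed {x : WithLp 2 (G.V × ℝ) | x.snd ∈ Icc F.a F.b} :=
      isClosed_Icc.preimage (WithLp.sndL 2 ℝ G.V ℝ).continuous
    have h0T : ∀ t ∈ Icc t₀ t₁, t ∈ Icc 0 D.T := fun t ht =>
      ⟨ht₀.1.trans ht.1, ht.2.trans (ht₁.2.trans hT'.2)⟩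
    obtain ⟨w, hw⟩ := H.exists_flow_limit hS ht₁.1 ht₁.2
      (z := fun ε t => WithLp.toLp 2 (vε ε t, σε ε t))
      (((WithLp.prod_continuous_toLp 2 G.V ℝ).tendsto (v₀, s₀)).comp (hv.prodMk_nhds hσ)) (by
        filter_upwards [hmono, self_mem_nhdsWithin] with ε h1 h2
        have hf := hflow ε h2
        refine ⟨?_, fun t ht => ?_, fun t ht => ?_⟩
        · exact (WithLp.prod_continuous_toLp 2 G.V ℝ).comp_continuousOn
            ((hf.contDiffOn_v.continuousOn.mono h0T).prodMk (hf.contDiffOn_σ.continuousOn.mono h0T))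
        · change σε ε t ∈ Icc F.a F.b
          rw [ha, hb]
          exact hf.σ_mem t (h0T t ht)
        · exact hf.hasDerivAt ha hb hF h2 ⟨ht₀.1.trans_lt ht.1, ht.2.trans_le (ht₁.2.trans hT'.2)⟩
            (h1.1 t ⟨ht.1, ht.2.le⟩) (h1.2 t (Ioo_subset_Icc_self ht)))
    have hlim : ∀ t ∈ Icc t₀ t₁, Tendsto (fun ε => vε ε t) (𝓝[>] 0) (𝓝 (w t).fst) ∧
        Tendsto (fun ε => σε ε t) (𝓝[>] 0) (𝓝 (w t).snd) := fun t ht =>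
      ⟨((WithLp.fstL 2 ℝ G.V ℝ).continuous.tendsto (w t)).comp (hw t ht).2.2,
        ((WithLp.sndL 2 ℝ G.V ℝ).continuous.tendsto (w t)).comp (hw t ht).2.2⟩
    refine ⟨_, _, CrackGrowth.CrackData.isBranch_of_zeros ha hb hF H ht₁.1.le ht₁.2
      (fun t ht => ⟨(hw t ht).1, (hw t ht).2.1⟩) fun t ht => ⟨?_, hle _ (hw t ht).1.2⟩, hlim⟩
    -- The lower bound s₀ comes from the monotonicity of the approximating crack lengths.
    refine le_of_tendsto_of_tendsto hσ (hlim t ht).2 ?_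
    filter_upwards [self_mem_nhdsWithin] with ε hε
    exact (hflow ε hε).monotoneOn_σ (h0T t₀ (left_mem_Icc.2 ht₁.1.le)) (h0T t ht) ht.1
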